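/- Let $\Lambda=(-1,1)$ and $\omega^{a,a}(x)=(1-x^2)^a$. Let $\tilde v$ be the extension by zero of a function $v:\Lambda\to\mathbb C$, and for $\alpha>0$ let $H^\alpha_*(\Lambda)=\{v:\tilde v\in H^\alpha(\mathbb R)\}$. For $s\ge 0$ let $D^s v$ be the Riesz fractional derivative, i.e. the distribution with $\mathscr F(D^s v)(\xi)=(-1)^{\lfloor (s+1)/2\rfloor}|\xi|^s\,\mathscr F\tilde v(\xi)$, which may be restricted to $\Lambda$. Let $\mathcal J_n^{-\alpha,-\alpha}(x)=(1-x^2)^\alpha P_n^{\alpha,\alpha}(x)$ on $\Lambda$, extended by zero ($P_n^{\alpha,\alpha}$ the Jacobi polynomials), and let $\mathbb F_N=\operatorname{span}\{\mathcal J_n^{-\alpha,-\alpha}:0\le n\le N\}$. Let $\alpha>0$, $\nu\in\{0,1,\dots,\lfloor\alpha\rfloor\}$, and let $m\ge 0$ be an integer with $m\ge 2\nu-\lfloor\alpha\rfloor$. Let $$\mathcal B^m_{\alpha,\nu}(\Lambda)=\Big\{v\in L^2_{\omega^{-\alpha,-\alpha}}(\Lambda):\ \tfrac{d^l}{dx^l}D^{2\alpha-2\nu}v\in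 L^2_{\omega^{\alpha-2\nu+l,\alpha-2\nu+l}}(\Lambda),\ 0\le l\le m\Big\},$$ where the derivatives are taken in the sense of distributions on $\Lambda$. Let $I=\Lambda$ or $I=\mathbb R$, and let $(\cdot,\cdot)$ and $\|\cdot\|$ be the inner product and the norm of $L^2(I)$. Then there is a constant $C>0$, depending only on $\alpha,\nu,m$, such that for every integer $N\ge 1$ with $N+1\ge m-2\nu$ and every $u\in H^\alpha_*(\Lambda)\cap\mathcal B^m_{\alpha,\nu}(\Lambda)$ there is exactly one $\Pi_N u\in\mathbb F_N$ with $(D^\alpha(\Pi_N u-u),D^\alpha v)=0$ for all $v\in\mathbb F_N$, and $$\|D^\alpha(\Pi_N u-u)\|\le C\,N^{2\nu-\alpha-m}\,\Big\|\tfrac{d^m}{dx^m}D^{2\alpha-2\nu}u\Big\|_{L^2_{\omega^{\alpha-2\nu+m,\alpha-2\nu+m}}(\Lambda)}.$$ -/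

import Mathlib

open MeasureTheory Set
open scoped FourierTransform SchwartzMap Distributions ENNReal ContDiff

noncomputable section

namespace RieszJacobi

/-- The interval `(-1, 1)`, as an open subset of the line. -/
def Lam : TopologicalSpace.Opens ℝ := ⟨Ioo (-1) 1, isOpen_Ioo⟩

/-- The extension by zero of (the restriction to `(-1, 1)` of) `v`. -/
def zeroExt (v : ℝ → ℂ) : ℝ → ℂ := (Ioo (-1 : ℝ) 1).indicator v

/-- The measure `(1 - x) ^ a (1 + x) ^ a dx` on `(-1, 1)`; `L²` of it is the weighted space
`L²_{ω^{a,a}}(-1, 1)`. -/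
def jacobiMeasure (a : ℝ) : Measure ℝ :=
  (volume.restrict (Ioo (-1) 1)).withDensity
    (fun x => ENNReal.ofReal ((1 - x) ^ a * (1 + x) ^ a))

/-- The Riesz derivative of order `s ≥ 0` of a test function on the line: the operator with
symbol `(-1) ^ ⌊(s + 1) / 2⌋ |ξ| ^ s` for the Fourier transform `∫ φ(x) e^{-iξx} dx`. Mathlib's
transform is `∫ φ(x) e^{-2πiξx} dx`, hence the factor `2π`. -/
def rieszTest (s : ℝ) (φ : ℝ → ℂ) (x : ℝ) : ℂ :=
  (-1) ^ ⌊(s + 1) / 2⌋₊ *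
    𝓕⁻ (fun ξ : ℝ => ((|2 * Real.pi * ξ| ^ s : ℝ) : ℂ) * 𝓕 φ ξ) x

/-- `g = (d/dx)^l D^s v` on the open set `I`, in the sense of distributions, where `D^s v` is the
Riesz derivative of order `s` of the zero extension of a function `v` on `(-1, 1)`. The operator
`D^s` is symmetric for the bilinear pairing, and `(d/dx)^l` is transposed to
`(-1)^l (d/dx)^l`. -/
def IsRieszDeriv (I : TopologicalSpace.Opens ℝ) (s : ℝ) (l : ℕ) (v g : ℝ → ℂ) : Prop :=
  LocallyIntegrableOn g I volume ∧
    ∀ φ : 𝓓(I, ℂ),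
      ∫ x in (I : Set ℝ), g x * φ x = (-1) ^ l * ∫ x, zeroExt v x * rieszTest s (iteratedDeriv l φ) x

/-- Membership in `H^s_*(-1, 1)` for `s ≥ 0`: the zero extension lies in `H^s(ℝ)`. -/
def MemHStar (s : ℝ) (v : ℝ → ℂ) : Prop :=
  ∃ h : MemLp (zeroExt v) 2 volume,
    TemperedDistribution.MemSobolev s 2 ((h.toLp (zeroExt v) : Lp ℂ 2 (volume : Measure ℝ)) : 𝓢'(ℝ, ℂ))

/-- Membership in `B^m_{α,ν}(-1, 1)`. -/
def MemB (α : ℝ) (ν m : ℕ) (v : ℝ → ℂ) : Prop :=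
  MemLp v 2 (jacobiMeasure (-α)) ∧
    ∀ l ≤ m, ∃ g, IsRieszDeriv Lam (2 * α - 2 * ν) l v g ∧
      MemLp g 2 (jacobiMeasure (α - 2 * ν + l))

/-- The classical Jacobi polynomial `P_n^{a,b}` for `a, b > -1`, evaluated at `x`:
`∑ₛ C(n + a, n - s) C(n + b, s) ((x - 1) / 2)^s ((x + 1) / 2)^(n - s)`. -/
def jacobiP (n : ℕ) (a b x : ℝ) : ℝ :=
  ∑ s ∈ Finset.range (n + 1),
    Real.Gamma (n + a + 1) / ((n - s).factorial * Real.Gamma (a + s + 1)) *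
      (Real.Gamma (n + b + 1) / (s.factorial * Real.Gamma (n + b - s + 1))) *
      ((x - 1) / 2) ^ s * ((x + 1) / 2) ^ (n - s)

/-- The generalized Jacobi function `(1 - x²)^α P_n^{α,α}(x)` on `(-1, 1)`, extended by zero. -/
def jacobiFun (α : ℝ) (n : ℕ) : ℝ → ℂ :=
  zeroExt (fun x => (((1 - x ^ 2) ^ α * jacobiP n α α x : ℝ) : ℂ))

/-- The span of the first `N + 1` generalized Jacobi functions. -/
def jacobiSpace (α : ℝ) (N : ℕ) : Submodule ℂ (ℝ → ℂ) :=
  Submodule.span ℂ (jacobiFun α '' {n | n ≤ N})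

/-- `(D^α v, D^α z)_{L²(I)} = 0`, both derivatives being square integrable functions on `I`. -/
def RieszOrthogonal (I : TopologicalSpace.Opens ℝ) (α : ℝ) (v z : ℝ → ℂ) : Prop :=
  ∃ g h : ℝ → ℂ, IsRieszDeriv I α 0 v g ∧ IsRieszDeriv I α 0 z h ∧
    MemLp g 2 (volume.restrict I) ∧ MemLp h 2 (volume.restrict I) ∧
    ∫ x in (I : Set ℝ), g x * (starRingEnd ℂ) (h x) = 0

/-- `w` is a `(D^α ·, D^α ·)_{L²(I)}`-orthogonal projection of `u` onto `jacobiSpace α N`. -/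
def IsRieszProj (I : TopologicalSpace.Opens ℝ) (α : ℝ) (N : ℕ) (u w : ℝ → ℂ) : Prop :=
  w ∈ jacobiSpace α N ∧ ∀ v ∈ jacobiSpace α N, RieszOrthogonal I α (w - u) v

end RieszJacobi

end

noncomputable section

namespace RieszJacobi

/-! ### Riesz derivatives of test functions -/

/-- Smooth functions with compact support on the line. -/
structure IsTest (φ : ℝ → ℂ) : Prop where
  contDiff : ContDiff ℝ ∞ φ
  hasCompactSupport : HasCompactSupport φ

/-- The symbol `|2πξ| ^ s`. -/
def symb (s ξ : ℝ) : ℂ := ((|2 * Real.pi * ξ| ^ s : ℝ) : ℂ)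

/-- The sign in the definition of the Riesz derivative. -/
def rsign (s : ℝ) : ℂ := (-1) ^ ⌊(s + 1) / 2⌋₊

lemma rieszTest_eq (s : ℝ) (φ : ℝ → ℂ) (x : ℝ) :
    rieszTest s φ x = rsign s * 𝓕⁻ (fun ξ => symb s ξ * 𝓕 φ ξ) x := rfl

lemma rsign_mul_self (s : ℝ) : rsign s * rsign s = 1 := by
  unfold rsign
  rw [← mul_pow]; simp

lemma norm_rsign (s : ℝ) : ‖rsign s‖ = 1 := by simp [rsign]

lemma rsign_ne_zero (s : ℝ) : rsign s ≠ 0 := by simp [rsign]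

lemma rsign_add_two {s : ℝ} (hs : 0 ≤ s) : rsign (s + 2) = -rsign s := by
  unfold rsign
  rw [show (s + 2 + 1) / 2 = (s + 1) / 2 + 1 by ring, Nat.floor_add_one (by positivity), pow_succ]
  ring

lemma continuous_symb {s : ℝ} (hs : 0 ≤ s) : Continuous (symb s) := by
  unfold symb
  refine Complex.continuous_ofReal.comp ?_
  exact Continuous.rpow_const (by fun_prop) (fun _ => Or.inr hs)

lemma symb_add_two {s : ℝ} (hs : 0 ≤ s) (ξ : ℝ) :
    symb (s + 2) ξ = -(2 * Real.pi * Complex.I * ξ) ^ 2 * symb s ξ := by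
  unfold symb
  have : (|2 * Real.pi * ξ| ^ (s + 2) : ℝ) = (2 * Real.pi * ξ) ^ 2 * |2 * Real.pi * ξ| ^ s := by
    rw [Real.rpow_add_of_nonneg (abs_nonneg _) hs (by norm_num), Real.rpow_two, sq_abs]; ring
  rw [this]
  push_cast
  ring_nf
  simp

lemma symb_add {s t : ℝ} (hs : 0 ≤ s) (ht : 0 ≤ t) (ξ : ℝ) :
    symb (s + t) ξ = symb s ξ * symb t ξ := by
  unfold symb
  rw [Real.rpow_add_of_nonneg (abs_nonneg _) hs ht]; push_cast; rfl

lemma symb_neg (s ξ : ℝ) : symb s (-ξ) = symb s ξ := by simp [symb]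

lemma conj_symb (s ξ : ℝ) : (starRingEnd ℂ) (symb s ξ) = symb s ξ := by
  simp [symb, Complex.conj_ofReal]

lemma norm_symb (s ξ : ℝ) : ‖symb s ξ‖ = |2 * Real.pi * ξ| ^ s := by
  rw [symb, Complex.norm_real, Real.norm_eq_abs, abs_of_nonneg (by positivity)]

lemma hasDerivAt_mul_abs_rpow {s : ℝ} (hs : 0 < s) (x : ℝ) :
    HasDerivAt (fun x : ℝ => x * |x| ^ s) ((s + 1) * |x| ^ s) x := by
  rcases lt_trichotomy x 0 with hx | hx | hx
  · have h1 : HasDerivAt (fun x : ℝ => x * (-x) ^ s) (1 * (-x) ^ s + x * (-1 * s * (-x) ^ (s - 1))) x :=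
      (hasDerivAt_id x).mul ((hasDerivAt_neg x).rpow_const (Or.inl (by linarith)))
    have h2 : (fun x : ℝ => x * |x| ^ s) =ᶠ[nhds x] fun x => x * (-x) ^ s := by
      filter_upwards [gt_mem_nhds hx] with y hy
      rw [abs_of_neg hy]
    refine (h1.congr_of_eventuallyEq h2).congr_deriv ?_
    rw [abs_of_neg hx]
    have : (-x) ^ s = (-x) ^ (s - 1) * (-x) := by
      rw [← Real.rpow_add_one (by linarith)]; ring_nf
    rw [this]; ring
  · subst hx
    rw [hasDerivAt_iff_tendsto_slope]
    have h0 : Filter.Tendsto (fun x : ℝ => |x| ^ s) (nhds 0) (nhds 0) := by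
      have : Continuous (fun x : ℝ => |x| ^ s) :=
        Continuous.rpow_const (by fun_prop) (fun _ => Or.inr hs.le)
      simpa [Real.zero_rpow hs.ne'] using this.tendsto 0
    have : (s + 1) * |(0 : ℝ)| ^ s = 0 := by simp [Real.zero_rpow hs.ne']
    rw [this]
    refine (h0.mono_left nhdsWithin_le_nhds).congr' ?_
    filter_upwards [self_mem_nhdsWithin] with y hy
    have : y ≠ 0 := hy
    simp [slope_def_field]
    field_simp
  · have h1 : HasDerivAt (fun x : ℝ => x * x ^ s) (1 * x ^ s + x * (s * x ^ (s - 1))) x := by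
      simpa using! (hasDerivAt_id x).mul ((hasDerivAt_id x).rpow_const (p := s) (Or.inl hx.ne'))
    have h2 : (fun x : ℝ => x * |x| ^ s) =ᶠ[nhds x] fun x => x * x ^ s := by
      filter_upwards [lt_mem_nhds hx] with y hy
      rw [abs_of_pos hy]
    refine (h1.congr_of_eventuallyEq h2).congr_deriv ?_
    rw [abs_of_pos hx]
    have : x ^ s = x ^ (s - 1) * x := by
      rw [← Real.rpow_add_one hx.ne']; ring_nf
    rw [this]; ring

lemma hasDerivAt_mul_symb {s : ℝ} (hs : 0 < s) (ξ : ℝ) :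
    HasDerivAt (fun ξ : ℝ => (ξ : ℂ) * symb s ξ) ((s + 1) * symb s ξ) ξ := by
  have h := (hasDerivAt_mul_abs_rpow hs (2 * Real.pi * ξ)).scomp ξ
    ((hasDerivAt_id ξ).const_mul (2 * Real.pi))
  have h3 := (h.const_mul (1 / (2 * Real.pi))).ofReal_comp
  have hpi : (2 * Real.pi) ≠ 0 := by positivity
  have hpi' : (Real.pi : ℂ) ≠ 0 := by exact_mod_cast Real.pi_ne_zero
  convert! h3 using 1
  · ext y
    simp only [Function.comp, symb]
    push_cast
    field_simp
  · simp only [symb]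
    push_cast
    simp
    field_simp

lemma fourier_const_mul (c : ℂ) (f : ℝ → ℂ) (ξ : ℝ) :
    𝓕 (fun x => c * f x) ξ = c * 𝓕 f ξ := by
  simp only [Real.fourier_real_eq_integral_exp_smul, ← integral_const_mul, smul_eq_mul]
  congr 1; funext x; ring

lemma fourier_fun_add {f g : ℝ → ℂ} (hf : Integrable f) (hg : Integrable g) (ξ : ℝ) :
    𝓕 (fun x => f x + g x) ξ = 𝓕 f ξ + 𝓕 g ξ := by
  simp only [Real.fourier_real_eq]
  have h : ∀ {f : ℝ → ℂ}, Integrable f → Integrable (fun v : ℝ => Real.fourierChar (-(v * ξ)) • f v) := by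
    intro f hf
    simpa [mul_comm] using! (Real.fourierIntegral_convergent_iff ξ).2 hf
  rw [← integral_add (h hf) (h hg)]
  simp only [smul_add]

namespace IsTest

variable {φ ψ : ℝ → ℂ}

lemma continuous (h : IsTest φ) : Continuous φ := h.contDiff.continuous

lemma differentiable (h : IsTest φ) : Differentiable ℝ φ :=
  h.contDiff.differentiable (by simp)

lemma integrable (h : IsTest φ) : Integrable φ :=
  h.continuous.integrable_of_hasCompactSupport h.hasCompactSupport

lemma deriv (h : IsTest φ) : IsTest (deriv φ) :=
  ⟨((contDiff_infty_iff_deriv).1 h.contDiff).2, h.hasCompactSupport.deriv⟩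

lemma iteratedDeriv (h : IsTest φ) (n : ℕ) : IsTest (iteratedDeriv n φ) := by
  induction n with
  | zero => simpa using h
  | succ n ih => rw [iteratedDeriv_succ]; exact ih.deriv

lemma smooth_mul {a : ℝ → ℂ} (ha : ContDiff ℝ ∞ a) (h : IsTest φ) : IsTest (fun x => a x * φ x) :=
  ⟨ha.mul h.contDiff, h.hasCompactSupport.mul_left⟩

lemma const_mul (c : ℂ) (h : IsTest φ) : IsTest (fun x => c * φ x) :=
  h.smooth_mul contDiff_const

lemma add (h : IsTest φ) (h' : IsTest ψ) : IsTest (fun x => φ x + ψ x) :=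
  ⟨h.contDiff.add h'.contDiff, h.hasCompactSupport.add h'.hasCompactSupport⟩

lemma id_mul (h : IsTest φ) : IsTest (fun x => (x : ℂ) * φ x) :=
  h.smooth_mul Complex.ofRealCLM.contDiff

lemma integrable_pow_mul_fourier (h : IsTest φ) (n : ℕ) :
    Integrable (fun ξ : ℝ => |ξ| ^ n * ‖𝓕 φ ξ‖) := by
  have := (𝓕 (h.hasCompactSupport.toSchwartzMap h.contDiff)).integrable_pow_mul volume n
  simpa using! this

lemma continuous_fourier (h : IsTest φ) : Continuous (𝓕 φ) := by
  have := (𝓕 (h.hasCompactSupport.toSchwartzMap h.contDiff)).continuous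
  simpa using! this

lemma integrable_rpow_mul_fourier (h : IsTest φ) {s : ℝ} (hs : 0 ≤ s) :
    Integrable (fun ξ : ℝ => |ξ| ^ s * ‖𝓕 φ ξ‖) := by
  have h0 := (h.integrable_pow_mul_fourier 0).add (h.integrable_pow_mul_fourier ⌈s⌉₊)
  refine h0.mono' ?_ (Filter.Eventually.of_forall fun ξ => ?_)
  · refine Continuous.aestronglyMeasurable ?_
    exact (Continuous.rpow_const (by fun_prop) (fun _ => Or.inr hs)).mul h.continuous_fourier.norm
  · rw [Real.norm_of_nonneg (by positivity)]
    simp only [Pi.add_apply, pow_zero, ← add_mul]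
    refine mul_le_mul_of_nonneg_right ?_ (norm_nonneg _)
    rcases le_total |ξ| 1 with h1 | h1
    · have := Real.rpow_le_one (abs_nonneg ξ) h1 hs
      have : 0 ≤ |ξ| ^ ⌈s⌉₊ := by positivity
      linarith
    · have := Real.rpow_le_rpow_of_exponent_le h1 (Nat.le_ceil s)
      rw [Real.rpow_natCast] at this
      linarith

lemma integrable_symb_mul_fourier (h : IsTest φ) {s : ℝ} (hs : 0 ≤ s) :
    Integrable (fun ξ => symb s ξ * 𝓕 φ ξ) := by
  refine ((h.integrable_rpow_mul_fourier hs).const_mul ((2 * Real.pi) ^ s)).mono'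
    (((continuous_symb hs).mul h.continuous_fourier).aestronglyMeasurable)
    (Filter.Eventually.of_forall fun ξ => ?_)
  rw [norm_mul, norm_symb, abs_mul, Real.mul_rpow (abs_nonneg _) (abs_nonneg _),
    abs_of_pos (by positivity), mul_assoc]

lemma fourier_deriv (h : IsTest φ) (ξ : ℝ) :
    𝓕 (_root_.deriv φ) ξ = 2 * Real.pi * Complex.I * ξ * 𝓕 φ ξ := by
  rw [Real.fourier_deriv h.integrable h.differentiable h.deriv.integrable]
  exact smul_eq_mul _ _

lemma fourier_iteratedDeriv (h : IsTest φ) (n : ℕ) (ξ : ℝ) :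
    𝓕 (_root_.iteratedDeriv n φ) ξ = (2 * Real.pi * Complex.I * ξ) ^ n * 𝓕 φ ξ := by
  induction n with
  | zero => simp
  | succ n ih => rw [iteratedDeriv_succ, (h.iteratedDeriv n).fourier_deriv, ih]; ring

lemma hasDerivAt_fourier (h : IsTest φ) (ξ : ℝ) :
    HasDerivAt (𝓕 φ) (-2 * Real.pi * Complex.I * 𝓕 (fun x : ℝ => (x : ℂ) * φ x) ξ) ξ := by
  have := Real.hasDerivAt_fourier h.integrable (by simpa using h.id_mul.integrable) ξ
  convert! this using 1
  rw [← fourier_const_mul]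
  refine congrArg (fun f : ℝ → ℂ => 𝓕 f ξ) (funext fun x => ?_)
  simp [mul_assoc]

end IsTest

lemma hasDerivAt_fourierInv {f : ℝ → ℂ} (hf : Integrable f)
    (hf' : Integrable (fun ξ : ℝ => (ξ : ℂ) * f ξ)) (x : ℝ) :
    HasDerivAt (𝓕⁻ f) (𝓕⁻ (fun ξ : ℝ => 2 * Real.pi * Complex.I * ξ * f ξ) x) x := by
  have h := (Real.hasDerivAt_fourier hf (by simpa using hf') (-x)).scomp x (hasDerivAt_neg x)
  have e : 𝓕⁻ f = (𝓕 f) ∘ Neg.neg := by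
    ext y; rw [Real.fourierInv_eq_fourier_neg]; rfl
  rw [e]
  refine h.congr_deriv ?_
  rw [Real.fourierInv_eq_fourier_neg, neg_one_smul, ← neg_one_mul, ← fourier_const_mul]
  refine congrArg (fun f : ℝ → ℂ => 𝓕 f (-x)) (funext fun ξ => ?_)
  simp

section Riesz

variable {φ : ℝ → ℂ} {s : ℝ}

lemma rieszTest_hasDerivAt (h : IsTest φ) (hs : 0 ≤ s) (x : ℝ) :
    HasDerivAt (rieszTest s φ) (rieszTest s (deriv φ) x) x := by
  have h1 := h.integrable_symb_mul_fourier hs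
  have h2 : Integrable (fun ξ : ℝ => (ξ : ℂ) * (symb s ξ * 𝓕 φ ξ)) := by
    have := (h.deriv.integrable_symb_mul_fourier hs).const_mul (1 / (2 * Real.pi * Complex.I))
    refine this.congr (Filter.Eventually.of_forall fun ξ => ?_)
    simp only [h.fourier_deriv]
    have : (Real.pi : ℂ) ≠ 0 := by exact_mod_cast Real.pi_ne_zero
    field_simp
  have h3 := (hasDerivAt_fourierInv h1 h2 x).const_mul (rsign s)
  refine h3.congr_deriv ?_
  rw [rieszTest_eq]
  refine congrArg (fun f : ℝ → ℂ => rsign s * 𝓕⁻ f x) (funext fun ξ => ?_)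
  rw [h.fourier_deriv]; ring

lemma deriv_rieszTest (h : IsTest φ) (hs : 0 ≤ s) :
    deriv (rieszTest s φ) = rieszTest s (deriv φ) := by
  ext x; exact (rieszTest_hasDerivAt h hs x).deriv

lemma continuous_rieszTest (h : IsTest φ) (hs : 0 ≤ s) : Continuous (rieszTest s φ) :=
  continuous_iff_continuousAt.2 fun x => (rieszTest_hasDerivAt h hs x).continuousAt

lemma rieszTest_add_two (h : IsTest φ) (hs : 0 ≤ s) :
    rieszTest (s + 2) φ = rieszTest s (deriv (deriv φ)) := by
  ext x
  rw [rieszTest_eq, rieszTest_eq, rsign_add_two hs, neg_mul, ← mul_neg]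
  congr 1
  simp only [Real.fourierInv_eq_fourier_neg]
  rw [← neg_one_mul, ← fourier_const_mul]
  refine congrArg (fun f : ℝ → ℂ => 𝓕 f (-x)) (funext fun ξ => ?_)
  rw [h.deriv.fourier_deriv, h.fourier_deriv, symb_add_two hs]
  ring

lemma fourierInv_add' {f g : ℝ → ℂ} (hf : Integrable f) (hg : Integrable g) (x : ℝ) :
    𝓕⁻ (fun ξ => f ξ + g ξ) x = 𝓕⁻ f x + 𝓕⁻ g x := by
  simp only [Real.fourierInv_eq_fourier_neg]
  exact fourier_fun_add hf hg (-x)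

lemma fourierInv_const_mul (c : ℂ) (f : ℝ → ℂ) (x : ℝ) :
    𝓕⁻ (fun ξ => c * f ξ) x = c * 𝓕⁻ f x := by
  simp only [Real.fourierInv_eq_fourier_neg]
  exact fourier_const_mul c f (-x)

lemma rieszTest_add {ψ : ℝ → ℂ} (h : IsTest φ) (h' : IsTest ψ) (hs : 0 ≤ s) (x : ℝ) :
    rieszTest s (fun x => φ x + ψ x) x = rieszTest s φ x + rieszTest s ψ x := by
  rw [rieszTest_eq, rieszTest_eq, rieszTest_eq, ← mul_add,
    ← fourierInv_add' (h.integrable_symb_mul_fourier hs) (h'.integrable_symb_mul_fourier hs)]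
  refine congrArg (fun f : ℝ → ℂ => rsign s * 𝓕⁻ f x) (funext fun ξ => ?_)
  rw [← mul_add, fourier_fun_add h.integrable h'.integrable]

lemma rieszTest_const_mul (c : ℂ) (φ : ℝ → ℂ) (x : ℝ) :
    rieszTest s (fun x => c * φ x) x = c * rieszTest s φ x := by
  rw [rieszTest_eq, rieszTest_eq, mul_left_comm c, ← fourierInv_const_mul c]
  refine congrArg (fun f : ℝ → ℂ => rsign s * 𝓕⁻ f x) (funext fun ξ => ?_)
  rw [mul_left_comm, fourier_const_mul]

lemma rieszTest_comp_neg (φ : ℝ → ℂ) (x : ℝ) :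
    rieszTest s (fun x => φ (-x)) x = rieszTest s φ (-x) := by
  have h1 : ∀ ξ, 𝓕 (fun x => φ (-x)) ξ = 𝓕 φ (-ξ) := by
    intro ξ
    rw [Real.fourier_real_eq, Real.fourier_real_eq, ← integral_neg_eq_self]
    simp
  rw [rieszTest_eq, rieszTest_eq]
  congr 1
  simp only [h1, Real.fourierInv_eq_fourier_neg, Real.fourier_real_eq]
  rw [← integral_neg_eq_self]
  simp [symb_neg]

/-- Euler's identity `D^s (x φ') = x (D^s φ)' + s D^s φ`. -/
lemma rieszTest_id_mul_deriv (h : IsTest φ) (hs : 0 < s) (x : ℝ) :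
    rieszTest s (fun x : ℝ => (x : ℂ) * deriv φ x) x =
      x * rieszTest s (deriv φ) x + s * rieszTest s φ x := by
  have hpi : (Real.pi : ℂ) ≠ 0 := by exact_mod_cast Real.pi_ne_zero
  set f : ℝ → ℂ := fun ξ => (ξ : ℂ) * symb s ξ * 𝓕 φ ξ with hf
  set φ₁ : ℝ → ℂ := fun x => (x : ℂ) * φ x with hφ₁
  have h₁ : IsTest φ₁ := h.id_mul
  have hd : ∀ ξ, HasDerivAt f ((s + 1) * (symb s ξ * 𝓕 φ ξ) + -1 * (symb s ξ * 𝓕 (deriv φ₁) ξ)) ξ := by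
    intro ξ
    refine ((hasDerivAt_mul_symb hs ξ).mul (h.hasDerivAt_fourier ξ)).congr_deriv ?_
    rw [h₁.fourier_deriv]; ring
  have hfi : Integrable f := by
    have := (h.deriv.integrable_symb_mul_fourier hs.le).const_mul (1 / (2 * Real.pi * Complex.I))
    refine this.congr (Filter.Eventually.of_forall fun ξ => ?_)
    simp only [h.fourier_deriv, hf]
    field_simp
  have hdf : deriv f = fun ξ => (s + 1) * (symb s ξ * 𝓕 φ ξ) + -1 * (symb s ξ * 𝓕 (deriv φ₁) ξ) := by
    ext ξ; exact (hd ξ).deriv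
  have i1 := (h.integrable_symb_mul_fourier hs.le).const_mul ((s : ℂ) + 1)
  have i2 := (h₁.deriv.integrable_symb_mul_fourier hs.le).const_mul (-1)
  have key := congrFun (Real.fourier_deriv hfi (fun ξ => (hd ξ).differentiableAt)
    (by rw [hdf]; exact i1.add i2)) (-x)
  rw [hdf, ← Real.fourierInv_eq_fourier_neg, fourierInv_add' i1 i2, fourierInv_const_mul,
    fourierInv_const_mul, smul_eq_mul, ← Real.fourierInv_eq_fourier_neg] at key
  have e1 : (fun x : ℝ => (x : ℂ) * deriv φ x) = fun x => deriv φ₁ x + (-1) * φ x := by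
    ext y
    have : HasDerivAt φ₁ (1 * φ y + y * deriv φ y) y :=
      (Complex.ofRealCLM.hasDerivAt (x := y)).mul (h.differentiable y).hasDerivAt
    rw [this.deriv]; ring
  have e2 : 𝓕⁻ (fun ξ => symb s ξ * 𝓕 (deriv φ) ξ) x = 2 * Real.pi * Complex.I * 𝓕⁻ f x := by
    rw [← fourierInv_const_mul]
    refine congrArg (fun f : ℝ → ℂ => 𝓕⁻ f x) (funext fun ξ => ?_)
    rw [h.fourier_deriv]; simp only [hf]; ring
  rw [e1, rieszTest_add h₁.deriv (h.const_mul (-1)) hs.le, rieszTest_const_mul, rieszTest_eq,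
    rieszTest_eq, rieszTest_eq, e2]
  push_cast at key
  linear_combination (-rsign s) * key

end Riesz

end RieszJacobi

end

noncomputable section

namespace RieszJacobi

/-! ### The weight and integration by parts -/

/-- The weight `(1 - x²) ^ γ`. -/
def wt (γ x : ℝ) : ℝ := (1 - x ^ 2) ^ γ

lemma one_sub_sq_pos {x : ℝ} (hx : x ∈ Ioo (-1 : ℝ) 1) : 0 < 1 - x ^ 2 := by
  nlinarith [hx.1, hx.2]

lemma wt_pos {γ x : ℝ} (hx : x ∈ Ioo (-1 : ℝ) 1) : 0 < wt γ x :=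
  Real.rpow_pos_of_pos (one_sub_sq_pos hx) γ

lemma continuous_wt {γ : ℝ} (h : 0 ≤ γ) : Continuous (wt γ) :=
  Continuous.rpow_const (by fun_prop) (fun _ => Or.inr h)

lemma wt_neg_arg (γ x : ℝ) : wt γ (-x) = wt γ x := by simp [wt]

lemma wt_zero (x : ℝ) : wt 0 x = 1 := by simp [wt]

lemma wt_add {x : ℝ} (hx : x ∈ Ioo (-1 : ℝ) 1) (γ δ : ℝ) : wt (γ + δ) x = wt γ x * wt δ x :=
  Real.rpow_add (one_sub_sq_pos hx) γ δ

lemma wt_add_one {x : ℝ} (hx : x ∈ Ioo (-1 : ℝ) 1) (γ : ℝ) :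
    wt (γ + 1) x = wt γ x * (1 - x ^ 2) :=
  Real.rpow_add_one (one_sub_sq_pos hx).ne' γ

lemma wt_one {γ : ℝ} (h : 0 < γ) : wt γ 1 = 0 := by simp [wt, Real.zero_rpow h.ne']

lemma wt_neg_one {γ : ℝ} (h : 0 < γ) : wt γ (-1) = 0 := by rw [wt_neg_arg, wt_one h]

lemma hasDerivAt_wt {x : ℝ} (hx : x ∈ Ioo (-1 : ℝ) 1) (γ : ℝ) :
    HasDerivAt (wt (γ + 1)) (-2 * (γ + 1) * x * wt γ x) x := by
  have h1 : HasDerivAt (fun x : ℝ => 1 - x ^ 2) (-(2 * x)) x := by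
    simpa using! ((hasDerivAt_id x).pow 2).const_sub 1
  refine (h1.rpow_const (p := γ + 1) (Or.inl (one_sub_sq_pos hx).ne')).congr_deriv ?_
  simp only [wt, add_sub_cancel_right]; ring

lemma hasDerivAt_wt_ofReal {x : ℝ} (hx : x ∈ Ioo (-1 : ℝ) 1) (γ : ℝ) :
    HasDerivAt (fun x => (wt (γ + 1) x : ℂ)) (-2 * (γ + 1) * x * wt γ x) x := by
  simpa using! (hasDerivAt_wt hx γ).ofReal_comp

lemma contDiffOn_wt (γ : ℝ) : ContDiffOn ℝ ∞ (fun x => (wt γ x : ℂ)) (Ioo (-1) 1) := by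
  refine Complex.ofRealCLM.contDiff.comp_contDiffOn ?_
  refine ContDiffOn.rpow_const_of_ne (by fun_prop) ?_
  intro x hx
  exact (one_sub_sq_pos hx).ne'

/-- Integration by parts against the weight. -/
lemma integral_wt_mul_deriv {γ : ℝ} (hγ : 0 ≤ γ) {a a' f f' : ℝ → ℂ}
    (ha : ∀ x, HasDerivAt a (a' x) x) (ha' : Continuous a')
    (hf : ∀ x, HasDerivAt f (f' x) x) (hf' : Continuous f') :
    ∫ x in (-1 : ℝ)..1, (wt (γ + 1) x : ℂ) * a x * f' x =
      -∫ x in (-1 : ℝ)..1, (wt γ x : ℂ) * ((1 - x ^ 2) * a' x - 2 * (γ + 1) * x * a x) * f x := by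
  have ca : Continuous a := continuous_iff_continuousAt.2 fun x => (ha x).continuousAt
  have cf : Continuous f := continuous_iff_continuousAt.2 fun x => (hf x).continuousAt
  have cw : Continuous (fun x => (wt γ x : ℂ)) := Complex.continuous_ofReal.comp (continuous_wt hγ)
  have cw1 : Continuous (fun x => (wt (γ + 1) x : ℂ)) :=
    Complex.continuous_ofReal.comp (continuous_wt (by linarith))
  have c1 : Continuous fun x : ℝ => (wt (γ + 1) x : ℂ) * a x * f' x := (cw1.mul ca).mul hf'
  have c2 : Continuous fun x : ℝ =>
      (wt γ x : ℂ) * ((1 - x ^ 2) * a' x - 2 * (γ + 1) * x * a x) * f x := by fun_prop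
  rw [← sub_eq_zero, sub_neg_eq_add, ← intervalIntegral.integral_add
    (c1.intervalIntegrable _ _) (c2.intervalIntegrable _ _)]
  have key := intervalIntegral.integral_eq_sub_of_hasDerivAt_of_le
    (f := fun x => (wt (γ + 1) x : ℂ) * a x * f x) (a := -1) (b := 1)
    (by norm_num) ((cw1.mul ca).mul cf).continuousOn ?_ ((c1.add c2).intervalIntegrable _ _)
  · refine key.trans ?_
    simp [wt_one (show 0 < γ + 1 by linarith), wt_neg_one (show 0 < γ + 1 by linarith)]
  · intro x hx
    refine (((hasDerivAt_wt_ofReal hx γ).mul (ha x)).mul (hf x)).congr_deriv ?_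
    simp only [Pi.mul_apply, Pi.add_apply, wt_add_one hx]
    push_cast
    ring

/-! ### Test functions on the interval -/

/-- Smooth functions with compact support in `(-1, 1)`. -/
structure IsTestIn (φ : ℝ → ℂ) : Prop where
  contDiff : ContDiff ℝ ∞ φ
  exists_radius : ∃ r : ℝ, 0 ≤ r ∧ r < 1 ∧ ∀ x, r ≤ |x| → φ x = 0

lemma isTestIn_of_tsupport {φ : ℝ → ℂ} (h : ContDiff ℝ ∞ φ) (hc : HasCompactSupport φ)
    (hs : tsupport φ ⊆ Ioo (-1) 1) : IsTestIn φ := by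
  refine ⟨h, ?_⟩
  rcases (tsupport φ).eq_empty_or_nonempty with he | hne
  · refine ⟨0, le_rfl, one_pos, fun x _ => ?_⟩
    exact image_eq_zero_of_notMem_tsupport (by simp [he])
  · obtain ⟨y, hy, hmax⟩ := hc.isCompact.exists_isMaxOn hne continuous_abs.continuousOn
    have hy1 : |y| < 1 := abs_lt.2 (hs hy)
    refine ⟨(|y| + 1) / 2, by positivity, by linarith, fun x hx => ?_⟩
    refine image_eq_zero_of_notMem_tsupport fun hx' => ?_
    have := hmax hx'
    have : |x| ≤ |y| := this
    linarith

namespace IsTestIn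

variable {φ ψ : ℝ → ℂ}

lemma tsupport_subset (h : IsTestIn φ) : tsupport φ ⊆ Ioo (-1) 1 := by
  obtain ⟨r, -, hr, hz⟩ := h.exists_radius
  have : tsupport φ ⊆ Icc (-r) r := by
    refine closure_minimal (fun x hx => ?_) isClosed_Icc
    by_contra hn
    refine hx (hz x ?_)
    rw [mem_Icc, ← abs_le] at hn
    exact (not_le.1 hn).le
  exact this.trans fun x hx => ⟨by linarith [hx.1], by linarith [hx.2]⟩

lemma isTest (h : IsTestIn φ) : IsTest φ :=
  ⟨h.contDiff, HasCompactSupport.of_support_subset_isCompact (isCompact_Icc (a := (-1 : ℝ)) (b := 1))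
    ((subset_tsupport φ).trans (h.tsupport_subset.trans Ioo_subset_Icc_self))⟩

lemma eq_zero (h : IsTestIn φ) {x : ℝ} (hx : x ∉ Ioo (-1 : ℝ) 1) : φ x = 0 :=
  image_eq_zero_of_notMem_tsupport fun hx' => hx (h.tsupport_subset hx')

lemma integral_eq (h : IsTestIn φ) (f : ℝ → ℂ) :
    ∫ x, f x * φ x = ∫ x in (-1 : ℝ)..1, f x * φ x := by
  rw [intervalIntegral.integral_of_le (by norm_num), integral_Ioc_eq_integral_Ioo,
    setIntegral_eq_integral_of_forall_compl_eq_zero]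
  intro x hx
  rw [h.eq_zero hx, mul_zero]

lemma deriv (h : IsTestIn φ) : IsTestIn (deriv φ) :=
  isTestIn_of_tsupport h.isTest.deriv.contDiff h.isTest.deriv.hasCompactSupport
    (tsupport_deriv_subset.trans h.tsupport_subset)

lemma smooth_mul {a : ℝ → ℂ} (ha : ContDiffOn ℝ ∞ a (Ioo (-1) 1)) (h : IsTestIn φ) :
    IsTestIn (fun x => a x * φ x) := by
  obtain ⟨r, hr0, hr, hz⟩ := h.exists_radius
  refine ⟨contDiff_iff_contDiffAt.2 fun x => ?_, r, hr0, hr, fun x hx => by rw [hz x hx, mul_zero]⟩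
  by_cases hx : x ∈ Ioo (-1 : ℝ) 1
  · exact (ha.contDiffAt (isOpen_Ioo.mem_nhds hx)).mul h.contDiff.contDiffAt
  · have h1 : (1 : ℝ) ≤ |x| := by
      by_contra hn
      exact hx (abs_lt.1 (not_le.1 hn))
    have : (fun x => a x * φ x) =ᶠ[nhds x] fun _ => 0 := by
      filter_upwards [continuous_abs.continuousAt.eventually (lt_mem_nhds (hr.trans_le h1))] with y hy
      rw [hz y (le_of_lt hy), mul_zero]
    exact contDiffAt_const.congr_of_eventuallyEq this

lemma const_mul (c : ℂ) (h : IsTestIn φ) : IsTestIn (fun x => c * φ x) :=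
  h.smooth_mul contDiffOn_const

lemma add (h : IsTestIn φ) (h' : IsTestIn ψ) : IsTestIn (fun x => φ x + ψ x) := by
  obtain ⟨r, hr0, hr, hz⟩ := h.exists_radius
  obtain ⟨r', hr0', hr', hz'⟩ := h'.exists_radius
  refine ⟨h.contDiff.add h'.contDiff, max r r', le_max_of_le_left hr0, max_lt hr hr', fun x hx => ?_⟩
  rw [hz x ((le_max_left _ _).trans hx), hz' x ((le_max_right _ _).trans hx), add_zero]

lemma comp_neg (h : IsTestIn φ) : IsTestIn (fun x => φ (-x)) := by
  obtain ⟨r, hr0, hr, hz⟩ := h.exists_radius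
  exact ⟨h.contDiff.comp contDiff_neg, r, hr0, hr, fun x hx => hz _ (by simpa using hx)⟩

lemma exists_antideriv (h : IsTestIn φ) (h0 : ∫ x in (-1 : ℝ)..1, φ x = 0) :
    ∃ χ, IsTestIn χ ∧ ∀ x, HasDerivAt χ (φ x) x := by
  obtain ⟨r, hr0, hr, hz⟩ := h.exists_radius
  have hc := h.contDiff.continuous
  have hd : ∀ x, HasDerivAt (fun x => ∫ t in (-1 : ℝ)..x, φ t) (φ x) x := fun x =>
    intervalIntegral.integral_hasDerivAt_right (hc.intervalIntegrable _ _)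
      hc.stronglyMeasurable.stronglyMeasurableAtFilter hc.continuousAt
  refine ⟨fun x => ∫ t in (-1 : ℝ)..x, φ t, ⟨?_, r, hr0, hr, fun x hx => ?_⟩, hd⟩
  · rw [contDiff_infty_iff_deriv]
    refine ⟨fun x => (hd x).differentiableAt, ?_⟩
    rw [show _root_.deriv (fun x => ∫ t in (-1 : ℝ)..x, φ t) = φ from funext fun x => (hd x).deriv]
    exact h.contDiff
  · have key : ∀ a b : ℝ, (∀ t ∈ uIcc a b, r ≤ |t|) → ∫ t in a..b, φ t = 0 := by
      intro a b hab
      rw [intervalIntegral.integral_congr (g := fun _ => (0 : ℂ)) (fun t ht => hz t (hab t ht))]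
      simp
    rcases le_abs.1 hx with hx | hx
    · have := intervalIntegral.integral_add_adjacent_intervals (μ := volume)
        (hc.intervalIntegrable (-1) 1) (hc.intervalIntegrable 1 x)
      rw [h0, zero_add] at this
      refine this.symm.trans ?_
      refine key _ _ fun t ht => ?_
      have := (le_min hr.le hx).trans ht.1
      exact this.trans (le_abs_self t)
    · refine key _ _ fun t ht => ?_
      have : t ≤ -r := ht.2.trans (max_le (by linarith) (by linarith))
      exact (le_neg.2 this).trans (neg_le_abs t)

end IsTestIn

/-- A fixed smooth even bump function of integral one, supported in `[-1/2, 1/2]`. -/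
def bumpBase : ContDiffBump (0 : ℝ) := ⟨1 / 4, 1 / 2, by norm_num, by norm_num⟩

/-- The normalized bump as a complex valued function. -/
def bump (x : ℝ) : ℂ := (bumpBase.normed volume x : ℝ)

lemma isTestIn_bump : IsTestIn bump := by
  refine ⟨Complex.ofRealCLM.contDiff.comp bumpBase.contDiff_normed, 1 / 2, by norm_num, by norm_num,
    fun x hx => ?_⟩
  have : x ∉ Function.support (bumpBase.normed volume) := by
    rw [bumpBase.support_normed_eq]
    simpa [bumpBase] using hx
  simp only [Function.mem_support, not_not] at this
  simp [bump, this]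

lemma integral_bump : ∫ x, bump x = 1 := by
  unfold bump
  rw [integral_complex_ofReal, bumpBase.integral_normed]; simp

lemma intervalIntegral_bump : ∫ x in (-1 : ℝ)..1, bump x = 1 := by
  have := isTestIn_bump.integral_eq (fun _ => 1)
  simpa [integral_bump] using this.symm

lemma IsTestIn.exists_deriv_add_bump {φ : ℝ → ℂ} (h : IsTestIn φ) :
    ∃ χ, IsTestIn χ ∧ φ = fun x => _root_.deriv χ x + (∫ x in (-1 : ℝ)..1, φ x) * bump x := by
  set c := ∫ x in (-1 : ℝ)..1, φ x with hc
  have h1 : IsTestIn (fun x => φ x + (-c) * bump x) := h.add (isTestIn_bump.const_mul _)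
  obtain ⟨χ, hχ, hd⟩ := h1.exists_antideriv (by
    rw [intervalIntegral.integral_add (h.contDiff.continuous.intervalIntegrable _ _)
      ((isTestIn_bump.const_mul _).contDiff.continuous.intervalIntegrable _ _),
      intervalIntegral.integral_const_mul, intervalIntegral_bump, ← hc]
    ring)
  refine ⟨χ, hχ, funext fun x => ?_⟩
  rw [(hd x).deriv]; ring

end RieszJacobi

end

noncomputable section

namespace RieszJacobi

/-! ### The Riesz derivative of the weight -/

/-- The pairing of `D^{2γ} (1 - x²)^γ` with a test function. -/
def wtPairing (γ : ℝ) (φ : ℝ → ℂ) : ℂ :=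
  ∫ x in (-1 : ℝ)..1, (wt γ x : ℂ) * rieszTest (2 * γ) φ x

/-- The value of the constant function `D^{2γ} (1 - x²)^γ` on `(-1, 1)`. -/
def wtConst (γ : ℝ) : ℂ := wtPairing γ bump

lemma continuous_wt_ofReal {γ : ℝ} (h : 0 ≤ γ) : Continuous fun x => (wt γ x : ℂ) :=
  Complex.continuous_ofReal.comp (continuous_wt h)

lemma wtPairing_add {γ : ℝ} (hγ : 0 ≤ γ) {φ ψ : ℝ → ℂ} (h : IsTest φ) (h' : IsTest ψ) :
    wtPairing γ (fun x => φ x + ψ x) = wtPairing γ φ + wtPairing γ ψ := by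
  have hs : 0 ≤ 2 * γ := by linarith
  unfold wtPairing
  rw [← intervalIntegral.integral_add]
  · simp only [rieszTest_add h h' hs, mul_add]
  · exact ((continuous_wt_ofReal hγ).mul (continuous_rieszTest h hs)).intervalIntegrable _ _
  · exact ((continuous_wt_ofReal hγ).mul (continuous_rieszTest h' hs)).intervalIntegrable _ _

lemma wtPairing_const_mul (γ : ℝ) (c : ℂ) (φ : ℝ → ℂ) :
    wtPairing γ (fun x => c * φ x) = c * wtPairing γ φ := by
  unfold wtPairing
  rw [← intervalIntegral.integral_const_mul]
  simp only [rieszTest_const_mul]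
  congr 1; funext x; ring

lemma wtPairing_comp_neg (γ : ℝ) (φ : ℝ → ℂ) :
    wtPairing γ (fun x => φ (-x)) = wtPairing γ φ := by
  unfold wtPairing
  have := intervalIntegral.integral_comp_neg (a := -1) (b := 1)
    (fun x => (wt γ x : ℂ) * rieszTest (2 * γ) φ x)
  simp only [wt_neg_arg, neg_neg] at this
  simp only [rieszTest_comp_neg]
  exact this

/-- The conjugation by `D^{2γ}` of the operator `ψ ↦ ((1 - x²) ψ' + 2 γ x ψ)'`. -/
lemma rieszTest_weight_operator {γ : ℝ} (hγ : 0 < γ) {ψ : ℝ → ℂ} (h : IsTest ψ) (x : ℝ) :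
    rieszTest (2 * γ) (fun x => deriv (fun y : ℝ => (1 - y ^ 2) * deriv ψ y + 2 * γ * y * ψ y) x) x =
      (1 - x ^ 2) * rieszTest (2 * γ) (deriv (deriv ψ)) x
        - 2 * (γ + 1) * x * rieszTest (2 * γ) (deriv ψ) x := by
  have hs : 0 < 2 * γ := by linarith
  set θ : ℝ → ℂ := fun x => (x : ℂ) * deriv ψ x with hθ
  have tθ : IsTest θ := h.deriv.id_mul
  have dθ : ∀ y, deriv θ y = deriv ψ y + y * deriv (deriv ψ) y := by
    intro y
    have : HasDerivAt θ (1 * deriv ψ y + y * deriv (deriv ψ) y) y :=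
      (Complex.ofRealCLM.hasDerivAt (x := y)).mul (h.deriv.differentiable y).hasDerivAt
    rw [this.deriv, one_mul]
  have e : (fun x => deriv (fun y : ℝ => (1 - y ^ 2) * deriv ψ y + 2 * γ * y * ψ y) x) =
      fun x => (deriv (deriv ψ) x + (-1) * (x * deriv θ x)) + ((2 * γ - 1) * θ x + 2 * γ * ψ x) := by
    ext y
    have h1 : HasDerivAt (fun y : ℝ => (1 : ℂ) - (y : ℂ) ^ 2) (-(2 * y)) y := by
      simpa using! ((Complex.ofRealCLM.hasDerivAt (x := y)).pow 2).const_sub 1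
    have h2 : HasDerivAt (fun y : ℝ => 2 * γ * (y : ℂ)) (2 * γ) y := by
      simpa using! (Complex.ofRealCLM.hasDerivAt (x := y)).const_mul (2 * γ : ℂ)
    have := (h1.mul (h.deriv.differentiable y).hasDerivAt).add
      (h2.mul (h.differentiable y).hasDerivAt)
    refine this.deriv.trans ?_
    rw [dθ]; simp only [hθ]; ring
  have t1 : IsTest (fun x : ℝ => (x : ℂ) * deriv θ x) := tθ.deriv.id_mul
  have Rθ : rieszTest (2 * γ) θ = fun x => x * rieszTest (2 * γ) (deriv ψ) x
      + (2 * γ : ℝ) * rieszTest (2 * γ) ψ x := by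
    ext y; exact rieszTest_id_mul_deriv h hs y
  have Rdθ : rieszTest (2 * γ) (deriv θ) x = rieszTest (2 * γ) (deriv ψ) x
      + x * rieszTest (2 * γ) (deriv (deriv ψ)) x + (2 * γ : ℝ) * rieszTest (2 * γ) (deriv ψ) x := by
    rw [← deriv_rieszTest tθ hs.le, Rθ]
    have := ((Complex.ofRealCLM.hasDerivAt (x := x)).mul (rieszTest_hasDerivAt h.deriv hs.le x)).add
      ((rieszTest_hasDerivAt h hs.le x).const_mul (((2 * γ : ℝ) : ℂ)))
    refine this.deriv.trans ?_
    simp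
  rw [e, rieszTest_add (h.deriv.deriv.add (t1.const_mul _)) ((tθ.const_mul _).add (h.const_mul _)) hs.le,
    rieszTest_add h.deriv.deriv (t1.const_mul _) hs.le,
    rieszTest_add (tθ.const_mul _) (h.const_mul _) hs.le, rieszTest_const_mul, rieszTest_const_mul,
    rieszTest_const_mul, rieszTest_id_mul_deriv tθ hs, Rdθ, Rθ]
  push_cast
  ring

lemma wtPairing_weight_operator {γ : ℝ} (hγ : 0 < γ) {ψ : ℝ → ℂ} (h : IsTest ψ) :
    wtPairing γ (fun x => deriv (fun y : ℝ => (1 - y ^ 2) * deriv ψ y + 2 * γ * y * ψ y) x) = 0 := by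
  have hs : 0 ≤ 2 * γ := by linarith
  have := integral_wt_mul_deriv hγ.le (fun x => rieszTest_hasDerivAt h.deriv hs x)
    (continuous_rieszTest h.deriv.deriv hs) (f := fun _ => 1) (f' := fun _ => 0)
    (fun x => hasDerivAt_const x 1) continuous_const
  simp only [mul_zero, intervalIntegral.integral_zero, mul_one] at this
  unfold wtPairing
  simp only [rieszTest_weight_operator hγ h]
  exact (neg_eq_zero.1 this.symm)

lemma wtPairing_deriv_eq_zero {γ : ℝ} (hγ : 0 < γ) {χ : ℝ → ℂ} (h : IsTestIn χ) :
    wtPairing γ (deriv χ) = 0 := by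
  have hd : ∀ {χ : ℝ → ℂ}, IsTestIn χ → deriv (fun x => χ (-x)) = fun x => -deriv χ (-x) := by
    intro χ _
    ext x
    rw [deriv_comp_neg]
  -- reduction to odd functions
  suffices odd : ∀ {χ : ℝ → ℂ}, IsTestIn χ → (∀ x, χ (-x) = -χ x) → wtPairing γ (deriv χ) = 0 by
    have h1 : IsTestIn (fun x => χ x + (-1) * χ (-x)) := h.add (h.comp_neg.const_mul _)
    have h2 := odd h1 (fun x => by rw [neg_neg]; ring)
    have e : deriv (fun x => χ x + (-1) * χ (-x)) = fun x => deriv χ x + deriv χ (-x) := by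
      ext x
      have := (h.isTest.differentiable x).hasDerivAt.add
        ((h.comp_neg.isTest.differentiable x).hasDerivAt.const_mul (-1))
      refine this.deriv.trans ?_
      rw [hd h]; ring
    rw [e, wtPairing_add hγ.le h.deriv.isTest h.deriv.comp_neg.isTest, wtPairing_comp_neg] at h2
    linear_combination h2 / 2
  intro χ h hodd
  have hκ : IsTestIn (fun x => (wt (-γ - 1) x : ℂ) * χ x) := h.smooth_mul (contDiffOn_wt _)
  obtain ⟨K, hK, hKd⟩ := hκ.exists_antideriv (by
    have := intervalIntegral.integral_comp_neg (a := -1) (b := 1)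
      (fun x => (wt (-γ - 1) x : ℂ) * χ x)
    simp only [wt_neg_arg, hodd, mul_neg, neg_neg, intervalIntegral.integral_neg] at this
    linear_combination (-1 / 2) * this)
  have hψ : IsTestIn (fun x => (wt γ x : ℂ) * K x) := hK.smooth_mul (contDiffOn_wt _)
  rw [← wtPairing_weight_operator hγ hψ.isTest]
  congr 1
  ext x
  congr 1
  ext y
  by_cases hy : y ∈ Ioo (-1 : ℝ) 1
  · have h1 : HasDerivAt (fun x => (wt γ x : ℂ)) (-2 * γ * y * wt (γ - 1) y) y := by
      have := hasDerivAt_wt_ofReal hy (γ - 1)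
      simpa using this
    have h2 := (h1.mul (hKd y)).deriv
    change deriv (fun x => (wt γ x : ℂ) * K x) y = _ at h2
    rw [h2]
    have e1 : wt γ y = wt (γ - 1) y * (1 - y ^ 2) := by
      rw [← wt_add_one hy, sub_add_cancel]
    have e2 : wt γ y * (1 - y ^ 2) * wt (-γ - 1) y = 1 := by
      rw [← wt_add_one hy, ← wt_add hy, show γ + 1 + (-γ - 1) = 0 by ring, wt_zero]
    have e2' : (wt γ y : ℂ) * (1 - y ^ 2) * wt (-γ - 1) y = 1 := by exact_mod_cast e2
    have e1' : (wt γ y : ℂ) = wt (γ - 1) y * (1 - y ^ 2) := by exact_mod_cast e1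
    linear_combination (-χ y) * e2' - 2 * γ * y * K y * e1'
  · rw [h.eq_zero hy, hψ.eq_zero hy, hψ.deriv.eq_zero hy]; ring

/-- `D^{2γ} (1 - x²)^γ` is constant on `(-1, 1)`. -/
theorem wtPairing_eq {γ : ℝ} (hγ : 0 < γ) {φ : ℝ → ℂ} (h : IsTestIn φ) :
    wtPairing γ φ = wtConst γ * ∫ x in (-1 : ℝ)..1, φ x := by
  obtain ⟨χ, hχ, e⟩ := h.exists_deriv_add_bump
  set c := ∫ x in (-1 : ℝ)..1, φ x
  rw [e, wtPairing_add hγ.le hχ.deriv.isTest (isTestIn_bump.isTest.const_mul _),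
    wtPairing_deriv_eq_zero hγ hχ, wtPairing_const_mul, wtConst]
  ring

lemma integral_id_mul_deriv {φ : ℝ → ℂ} (h : IsTestIn φ) :
    ∫ x in (-1 : ℝ)..1, (x : ℂ) * deriv φ x = -∫ x in (-1 : ℝ)..1, φ x := by
  have := intervalIntegral.integral_mul_deriv_eq_deriv_mul (a := -1) (b := 1)
    (u := fun x : ℝ => (x : ℂ)) (u' := fun _ => 1) (v := φ) (v' := deriv φ)
    (fun x _ => Complex.ofRealCLM.hasDerivAt) (fun x _ => (h.isTest.differentiable x).hasDerivAt)
    (continuous_const.intervalIntegrable _ _)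
    (h.deriv.contDiff.continuous.intervalIntegrable _ _)
  rw [this, h.eq_zero (by simp), h.eq_zero (by simp)]
  simp

lemma wtConst_add_one {γ : ℝ} (hγ : 0 < γ) :
    wtConst (γ + 1) = -((2 * γ + 2) * (2 * γ + 1)) * wtConst γ := by
  have hs : 0 < 2 * γ := by linarith
  have hb := isTestIn_bump
  have hbt := isTestIn_bump.isTest
  have h1 : wtConst (γ + 1) = ∫ x in (-1 : ℝ)..1, (wt (γ + 1) x : ℂ) * 1 *
      rieszTest (2 * γ) (deriv (deriv bump)) x := by
    unfold wtConst wtPairing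
    rw [show 2 * (γ + 1) = 2 * γ + 2 by ring, rieszTest_add_two hbt hs.le]
    simp
  rw [integral_wt_mul_deriv hγ.le (a := fun _ => 1) (a' := fun _ => 0) (fun x => hasDerivAt_const x 1)
    continuous_const (fun x => rieszTest_hasDerivAt hbt.deriv hs.le x)
    (continuous_rieszTest hbt.deriv.deriv hs.le)] at h1
  have h2 : wtPairing γ (fun x : ℝ => (x : ℂ) * deriv bump x) =
      (∫ x in (-1 : ℝ)..1, (wt γ x : ℂ) * (x * rieszTest (2 * γ) (deriv bump) x))
        + 2 * γ * wtConst γ := by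
    unfold wtConst wtPairing
    rw [← intervalIntegral.integral_const_mul, ← intervalIntegral.integral_add]
    · congr 1; funext x
      rw [rieszTest_id_mul_deriv hbt hs]; push_cast; ring
    · refine Continuous.intervalIntegrable ?_ _ _
      exact (continuous_wt_ofReal hγ.le).mul
        (Complex.continuous_ofReal.mul (continuous_rieszTest hbt.deriv hs.le))
    · refine Continuous.intervalIntegrable ?_ _ _
      exact continuous_const.mul ((continuous_wt_ofReal hγ.le).mul (continuous_rieszTest hbt hs.le))
  rw [wtPairing_eq hγ (hb.deriv.smooth_mul Complex.ofRealCLM.contDiff.contDiffOn :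
      IsTestIn (fun x : ℝ => (x : ℂ) * deriv bump x)),
    integral_id_mul_deriv hb, intervalIntegral_bump] at h2
  have h3 : wtConst (γ + 1) = 2 * (γ + 1) *
      ∫ x in (-1 : ℝ)..1, (wt γ x : ℂ) * (x * rieszTest (2 * γ) (deriv bump) x) := by
    rw [h1, ← intervalIntegral.integral_const_mul, ← intervalIntegral.integral_neg]
    congr 1; funext x; ring
  linear_combination h3 - 2 * (γ + 1) * h2

end RieszJacobi

end

noncomputable section

namespace RieszJacobi

open Polynomial

/-! ### Rodrigues polynomials -/

/-- The polynomial `p` with `((1 - x²)^{β+1} q)' = (1 - x²)^β p`. -/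
def raising (β : ℝ) (q : ℝ[X]) : ℝ[X] := (1 - X ^ 2) * derivative q - C (2 * (β + 1)) * X * q

/-- The polynomial `p` with `(d/dx)^n (1 - x²)^{β+n} = (1 - x²)^β p`. -/
def rodrigues : ℕ → ℝ → ℝ[X]
  | 0, _ => 1
  | n + 1, β => raising β (rodrigues n (β + 1))

lemma natDegree_raising_le (β : ℝ) {q : ℝ[X]} {n : ℕ} (h : q.natDegree ≤ n) :
    (raising β q).natDegree ≤ n + 1 := by
  unfold raising
  refine (natDegree_sub_le _ _).trans (max_le ?_ ?_)
  · rcases n with _ | n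
    · rw [natDegree_eq_zero.1 (Nat.le_zero.1 h) |>.choose_spec.symm]; simp
    · refine natDegree_mul_le.trans ?_
      have h1 : (1 - X ^ 2 : ℝ[X]).natDegree ≤ 2 := by compute_degree
      have h2 := natDegree_derivative_le q
      omega
  · refine natDegree_mul_le.trans ?_
    have h1 : (C (2 * (β + 1)) * X : ℝ[X]).natDegree ≤ 1 := by compute_degree
    omega

lemma coeff_raising (β : ℝ) {q : ℝ[X]} {n : ℕ} (h : q.natDegree ≤ n) :
    (raising β q).coeff (n + 1) = -(n + 2 * (β + 1)) * q.coeff n := by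
  unfold raising
  have h1 : (derivative q).coeff (n + 1) = 0 := by
    rw [coeff_derivative, coeff_eq_zero_of_natDegree_lt (by omega), zero_mul]
  have h2 : (X ^ 2 * derivative q).coeff (n + 1) = n * q.coeff n := by
    rcases n with _ | n
    · rw [show (0 + 1 : ℕ) = 1 from rfl, coeff_X_pow_mul']; simp
    · rw [show n + 1 + 1 = n + 2 from rfl, coeff_X_pow_mul, coeff_derivative]; push_cast; ring
  rw [coeff_sub, sub_mul, one_mul, coeff_sub, h1, h2, mul_assoc, coeff_C_mul, coeff_X_mul]
  ring

lemma natDegree_rodrigues_le (n : ℕ) (β : ℝ) : (rodrigues n β).natDegree ≤ n := by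
  induction n generalizing β with
  | zero => simp [rodrigues]
  | succ n ih => exact natDegree_raising_le β (ih _)

lemma coeff_rodrigues (n : ℕ) {β : ℝ} (hβ : 0 ≤ β) :
    (rodrigues n β).coeff n =
      (-1) ^ n * (Real.Gamma (2 * (β + n) + 1) / Real.Gamma (2 * (β + n) - n + 1)) := by
  induction n generalizing β with
  | zero =>
    have : Real.Gamma (2 * β + 1) ≠ 0 := (Real.Gamma_pos_of_pos (by linarith)).ne'
    simp [rodrigues, this]
  | succ n ih =>
    rw [rodrigues, coeff_raising β (natDegree_rodrigues_le n _), ih (by linarith)]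
    have hn : (0 : ℝ) ≤ n := n.cast_nonneg
    have h1 : Real.Gamma (2 * (β + 1 + n) - n + 1) =
        (n + 2 * (β + 1)) * Real.Gamma (2 * (β + (n + 1 : ℕ)) - (n + 1 : ℕ) + 1) := by
      rw [show 2 * (β + 1 + n) - n + 1 = (n + 2 * (β + 1)) + 1 by ring,
        show 2 * (β + (n + 1 : ℕ)) - (n + 1 : ℕ) + 1 = n + 2 * (β + 1) by push_cast; ring,
        Real.Gamma_add_one (by positivity)]
    have h2 : Real.Gamma (2 * (β + (n + 1 : ℕ)) - (n + 1 : ℕ) + 1) ≠ 0 := by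
      refine (Real.Gamma_pos_of_pos ?_).ne'
      push_cast; linarith
    have h3 : (n + 2 * (β + 1) : ℝ) ≠ 0 := by positivity
    rw [h1, show 2 * (β + 1 + n) + 1 = 2 * (β + (n + 1 : ℕ)) + 1 by push_cast; ring]
    field_simp
    ring

lemma hasDerivAt_eval_ofReal (q : ℂ[X]) (x : ℝ) :
    HasDerivAt (fun x : ℝ => q.eval (x : ℂ)) ((derivative q).eval (x : ℂ)) x :=
  (q.hasDerivAt (x : ℂ)).comp_ofReal

lemma hasDerivAt_real_eval (q : ℝ[X]) (x : ℝ) :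
    HasDerivAt (fun x : ℝ => ((q.eval x : ℝ) : ℂ)) (((derivative q).eval x : ℝ) : ℂ) x :=
  (q.hasDerivAt x).ofReal_comp

lemma continuous_eval_ofReal (q : ℂ[X]) : Continuous (fun x : ℝ => q.eval (x : ℂ)) :=
  q.continuous.comp Complex.continuous_ofReal

lemma continuous_real_eval (q : ℝ[X]) : Continuous (fun x : ℝ => ((q.eval x : ℝ) : ℂ)) :=
  Complex.continuous_ofReal.comp q.continuous

/-- The function `(d/dx)^n (1 - x²)^{β+n}`. -/
def rodFun (β : ℝ) (n : ℕ) (x : ℝ) : ℂ := (wt β x : ℂ) * ((rodrigues n β).eval x : ℝ)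

lemma continuous_rodFun {β : ℝ} (h : 0 ≤ β) (n : ℕ) : Continuous (rodFun β n) :=
  (continuous_wt_ofReal h).mul (continuous_real_eval _)

lemma rodFun_zero (β x : ℝ) : rodFun β 0 x = wt β x := by simp [rodFun, rodrigues]

lemma integral_rodFun_succ {β : ℝ} (hβ : 0 ≤ β) (n : ℕ) {f f' : ℝ → ℂ}
    (hf : ∀ x, HasDerivAt f (f' x) x) (hf' : Continuous f') :
    ∫ x in (-1 : ℝ)..1, rodFun β (n + 1) x * f x =
      -∫ x in (-1 : ℝ)..1, rodFun (β + 1) n x * f' x := by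
  have := integral_wt_mul_deriv hβ (hasDerivAt_real_eval (rodrigues n (β + 1)))
    (continuous_real_eval _) hf hf'
  rw [← neg_eq_iff_eq_neg] at this
  refine Eq.trans ?_ this.symm
  congr 1
  funext x
  simp only [rodFun, rodrigues, raising]
  congr 2
  simp

/-- The integral of the weight. -/
def wtInt (γ : ℝ) : ℝ := ∫ x in (-1 : ℝ)..1, wt γ x

lemma wtInt_pos {γ : ℝ} (h : 0 ≤ γ) : 0 < wtInt γ :=
  intervalIntegral.intervalIntegral_pos_of_pos_on ((continuous_wt h).intervalIntegrable _ _)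
    (fun _ hx => wt_pos hx) (by norm_num)

lemma integral_wt_ofReal (γ : ℝ) : ∫ x in (-1 : ℝ)..1, (wt γ x : ℂ) = wtInt γ := by
  rw [wtInt, intervalIntegral.integral_ofReal]

lemma integral_rodFun_mul_poly {β : ℝ} (hβ : 0 ≤ β) (n : ℕ) {q : ℂ[X]} (hq : q.natDegree ≤ n) :
    ∫ x in (-1 : ℝ)..1, rodFun β n x * q.eval (x : ℂ) =
      (-1) ^ n * n.factorial * q.coeff n * wtInt (β + n) := by
  induction n generalizing β q with
  | zero =>
    rw [eq_C_of_natDegree_le_zero hq]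
    simp only [rodFun_zero, eval_C, intervalIntegral.integral_mul_const, integral_wt_ofReal]
    simp [mul_comm]
  | succ n ih =>
    rw [integral_rodFun_succ hβ n (hasDerivAt_eval_ofReal q) (continuous_eval_ofReal _),
      ih (by linarith) ((natDegree_derivative_le q).trans (by omega)), coeff_derivative,
      show β + 1 + n = β + (n + 1 : ℕ) by push_cast; ring, Nat.factorial_succ]
    push_cast
    ring

lemma exists_antideriv_poly (p : ℂ[X]) {n : ℕ} (hp : p.natDegree ≤ n) :
    ∃ Q : ℂ[X], derivative Q = p ∧ Q.natDegree ≤ n + 1 := by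
  refine ⟨∑ i ∈ Finset.range (n + 1), C (p.coeff i / (i + 1)) * X ^ (i + 1), ?_, ?_⟩
  · rw [derivative_sum]
    conv_rhs => rw [p.as_sum_range' (n + 1) (by omega)]
    refine Finset.sum_congr rfl fun i _ => ?_
    have : (i + 1 : ℂ) ≠ 0 := by exact_mod_cast i.succ_ne_zero
    rw [derivative_C_mul_X_pow, ← C_mul_X_pow_eq_monomial]
    simp [this]
  · refine natDegree_sum_le_of_forall_le _ _ fun i hi => ?_
    refine (natDegree_C_mul_X_pow_le _ _).trans ?_
    have := Finset.mem_range.1 hi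
    omega

/-- On `(-1, 1)` the Riesz derivative of order `2α` of `(d/dx)^n (1 - x²)^{α+n}` is a polynomial of
degree at most `n`. -/
theorem exists_poly_rieszTest (n : ℕ) {α : ℝ} (hα : 0 < α) :
    ∃ r : ℂ[X], r.natDegree ≤ n ∧ r.coeff n = wtConst (α + n) / n.factorial ∧
      ∀ φ, IsTestIn φ → ∫ x in (-1 : ℝ)..1, rodFun α n x * rieszTest (2 * α) φ x =
        ∫ x in (-1 : ℝ)..1, r.eval (x : ℂ) * φ x := by
  induction n generalizing α with
  | zero =>
    refine ⟨C (wtConst α), by simp, by simp, fun φ h => ?_⟩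
    simp only [rodFun_zero, eval_C, intervalIntegral.integral_const_mul]
    exact wtPairing_eq hα h
  | succ n ih =>
    have hs : 0 ≤ 2 * α := by linarith
    obtain ⟨r, hr, hc, hI⟩ := ih (α := α + 1) (by linarith)
    obtain ⟨Q, hQ, hQd⟩ := exists_antideriv_poly r hr
    have hcQ : Q.coeff (n + 1) * (n + 1) = r.coeff n := by
      rw [← hQ, coeff_derivative]
    set U : (ℝ → ℂ) → ℂ := fun φ =>
      ∫ x in (-1 : ℝ)..1, (rodFun α (n + 1) x * rieszTest (2 * α) φ x - Q.eval (x : ℂ) * φ x) with hU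
    have i1 : ∀ {φ}, IsTest φ → IntervalIntegrable (fun x => rodFun α (n + 1) x * rieszTest (2 * α) φ x)
        volume (-1) 1 := fun h =>
      ((continuous_rodFun hα.le _).mul (continuous_rieszTest h hs)).intervalIntegrable _ _
    have i2 : ∀ {q : ℂ[X]} {φ}, IsTest φ → IntervalIntegrable (fun x : ℝ => q.eval (x : ℂ) * φ x)
        volume (-1) 1 := fun h =>
      ((continuous_eval_ofReal _).mul h.continuous).intervalIntegrable _ _
    have hUd : ∀ {χ}, IsTestIn χ → U (deriv χ) = 0 := by
      intro χ h
      simp only [hU]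
      rw [intervalIntegral.integral_sub (i1 h.deriv.isTest) (i2 h.deriv.isTest),
        integral_rodFun_succ hα.le n (fun x => rieszTest_hasDerivAt h.isTest.deriv hs x)
          (continuous_rieszTest h.isTest.deriv.deriv hs), ← rieszTest_add_two h.isTest hs,
        show 2 * α + 2 = 2 * (α + 1) by ring, hI χ h,
        intervalIntegral.integral_mul_deriv_eq_deriv_mul
          (fun x _ => hasDerivAt_eval_ofReal Q x) (fun x _ => (h.isTest.differentiable x).hasDerivAt)
          ((continuous_eval_ofReal _).intervalIntegrable _ _)
          (h.deriv.contDiff.continuous.intervalIntegrable _ _), hQ,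
        h.eq_zero (by simp), h.eq_zero (by simp)]
      ring
    have hUφ : ∀ {φ}, IsTestIn φ → U φ = U bump * ∫ x in (-1 : ℝ)..1, φ x := by
      intro φ h
      obtain ⟨χ, hχ, e⟩ := h.exists_deriv_add_bump
      set c := ∫ x in (-1 : ℝ)..1, φ x
      have hb := isTestIn_bump.isTest
      have : U φ = U (deriv χ) + U bump * c := by
        conv_lhs => rw [e]
        simp only [hU]
        rw [← intervalIntegral.integral_mul_const, ← intervalIntegral.integral_add
          ((i1 hχ.deriv.isTest).sub (i2 hχ.deriv.isTest)) (((i1 hb).sub (i2 hb)).mul_const _)]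
        congr 1; funext x
        rw [rieszTest_add hχ.deriv.isTest (hb.const_mul _) hs, rieszTest_const_mul]
        ring
      rw [this, hUd hχ, zero_add]
    refine ⟨Q + C (U bump), ?_, ?_, fun φ h => ?_⟩
    · exact natDegree_add_le_of_degree_le hQd (by simp)
    · have h1 : ((n : ℂ) + 1) ≠ 0 := by exact_mod_cast n.succ_ne_zero
      have h2 : ((n.factorial : ℕ) : ℂ) ≠ 0 := by exact_mod_cast n.factorial_ne_zero
      rw [coeff_add, coeff_C_succ, add_zero, Nat.factorial_succ,
        show α + (n + 1 : ℕ) = α + 1 + n by push_cast; ring]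
      rw [hc, eq_div_iff h2] at hcQ
      rw [← hcQ]
      push_cast
      field_simp
    · have h1 := hUφ h
      simp only [hU] at h1
      rw [intervalIntegral.integral_sub (i1 h.isTest) (i2 h.isTest), sub_eq_iff_eq_add] at h1
      rw [h1, ← intervalIntegral.integral_const_mul, ← intervalIntegral.integral_add
        ((h.isTest.const_mul _).continuous.intervalIntegrable _ _) (i2 h.isTest)]
      congr 1; funext x
      simp only [eval_add, eval_C]; ring

end RieszJacobi

end

noncomputable section

namespace RieszJacobi

/-! ### The Fourier transform of the weight -/

lemma wt_nonneg (γ : ℝ) {x : ℝ} (hx : x ∈ Icc (-1 : ℝ) 1) : 0 ≤ wt γ x :=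
  Real.rpow_nonneg (by nlinarith [hx.1, hx.2]) γ

/-- The cosine transform of the weight. -/
def wtCos (γ t : ℝ) : ℝ := ∫ x in (-1 : ℝ)..1, wt γ x * Real.cos (t * x)

lemma hasDerivAt_integral_wt {γ : ℝ} (hγ : 0 ≤ γ) {k k' : ℝ → ℝ → ℝ}
    (hk : ∀ t x, HasDerivAt (fun t => k t x) (k' t x) t) (hc : ∀ t, Continuous (k t))
    (hc' : ∀ t, Continuous (k' t)) (hb : ∀ t, ∀ x ∈ Icc (-1 : ℝ) 1, |k' t x| ≤ 1) (t : ℝ) :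
    HasDerivAt (fun t => ∫ x in (-1 : ℝ)..1, wt γ x * k t x)
      (∫ x in (-1 : ℝ)..1, wt γ x * k' t x) t := by
  have cw := continuous_wt hγ
  refine (intervalIntegral.hasDerivAt_integral_of_dominated_loc_of_deriv_le
    (F := fun t x => wt γ x * k t x) (F' := fun t x => wt γ x * k' t x)
    (bound := fun x => |wt γ x|) Filter.univ_mem ?_ ?_ ?_ ?_ ?_ ?_).2
  · exact Filter.Eventually.of_forall fun t => (cw.mul (hc t)).aestronglyMeasurable
  · exact (cw.mul (hc t)).intervalIntegrable _ _
  · exact (cw.mul (hc' t)).aestronglyMeasurable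
  · refine Filter.Eventually.of_forall fun x hx s _ => ?_
    rw [uIoc_of_le (by norm_num)] at hx
    rw [Real.norm_eq_abs, abs_mul]
    exact mul_le_of_le_one_right (abs_nonneg _) (hb s x ⟨hx.1.le, hx.2⟩)
  · exact cw.abs.intervalIntegrable _ _
  · exact Filter.Eventually.of_forall fun x _ s _ => (hk s x).const_mul _

/-- The derivative of `wtCos`. -/
def wtCos' (γ t : ℝ) : ℝ := ∫ x in (-1 : ℝ)..1, wt γ x * (-(x * Real.sin (t * x)))

lemma hasDerivAt_wtCos {γ : ℝ} (hγ : 0 ≤ γ) (t : ℝ) : HasDerivAt (wtCos γ) (wtCos' γ t) t := by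
  refine hasDerivAt_integral_wt hγ (k := fun t x => Real.cos (t * x))
    (k' := fun t x => -(x * Real.sin (t * x))) (fun t x => ?_) (fun t => by fun_prop)
    (fun t => by fun_prop) (fun t x hx => ?_) t
  · refine (((hasDerivAt_id t).mul_const x).cos).congr_deriv ?_
    simp; ring
  · rw [abs_neg, abs_mul]
    exact mul_le_one₀ (abs_le.2 hx) (abs_nonneg _) (Real.abs_sin_le_one _)

lemma hasDerivAt_wtCos' {γ : ℝ} (hγ : 0 ≤ γ) (t : ℝ) :
    HasDerivAt (wtCos' γ) (∫ x in (-1 : ℝ)..1, wt γ x * (-(x * (x * Real.cos (t * x))))) t := by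
  refine hasDerivAt_integral_wt hγ (k := fun t x => -(x * Real.sin (t * x)))
    (k' := fun t x => -(x * (x * Real.cos (t * x)))) (fun t x => ?_) (fun t => by fun_prop)
    (fun t => by fun_prop) (fun t x hx => ?_) t
  · refine ((((hasDerivAt_id t).mul_const x).sin).const_mul x).neg.congr_deriv ?_
    simp only [id, one_mul]; ring
  · rw [abs_neg, abs_mul, abs_mul]
    have := abs_le.2 hx
    exact mul_le_one₀ this (by positivity)
      (mul_le_one₀ this (abs_nonneg _) (Real.abs_cos_le_one _))

/-- Bessel's differential equation for the cosine transform of the weight. -/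
lemma mul_wtCos_ode {γ : ℝ} (hγ : 0 ≤ γ) (t : ℝ) :
    t * (wtCos γ t + ∫ x in (-1 : ℝ)..1, wt γ x * (-(x * (x * Real.cos (t * x))))) =
      -(2 * (γ + 1)) * wtCos' γ t := by
  have h := integral_wt_mul_deriv hγ (a := fun _ => 1) (a' := fun _ => 0)
    (f := fun x => (Real.sin (t * x) : ℂ)) (f' := fun x => (Real.cos (t * x) * t : ℝ))
    (fun x => hasDerivAt_const x 1) continuous_const
    (fun x => by
      have := (((hasDerivAt_id x).const_mul t).sin).ofReal_comp
      simpa using! this)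
    (by fun_prop)
  have h' : ∫ x in (-1 : ℝ)..1, wt (γ + 1) x * (Real.cos (t * x) * t) =
      -∫ x in (-1 : ℝ)..1, wt γ x * (-(2 * (γ + 1) * x)) * Real.sin (t * x) := by
    have e1 : ∀ x : ℝ, (wt (γ + 1) x : ℂ) * 1 * (Real.cos (t * x) * t : ℝ) =
      ((wt (γ + 1) x * (Real.cos (t * x) * t) : ℝ) : ℂ) := fun x => by push_cast; ring
    have e2 : ∀ x : ℝ, (wt γ x : ℂ) * ((1 - (x : ℂ) ^ 2) * 0 - 2 * (γ + 1) * x * 1) *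
      (Real.sin (t * x) : ℂ) = ((wt γ x * (-(2 * (γ + 1) * x)) * Real.sin (t * x) : ℝ) : ℂ) :=
      fun x => by push_cast; ring
    simp only [e1, e2, intervalIntegral.integral_ofReal] at h
    exact_mod_cast h
  have cw := continuous_wt hγ
  unfold wtCos wtCos'
  have i1 : Continuous fun x => wt γ x * Real.cos (t * x) := by fun_prop
  have i2 : Continuous fun x => wt γ x * (-(x * (x * Real.cos (t * x)))) := by fun_prop
  rw [← intervalIntegral.integral_add (i1.intervalIntegrable _ _) (i2.intervalIntegrable _ _),
    ← intervalIntegral.integral_const_mul, ← intervalIntegral.integral_const_mul]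
  rw [← intervalIntegral.integral_neg] at h'
  have e3 : ∫ x in (-1 : ℝ)..1, t * (wt γ x * Real.cos (t * x) + wt γ x * (-(x * (x * Real.cos (t * x))))) =
      ∫ x in (-1 : ℝ)..1, wt (γ + 1) x * (Real.cos (t * x) * t) := by
    rw [intervalIntegral.integral_of_le (by norm_num), intervalIntegral.integral_of_le (by norm_num),
      integral_Ioc_eq_integral_Ioo, integral_Ioc_eq_integral_Ioo]
    refine setIntegral_congr_fun measurableSet_Ioo fun x hx => ?_
    simp only [wt_add_one hx]; ring
  rw [e3, h']
  congr 1; funext x; ring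

lemma abs_wtCos_le {γ : ℝ} (hγ : 0 ≤ γ) (t : ℝ) : |wtCos γ t| ≤ wtInt γ := by
  unfold wtCos wtInt
  rw [← Real.norm_eq_abs]
  refine intervalIntegral.norm_integral_le_of_norm_le (by norm_num) ?_
    ((continuous_wt hγ).intervalIntegrable _ _)
  refine Filter.Eventually.of_forall fun x hx => ?_
  have h0 := wt_nonneg γ ⟨hx.1.le, hx.2⟩
  rw [Real.norm_eq_abs, abs_mul, abs_of_nonneg h0]
  exact mul_le_of_le_one_right h0 (Real.abs_cos_le_one _)

lemma wtCos_neg_arg (γ t : ℝ) : wtCos γ (-t) = wtCos γ t := by simp [wtCos]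

lemma continuous_wtCos {γ : ℝ} (hγ : 0 ≤ γ) : Continuous (wtCos γ) :=
  continuous_iff_continuousAt.2 fun t => (hasDerivAt_wtCos hγ t).continuousAt

lemma exists_rpow_mul_wtCos_le {γ : ℝ} (hγ : 0 ≤ γ) :
    ∃ C : ℝ, 0 ≤ C ∧ ∀ t, 1 ≤ t → t ^ (γ + 1) * |wtCos γ t| ≤ C := by
  set f := wtCos γ with hf
  set f' := wtCos' γ with hf'
  set a := γ + 1 with ha
  set K := γ * (γ + 1) with hK
  set y : ℝ → ℝ := fun t => t ^ a * f t with hy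
  set z : ℝ → ℝ := fun t => t ^ a * (f' t + a * f t / t) with hz
  have dy : ∀ t, 0 < t → HasDerivAt y (z t) t := by
    intro t ht
    refine ((Real.hasDerivAt_rpow_const (p := a) (Or.inl ht.ne')).mul
      (hasDerivAt_wtCos hγ t)).congr_deriv ?_
    rw [Real.rpow_sub_one ht.ne']
    simp only [hz, ← hf, ← hf']
    field_simp
    ring
  have dz : ∀ t, 0 < t → HasDerivAt z ((K / t ^ 2 - 1) * y t) t := by
    intro t ht
    have h1 : HasDerivAt (fun t => f' t + a * f t / t) _ t :=
      (hasDerivAt_wtCos' hγ t).add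
        (((hasDerivAt_wtCos hγ t).const_mul a).div (hasDerivAt_id t) ht.ne')
    refine ((Real.hasDerivAt_rpow_const (p := a) (Or.inl ht.ne')).mul h1).congr_deriv ?_
    have ode := mul_wtCos_ode hγ t
    set f2 := ∫ x in (-1 : ℝ)..1, wt γ x * (-(x * (x * Real.cos (t * x))))
    rw [Real.rpow_sub_one ht.ne']
    simp only [← hf, ← hf', hy, hK] at ode ⊢
    have hg : γ = a - 1 := by rw [ha]; ring
    rw [hg] at ode ⊢
    field_simp
    linear_combination t ^ 1 * ode
  set E : ℝ → ℝ := fun t => (z t ^ 2 + y t ^ 2) * Real.exp (K / t) with hE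
  have dE : ∀ t, 0 < t → HasDerivAt E
      (-(K / t ^ 2) * (z t - y t) ^ 2 * Real.exp (K / t)) t := by
    intro t ht
    have h1 : HasDerivAt (fun t : ℝ => Real.exp (K / t)) (Real.exp (K / t) * (-K / t ^ 2)) t := by
      refine HasDerivAt.exp ?_
      refine ((hasDerivAt_const t K).div (hasDerivAt_id t) ht.ne').congr_deriv ?_
      simp
    refine ((((dz t ht).pow 2).add ((dy t ht).pow 2)).mul h1).congr_deriv ?_
    simp only [Pi.add_apply, Pi.pow_apply]
    push_cast
    ring
  have hK0 : 0 ≤ K := by positivity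
  have hanti : AntitoneOn E (Ici 1) := by
    refine antitoneOn_of_deriv_nonpos (convex_Ici 1) ?_ ?_ ?_
    · intro t ht
      exact (dE t (by linarith [mem_Ici.1 ht])).continuousAt.continuousWithinAt
    · intro t ht
      rw [interior_Ici] at ht
      exact (dE t (by linarith [mem_Ioi.1 ht])).differentiableAt.differentiableWithinAt
    · intro t ht
      rw [interior_Ici] at ht
      rw [(dE t (by linarith [mem_Ioi.1 ht])).deriv]
      have : 0 ≤ K / t ^ 2 * (z t - y t) ^ 2 * Real.exp (K / t) := by positivity
      linarith
  refine ⟨Real.sqrt (E 1), Real.sqrt_nonneg _, fun t ht => ?_⟩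
  have h1 : E t ≤ E 1 := hanti (mem_Ici.2 le_rfl) (mem_Ici.2 ht) ht
  have h2 : y t ^ 2 ≤ E t := by
    have : 1 ≤ Real.exp (K / t) := Real.one_le_exp (by positivity)
    have h3 : 0 ≤ z t ^ 2 + y t ^ 2 := by positivity
    simp only [hE]
    nlinarith [sq_nonneg (z t)]
  have h3 : |y t| ≤ Real.sqrt (E 1) := Real.abs_le_sqrt (h2.trans h1)
  simp only [hy] at h3
  rwa [abs_mul, abs_of_nonneg (by positivity)] at h3

/-- Decay of the Fourier transform of the weight. -/
theorem exists_abs_rpow_mul_wtCos_le {γ : ℝ} (hγ : 0 ≤ γ) :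
    ∃ C : ℝ, 0 ≤ C ∧ ∀ t, |t| ^ γ * |wtCos γ t| ≤ C / (1 + |t|) := by
  obtain ⟨C, hC, h⟩ := exists_rpow_mul_wtCos_le hγ
  have hI := (wtInt_pos hγ).le
  refine ⟨2 * max C (wtInt γ), by positivity, fun t => ?_⟩
  rw [le_div_iff₀ (by positivity)]
  have e : wtCos γ t = wtCos γ |t| := by
    rcases abs_choice t with h | h <;> rw [h]
    rw [wtCos_neg_arg]
  rw [e]
  rcases le_total |t| 1 with h1 | h1
  · have h2 := Real.rpow_le_one (abs_nonneg t) h1 hγ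
    have h3 := abs_wtCos_le hγ |t|
    have h4 : |t| ^ γ * |wtCos γ (|t|)| ≤ wtInt γ :=
      (mul_le_of_le_one_left (abs_nonneg _) h2).trans h3
    have h5 := le_max_right C (wtInt γ)
    have h6 : 0 ≤ |t| ^ γ * |wtCos γ (|t|)| := by positivity
    nlinarith
  · have h2 := h _ h1
    rw [Real.rpow_add_one (by linarith)] at h2
    have h5 := le_max_left C (wtInt γ)
    have h6 : 0 ≤ |t| ^ γ * |wtCos γ (|t|)| := by positivity
    nlinarith

lemma fourier_zeroExt (v : ℝ → ℂ) (ξ : ℝ) :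
    𝓕 (zeroExt v) ξ = ∫ x in (-1 : ℝ)..1, v x * Complex.exp (-(2 * Real.pi * Complex.I * ξ) * x) := by
  rw [Real.fourier_real_eq_integral_exp_smul, intervalIntegral.integral_of_le (by norm_num),
    integral_Ioc_eq_integral_Ioo, ← integral_indicator measurableSet_Ioo]
  congr 1
  funext x
  by_cases hx : x ∈ Ioo (-1 : ℝ) 1
  · simp only [zeroExt, indicator_of_mem hx, smul_eq_mul]
    rw [mul_comm]; congr 2; push_cast; ring
  · simp [zeroExt, indicator_of_notMem hx]

/-- The Fourier transform of `(d/dx)^n (1 - x²)^{β+n}`. -/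
theorem fourier_rodFun {β : ℝ} (hβ : 0 ≤ β) (n : ℕ) (ξ : ℝ) :
    𝓕 (zeroExt (rodFun β n)) ξ =
      (2 * Real.pi * Complex.I * ξ) ^ n * wtCos (β + n) (2 * Real.pi * ξ) := by
  rw [fourier_zeroExt]
  induction n generalizing β with
  | zero =>
    have h1 : ∫ x in (-1 : ℝ)..1, wt β x * Real.sin (2 * Real.pi * ξ * x) = 0 := by
      have := intervalIntegral.integral_comp_neg (a := -1) (b := 1)
        (fun x => wt β x * Real.sin (2 * Real.pi * ξ * x))
      simp only [wt_neg_arg, mul_neg, Real.sin_neg, neg_neg, intervalIntegral.integral_neg] at this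
      linarith
    have cw := continuous_wt_ofReal hβ
    have e : ∀ x : ℝ, rodFun β 0 x * Complex.exp (-(2 * Real.pi * Complex.I * ξ) * x) =
        ((wt β x * Real.cos (2 * Real.pi * ξ * x) : ℝ) : ℂ) -
          Complex.I * ((wt β x * Real.sin (2 * Real.pi * ξ * x) : ℝ) : ℂ) := by
      intro x
      rw [rodFun_zero, show -(2 * Real.pi * Complex.I * ξ) * (x : ℂ) =
        -((2 * Real.pi * ξ * x : ℝ) : ℂ) * Complex.I by push_cast; ring, ← Complex.ofReal_neg,
        Complex.exp_mul_I, ← Complex.ofReal_cos, ← Complex.ofReal_sin, Real.cos_neg, Real.sin_neg]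
      push_cast; ring
    simp only [e]
    rw [intervalIntegral.integral_sub, intervalIntegral.integral_const_mul,
      intervalIntegral.integral_ofReal, intervalIntegral.integral_ofReal, h1]
    · simp [wtCos]
    · exact (Complex.continuous_ofReal.comp ((continuous_wt hβ).mul (by fun_prop))).intervalIntegrable _ _
    · exact (continuous_const.mul (Complex.continuous_ofReal.comp
        ((continuous_wt hβ).mul (by fun_prop)))).intervalIntegrable _ _
  | succ n ih =>
    rw [integral_rodFun_succ hβ n (f' := fun x => -(2 * Real.pi * Complex.I * ξ) *
        Complex.exp (-(2 * Real.pi * Complex.I * ξ) * x)) (fun x => ?_) (by fun_prop)]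
    · have h2 := ih (β := β + 1) (by linarith)
      simp only [mul_left_comm (rodFun _ _ _), intervalIntegral.integral_const_mul, h2]
      rw [show β + 1 + n = β + (n + 1 : ℕ) by push_cast; ring]
      ring
    · have := ((Complex.ofRealCLM.hasDerivAt (x := x)).const_mul (-(2 * Real.pi * Complex.I * ξ))).cexp
      refine this.congr_deriv ?_
      simp; ring

end RieszJacobi

end

noncomputable section

namespace RieszJacobi

open Filter Topology

/-! ### Parseval identities -/

lemma integral_mul_fourierInv {f g : ℝ → ℂ} (hf : Integrable f) (hg : Integrable g) :
    ∫ x, f x * 𝓕⁻ g x = ∫ ξ, 𝓕 f ξ * g (-ξ) := by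
  have h := VectorFourier.integral_fourierIntegral_smul_eq_flip (μ := volume) (ν := volume)
    (L := innerₗ ℝ) (f := f) (g := fun ξ => g (-ξ)) Real.continuous_fourierChar
    (by fun_prop) hf hg.comp_neg
  have e : ∀ x, 𝓕⁻ g x = 𝓕 (fun ξ => g (-ξ)) x := by
    intro x
    rw [Real.fourierInv_eq_fourier_comp_neg]
  simp only [e]
  rw [flip_innerₗ] at h
  exact h.symm

lemma IsTest.integrable_fourier {φ : ℝ → ℂ} (h : IsTest φ) : Integrable (𝓕 φ) := by
  have := h.integrable_symb_mul_fourier le_rfl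
  simpa [symb] using this

lemma IsTest.fourierInv_fourier {φ : ℝ → ℂ} (h : IsTest φ) : 𝓕⁻ (𝓕 φ) = φ :=
  h.continuous.fourierInv_fourier_eq h.integrable h.integrable_fourier

lemma integral_mul_test {f φ : ℝ → ℂ} (hf : Integrable f) (h : IsTest φ) :
    ∫ x, f x * φ x = ∫ ξ, 𝓕 f ξ * 𝓕 φ (-ξ) := by
  rw [← integral_mul_fourierInv hf h.integrable_fourier, h.fourierInv_fourier]

lemma integral_mul_rieszTest {f φ : ℝ → ℂ} (hf : Integrable f) (h : IsTest φ) {s : ℝ}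
    (hs : 0 ≤ s) :
    ∫ x, f x * rieszTest s φ x = rsign s * ∫ ξ, 𝓕 f ξ * (symb s ξ * 𝓕 φ (-ξ)) := by
  have := integral_mul_fourierInv hf (h.integrable_symb_mul_fourier hs)
  simp only [symb_neg] at this
  rw [← this, ← integral_const_mul]
  congr 1; funext x
  rw [rieszTest_eq]; ring

lemma norm_fourier_le (f : ℝ → ℂ) (ξ : ℝ) : ‖𝓕 f ξ‖ ≤ ∫ x, ‖f x‖ :=
  VectorFourier.norm_fourierIntegral_le_integral_norm _ _ _ _ _

lemma continuous_fourier {f : ℝ → ℂ} (hf : Integrable f) : Continuous (𝓕 f) :=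
  VectorFourier.fourierIntegral_continuous Real.continuous_fourierChar
    (by fun_prop) hf

/-! ### Approximation by test functions -/

/-- The dilation `c⁻¹ f (x / c)`. -/
def dilate (c : ℝ) (f : ℝ → ℂ) (x : ℝ) : ℂ := (c⁻¹ : ℝ) * f (c⁻¹ * x)

lemma integrable_dilate {c : ℝ} (hc : 0 < c) {f : ℝ → ℂ} (hf : Integrable f) :
    Integrable (dilate c f) :=
  (hf.comp_mul_left' (inv_ne_zero hc.ne')).const_mul _

lemma integral_dilate {c : ℝ} (hc : 0 < c) (f : ℝ → ℂ) (k : ℝ → ℂ) :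
    ∫ x, dilate c f x * k x = ∫ x, f x * k (c * x) := by
  have h := Measure.integral_comp_mul_left (fun x => f x * k (c * x)) c⁻¹
  rw [inv_inv, abs_of_pos hc] at h
  have hc' : (c : ℂ) ≠ 0 := by exact_mod_cast hc.ne'
  have e : ∀ x, dilate c f x * k x = (c⁻¹ : ℝ) * (f (c⁻¹ * x) * k (c * (c⁻¹ * x))) := by
    intro x
    rw [mul_inv_cancel_left₀ hc.ne', dilate, mul_assoc]
  simp only [e]
  rw [integral_const_mul, h]
  simp [hc']

lemma fourier_dilate {c : ℝ} (hc : 0 < c) (f : ℝ → ℂ) (ξ : ℝ) :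
    𝓕 (dilate c f) ξ = 𝓕 f (c * ξ) := by
  rw [Real.fourier_real_eq_integral_exp_smul, Real.fourier_real_eq_integral_exp_smul]
  simp only [smul_eq_mul, mul_comm (Complex.exp _)]
  rw [integral_dilate hc]
  congr 1; funext x
  congr 4; ring

/-- The dilation parameter of the approximation. -/
def lamSeq (i : ℕ) : ℝ := 1 - 1 / (i + 2)

/-- The mollification parameter of the approximation. -/
def delSeq (i : ℕ) : ℝ := 1 / (i + 2)

lemma delSeq_pos (i : ℕ) : 0 < delSeq i := by unfold delSeq; positivity

lemma lamSeq_add (i : ℕ) : lamSeq i + delSeq i = 1 := by simp [lamSeq, delSeq]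

lemma delSeq_le (i : ℕ) : delSeq i ≤ 1 / 2 := by
  unfold delSeq
  exact one_div_le_one_div_of_le (by norm_num) (by linarith [i.cast_nonneg (α := ℝ)])

lemma half_le_lamSeq (i : ℕ) : 1 / 2 ≤ lamSeq i := by linarith [delSeq_le i, lamSeq_add i]

lemma lamSeq_pos (i : ℕ) : 0 < lamSeq i := by linarith [half_le_lamSeq i]

lemma lamSeq_lt_one (i : ℕ) : lamSeq i < 1 := by linarith [delSeq_pos i, lamSeq_add i]

lemma inv_lamSeq_le (i : ℕ) : (lamSeq i)⁻¹ ≤ 2 := by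
  have := inv_anti₀ (by norm_num) (half_le_lamSeq i)
  simpa using this

lemma one_le_inv_lamSeq (i : ℕ) : 1 ≤ (lamSeq i)⁻¹ :=
  (one_le_inv₀ (lamSeq_pos i)).2 (lamSeq_lt_one i).le

lemma tendsto_delSeq : Tendsto delSeq atTop (𝓝 0) := by
  have h := (tendsto_one_div_add_atTop_nhds_zero_nat (𝕜 := ℝ)).comp (tendsto_add_atTop_nat 1)
  refine h.congr fun i => ?_
  simp only [Function.comp, delSeq]; push_cast; ring

lemma tendsto_lamSeq : Tendsto lamSeq atTop (𝓝 1) := by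
  have := tendsto_delSeq.const_sub 1
  simp only [sub_zero] at this
  exact this

lemma tendsto_inv_lamSeq : Tendsto (fun i => (lamSeq i)⁻¹) atTop (𝓝 1) := by
  simpa using tendsto_lamSeq.inv₀ one_ne_zero

/-- Approximations of a function supported in `[-1, 1]` by smooth functions with compact support
in `(-1, 1)`. -/
def approx (f : ℝ → ℂ) (i : ℕ) : ℝ → ℂ :=
  convolution (dilate (delSeq i) bump) (dilate (lamSeq i) f) (ContinuousLinearMap.mul ℂ ℂ) volume

lemma approx_eq (f : ℝ → ℂ) (i : ℕ) (x : ℝ) :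
    approx f i x = ∫ z, bump z * dilate (lamSeq i) f (x - delSeq i * z) :=
  integral_dilate (delSeq_pos i) bump (fun t => dilate (lamSeq i) f (x - t))

lemma bump_eq_zero {z : ℝ} (hz : 1 / 2 ≤ |z|) : bump z = 0 := by
  have : z ∉ Function.support (bumpBase.normed volume) := by
    rw [bumpBase.support_normed_eq]
    simpa [bumpBase] using hz
  simp only [Function.mem_support, not_not] at this
  simp [bump, this]

lemma norm_bump (z : ℝ) : ((‖bump z‖ : ℝ) : ℂ) = bump z := by
  have : 0 ≤ bumpBase.normed volume z := bumpBase.nonneg_normed z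
  rw [bump, Complex.norm_real, Real.norm_of_nonneg this]

lemma integral_norm_bump : ∫ z, ‖bump z‖ = 1 := by
  have h : ((∫ z, ‖bump z‖ : ℝ) : ℂ) = 1 := by
    rw [← integral_complex_ofReal]
    simp only [norm_bump, integral_bump]
  exact_mod_cast h

lemma fourier_approx {f : ℝ → ℂ} (hf : Integrable f) (i : ℕ) (ξ : ℝ) :
    𝓕 (approx f i) ξ = 𝓕 bump (delSeq i * ξ) * 𝓕 f (lamSeq i * ξ) := by
  unfold approx
  rw [Real.fourier_mul_convolution_eq (integrable_dilate (delSeq_pos i) isTestIn_bump.isTest.integrable)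
    (integrable_dilate (lamSeq_pos i) hf), fourier_dilate (delSeq_pos i), fourier_dilate (lamSeq_pos i)]

lemma dilate_lamSeq_eq_zero {f : ℝ → ℂ} (h0 : ∀ x ∉ Ioo (-1 : ℝ) 1, f x = 0) (i : ℕ) {x z : ℝ} (hx : lamSeq i + delSeq i / 2 ≤ |x|)
    (hz : |z| ≤ 1 / 2) : dilate (lamSeq i) f (x - delSeq i * z) = 0 := by
  rw [dilate, h0, mul_zero]
  rw [mem_Ioo, ← abs_lt, not_lt, abs_mul, abs_of_pos (inv_pos.2 (lamSeq_pos i)),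
    ← div_eq_inv_mul, le_div_iff₀ (lamSeq_pos i), one_mul]
  have h1 := abs_sub_abs_le_abs_sub x (delSeq i * z)
  rw [abs_mul, abs_of_pos (delSeq_pos i)] at h1
  have := mul_le_mul_of_nonneg_left hz (delSeq_pos i).le
  linarith

lemma isTestIn_approx {f : ℝ → ℂ} (hf : Integrable f) (h0 : ∀ x ∉ Ioo (-1 : ℝ) 1, f x = 0)
    (i : ℕ) : IsTestIn (approx f i) := by
  refine ⟨?_, lamSeq i + delSeq i / 2, by linarith [lamSeq_pos i, delSeq_pos i],
    by linarith [lamSeq_add i, delSeq_pos i], fun x hx => ?_⟩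
  · have h1 : HasCompactSupport (dilate (delSeq i) bump) :=
      (isTestIn_bump.isTest.hasCompactSupport.comp_homeomorph
        (Homeomorph.mulLeft₀ _ (inv_ne_zero (delSeq_pos i).ne'))).mul_left
    have h2 : ContDiff ℝ ∞ (dilate (delSeq i) bump) :=
      contDiff_const.mul (isTestIn_bump.contDiff.comp (contDiff_const.mul contDiff_id))
    exact h1.contDiff_convolution_left (ContinuousLinearMap.mul ℝ ℂ) (n := ⊤) h2
      (integrable_dilate (lamSeq_pos i) hf).locallyIntegrable
  · rw [approx_eq]
    refine integral_eq_zero_of_ae (Eventually.of_forall fun z => ?_)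
    simp only [Pi.zero_apply]
    rcases le_total (1 / 2) |z| with hz | hz
    · rw [bump_eq_zero hz, zero_mul]
    · rw [dilate_lamSeq_eq_zero h0 i hx hz, mul_zero]

lemma tendsto_fourier_bump {c : ℕ → ℝ} (hc : Tendsto c atTop (𝓝 0)) :
    Tendsto (fun i => 𝓕 bump (c i)) atTop (𝓝 1) := by
  have h1 : 𝓕 bump 0 = 1 := by
    rw [Real.fourier_real_eq_integral_exp_smul]
    simp [integral_bump]
  have := (isTestIn_bump.isTest.continuous_fourier.tendsto 0).comp hc
  rwa [h1] at this

lemma norm_fourier_bump_le (ξ : ℝ) : ‖𝓕 bump ξ‖ ≤ 1 := by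
  have := norm_fourier_le bump ξ
  rwa [integral_norm_bump] at this

lemma tendsto_fourier_approx {f : ℝ → ℂ} (hf : Integrable f) (ξ : ℝ) :
    Tendsto (fun i => 𝓕 (approx f i) ξ) atTop (𝓝 (𝓕 f ξ)) := by
  simp only [fourier_approx hf]
  have h1 : Tendsto (fun i => 𝓕 bump (delSeq i * ξ)) atTop (𝓝 1) :=
    tendsto_fourier_bump (by simpa using tendsto_delSeq.mul_const ξ)
  have h2 : Tendsto (fun i => lamSeq i * ξ) atTop (𝓝 ξ) := by
    simpa using tendsto_lamSeq.mul_const ξ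
  simpa using h1.mul (((continuous_fourier hf).tendsto ξ).comp h2)

lemma norm_approx_le {f : ℝ → ℂ} {β C : ℝ} (hβ : 0 ≤ β) (hC : 0 ≤ C)
    (h0 : ∀ x ∉ Ioo (-1 : ℝ) 1, f x = 0) (hb : ∀ x ∈ Ioo (-1 : ℝ) 1, ‖f x‖ ≤ C * wt β x) (i : ℕ)
    {x : ℝ} (hx : x ∈ Ioo (-1 : ℝ) 1) : ‖approx f i x‖ ≤ 2 * C * 4 ^ β * wt β x := by
  have hx1 := one_sub_sq_pos hx
  have key : ∀ z, |z| ≤ 1 / 2 →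
      ‖dilate (lamSeq i) f (x - delSeq i * z)‖ ≤ 2 * C * 4 ^ β * wt β x := by
    intro z hz
    have hR : 0 ≤ 2 * C * 4 ^ β * wt β x := by
      have := (wt_pos (γ := β) hx).le
      positivity
    set y := (lamSeq i)⁻¹ * (x - delSeq i * z) with hy
    by_cases hyΛ : y ∈ Ioo (-1 : ℝ) 1
    · have hlam := lamSeq_pos i
      rw [dilate, norm_mul, ← hy, Complex.norm_real, Real.norm_of_nonneg (inv_pos.2 hlam).le]
      have h1 : 1 - y ^ 2 ≤ 4 * (1 - x ^ 2) := by
        have ey : lamSeq i * y = x - delSeq i * z := by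
          rw [hy, mul_inv_cancel_left₀ hlam.ne']
        have h2 : |x| ≤ lamSeq i * |y| + delSeq i * (1 / 2) := by
          have : x = lamSeq i * y + delSeq i * z := by rw [ey]; ring
          calc |x| = |lamSeq i * y + delSeq i * z| := by rw [← this]
            _ ≤ |lamSeq i * y| + |delSeq i * z| := abs_add_le _ _
            _ ≤ _ := by
              rw [abs_mul (lamSeq i), abs_mul (delSeq i), abs_of_pos hlam, abs_of_pos (delSeq_pos i)]
              have := mul_le_mul_of_nonneg_left hz (delSeq_pos i).le
              linarith
        have hy1 : |y| < 1 := abs_lt.2 hyΛ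
        have hx2 : |x| < 1 := abs_lt.2 hx
        have h3 : lamSeq i * (1 - |y|) ≤ 1 - |x| := by
          have := lamSeq_add i
          have := delSeq_pos i
          nlinarith
        have h4 : 1 - |y| ≤ 2 * (1 - |x|) := by
          have := half_le_lamSeq i
          nlinarith
        rw [← sq_abs x, ← sq_abs y]
        nlinarith [abs_nonneg x, abs_nonneg y]
      have h5 : wt β y ≤ 4 ^ β * wt β x := by
        unfold wt
        rw [← Real.mul_rpow (by norm_num) hx1.le]
        exact Real.rpow_le_rpow (one_sub_sq_pos hyΛ).le h1 hβ
      calc (lamSeq i)⁻¹ * ‖f y‖ ≤ 2 * (C * (4 ^ β * wt β x)) := by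
            gcongr
            · exact inv_lamSeq_le i
            · exact (hb y hyΛ).trans (by gcongr)
        _ = _ := by ring
    · rw [dilate, ← hy, h0 y hyΛ, mul_zero, norm_zero]
      exact hR
  rw [approx_eq]
  have hbi : Integrable (fun z => ‖bump z‖ * (2 * C * 4 ^ β * wt β x)) :=
    isTestIn_bump.isTest.integrable.norm.mul_const _
  refine (norm_integral_le_of_norm_le hbi (Eventually.of_forall fun z => ?_)).trans ?_
  · rw [norm_mul]
    rcases le_total (1 / 2) |z| with hz | hz
    · simp [bump_eq_zero hz]
    · exact mul_le_mul_of_nonneg_left (key z hz) (norm_nonneg _)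
  · rw [integral_mul_const, integral_norm_bump, one_mul]

lemma tendsto_approx {f : ℝ → ℂ} (hf : AEStronglyMeasurable f) {C : ℝ} (hb : ∀ x, ‖f x‖ ≤ C) {x : ℝ}
    (hc : ContinuousAt f x) : Tendsto (fun i => approx f i x) atTop (𝓝 (f x)) := by
  have e : f x = ∫ z, bump z * f x := by rw [integral_mul_const, integral_bump, one_mul]
  rw [e]
  simp only [approx_eq]
  have hC : 0 ≤ C := (norm_nonneg _).trans (hb 0)
  refine tendsto_integral_of_dominated_convergence (fun z => ‖bump z‖ * (2 * C)) (fun i => ?_)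
    (isTestIn_bump.isTest.integrable.norm.mul_const _) (fun i => Eventually.of_forall fun z => ?_)
    (Eventually.of_forall fun z => ?_)
  · refine isTestIn_bump.isTest.continuous.aestronglyMeasurable.mul ?_
    unfold dilate
    refine aestronglyMeasurable_const.mul (hf.comp_quasiMeasurePreserving ?_)
    have h1 : Measure.QuasiMeasurePreserving (fun z : ℝ => delSeq i * z) :=
      ⟨by fun_prop, by
        rw [Real.map_volume_mul_left (delSeq_pos i).ne']
        exact Measure.smul_absolutelyContinuous⟩
    have h2 : Measure.QuasiMeasurePreserving (fun z : ℝ => (lamSeq i)⁻¹ * z) :=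
      ⟨by fun_prop, by
        rw [Real.map_volume_mul_left (inv_ne_zero (lamSeq_pos i).ne')]
        exact Measure.smul_absolutelyContinuous⟩
    exact h2.comp ((Measure.measurePreserving_sub_left volume x).quasiMeasurePreserving.comp h1)
  · rw [norm_mul]
    refine mul_le_mul_of_nonneg_left ?_ (norm_nonneg _)
    rw [dilate, norm_mul, Complex.norm_real, Real.norm_of_nonneg (inv_pos.2 (lamSeq_pos i)).le]
    exact mul_le_mul (inv_lamSeq_le i) (hb _) (norm_nonneg _) (by norm_num)
  · refine tendsto_const_nhds.mul ?_
    unfold dilate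
    have h1 : Tendsto (fun i => (lamSeq i)⁻¹ * (x - delSeq i * z)) atTop (𝓝 x) := by
      have := tendsto_inv_lamSeq.mul ((tendsto_delSeq.mul_const z).const_sub x)
      simpa using this
    have h2 : Tendsto (fun i => (((lamSeq i)⁻¹ : ℝ) : ℂ)) atTop (𝓝 ((1 : ℝ) : ℂ)) :=
      (Complex.continuous_ofReal.tendsto 1).comp tendsto_inv_lamSeq
    simpa using h2.mul (hc.tendsto.comp h1)

end RieszJacobi

end

noncomputable section

namespace RieszJacobi

open Filter Topology Polynomial

/-! ### The energy pairing with Rodrigues functions -/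

lemma zeroExt_of_mem (v : ℝ → ℂ) {x : ℝ} (hx : x ∈ Ioo (-1 : ℝ) 1) : zeroExt v x = v x :=
  indicator_of_mem hx v

lemma zeroExt_of_notMem (v : ℝ → ℂ) {x : ℝ} (hx : x ∉ Ioo (-1 : ℝ) 1) : zeroExt v x = 0 :=
  indicator_of_notMem hx v

lemma integral_zeroExt_mul (v k : ℝ → ℂ) :
    ∫ x, zeroExt v x * k x = ∫ x in (-1 : ℝ)..1, v x * k x := by
  rw [intervalIntegral.integral_of_le (by norm_num), integral_Ioc_eq_integral_Ioo,
    ← integral_indicator measurableSet_Ioo]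
  congr 1; funext x
  by_cases hx : x ∈ Ioo (-1 : ℝ) 1
  · rw [zeroExt_of_mem v hx, indicator_of_mem hx]
  · rw [zeroExt_of_notMem v hx, indicator_of_notMem hx, zero_mul]

lemma integrable_zeroExt {v : ℝ → ℂ} (hv : Continuous v) : Integrable (zeroExt v) :=
  ((hv.integrableOn_Icc (a := -1) (b := 1)).mono_set Ioo_subset_Icc_self).integrable_indicator
    measurableSet_Ioo

/-- The energy pairing `∫ |2πξ|^{2α} û(ξ) Ĝ(-ξ) dξ`. -/
def energy (α : ℝ) (f g : ℝ → ℂ) : ℂ := ∫ ξ, 𝓕 f ξ * (symb (2 * α) ξ * 𝓕 g (-ξ))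

lemma two_pi_one_le : (1 : ℝ) ≤ 2 * Real.pi := by linarith [Real.pi_gt_three]

/-- Decay of the Fourier transform of Rodrigues functions. -/
lemma exists_norm_symb_mul_fourier_rodFun_le {α : ℝ} (hα : 0 ≤ α) (n : ℕ) :
    ∃ C : ℝ, 0 ≤ C ∧ ∀ ξ, ‖symb α ξ * 𝓕 (zeroExt (rodFun α n)) ξ‖ ≤ C / (1 + |2 * Real.pi * ξ|) := by
  obtain ⟨C, hC, h⟩ := exists_abs_rpow_mul_wtCos_le (γ := α + n) (by positivity)
  refine ⟨C, hC, fun ξ => ?_⟩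
  refine le_trans (le_of_eq ?_) (h (2 * Real.pi * ξ))
  rw [fourier_rodFun hα, norm_mul, norm_symb, norm_mul, norm_pow, Complex.norm_real,
    Real.norm_eq_abs, Real.rpow_add_of_nonneg (abs_nonneg _) hα n.cast_nonneg, Real.rpow_natCast]
  simp [abs_mul]
  ring

lemma memLp_inv_one_add : MemLp (fun ξ : ℝ => 1 / (1 + |2 * Real.pi * ξ|)) 2 := by
  have hc : Continuous (fun ξ : ℝ => 1 / (1 + |2 * Real.pi * ξ|)) := by
    refine Continuous.div continuous_const (by fun_prop) fun ξ => ?_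
    positivity
  rw [memLp_two_iff_integrable_sq hc.aestronglyMeasurable]
  refine integrable_inv_one_add_sq.mono' (hc.pow 2).aestronglyMeasurable
    (Eventually.of_forall fun ξ => ?_)
  rw [Real.norm_of_nonneg (by positivity), div_pow, one_pow, ← one_div]
  refine one_div_le_one_div_of_le (by positivity) ?_
  have h1 : |ξ| ≤ |2 * Real.pi * ξ| := by
    rw [abs_mul _ ξ, abs_of_pos (by positivity : 0 < 2 * Real.pi)]
    exact le_mul_of_one_le_left (abs_nonneg _) two_pi_one_le
  rw [← sq_abs ξ]
  nlinarith [abs_nonneg ξ, abs_nonneg (2 * Real.pi * ξ)]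

lemma memLp_symb_mul_fourier_rodFun {α : ℝ} (hα : 0 ≤ α) (n : ℕ) :
    MemLp (fun ξ => symb α ξ * 𝓕 (zeroExt (rodFun α n)) ξ) 2 := by
  obtain ⟨C, hC, h⟩ := exists_norm_symb_mul_fourier_rodFun_le hα n
  refine (memLp_inv_one_add.const_mul C).mono'
    ((continuous_symb hα).mul (continuous_fourier
      (integrable_zeroExt (continuous_rodFun hα n)))).aestronglyMeasurable
    (Eventually.of_forall fun ξ => ?_)
  simpa [div_eq_mul_inv] using h ξ

/-- A bound that serves in all applications of dominated convergence below. -/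
lemma integrable_norm_mul_inv {M : ℝ → ℂ} (hM : MemLp M 2) (C : ℝ) :
    Integrable (fun ξ => C * (‖M ξ‖ * (1 / (1 + |2 * Real.pi * ξ|)))) :=
  (hM.norm.integrable_mul memLp_inv_one_add).const_mul C

lemma exists_test_eq_poly (r : ℂ[X]) : ∃ R : ℝ → ℂ, IsTest R ∧ ∀ x ∈ Icc (-1 : ℝ) 1, R x = r.eval (x : ℂ) := by
  let b : ContDiffBump (0 : ℝ) := ⟨1, 2, by norm_num, by norm_num⟩
  refine ⟨fun x => (b x : ℂ) * r.eval (x : ℂ), ⟨?_, ?_⟩, fun x hx => ?_⟩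
  · refine (Complex.ofRealCLM.contDiff.comp b.contDiff).mul ?_
    have : (fun x : ℝ => r.eval (x : ℂ)) = fun x : ℝ => ∑ i ∈ Finset.range (r.natDegree + 1),
        r.coeff i * (x : ℂ) ^ i := by
      ext x; rw [eval_eq_sum_range]
    rw [this]
    refine ContDiff.sum fun i _ => contDiff_const.mul (Complex.ofRealCLM.contDiff.pow i)
  · have : HasCompactSupport (fun x => (b x : ℂ)) :=
      b.hasCompactSupport.comp_left (g := fun x : ℝ => (x : ℂ)) Complex.ofReal_zero
    exact this.mul_right
  · have : b x = 1 := b.one_of_mem_closedBall (by simpa [abs_le, Real.dist_eq, b] using hx)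
    simp [this]

section

variable {f : ℝ → ℂ}

/-- Passing to the limit in the approximation, tested against a test function. -/
lemma tendsto_integral_test_mul_approx (hf : Integrable f) (h0 : ∀ x ∉ Ioo (-1 : ℝ) 1, f x = 0)
    {R : ℝ → ℂ} (hR : IsTest R) :
    Tendsto (fun i => ∫ x, R x * approx f i x) atTop (𝓝 (∫ x, R x * f x)) := by
  have e : ∀ {g : ℝ → ℂ}, Integrable g → ∫ x, R x * g x = ∫ ξ, 𝓕 g ξ * 𝓕 R (-ξ) := by
    intro g hg
    rw [← integral_mul_test hg hR]
    simp only [mul_comm]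
  rw [e hf]
  simp only [fun i => e (isTestIn_approx hf h0 i).isTest.integrable]
  refine tendsto_integral_of_dominated_convergence (fun ξ => (∫ x, ‖f x‖) * ‖𝓕 R (-ξ)‖) (fun i => ?_)
    (hR.integrable_fourier.comp_neg.norm.const_mul _) (fun i => Eventually.of_forall fun ξ => ?_)
    (Eventually.of_forall fun ξ => (tendsto_fourier_approx hf ξ).mul_const _)
  · exact ((isTestIn_approx hf h0 i).isTest.continuous_fourier.mul
      (hR.continuous_fourier.comp continuous_neg)).aestronglyMeasurable
  · rw [norm_mul, fourier_approx hf, norm_mul]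
    refine mul_le_mul_of_nonneg_right ?_ (norm_nonneg _)
    calc ‖𝓕 bump (delSeq i * ξ)‖ * ‖𝓕 f (lamSeq i * ξ)‖ ≤ 1 * (∫ x, ‖f x‖) :=
          mul_le_mul (norm_fourier_bump_le _) (norm_fourier_le _ _) (norm_nonneg _) zero_le_one
      _ = _ := one_mul _

lemma norm_symb_le_of_abs_le {α ξ η : ℝ} (hα : 0 ≤ α) (h : |η| ≤ 2 * |ξ|) :
    ‖symb α η‖ ≤ 2 ^ α * ‖symb α ξ‖ := by
  rw [norm_symb, norm_symb, ← Real.mul_rpow (by norm_num) (abs_nonneg _)]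
  refine Real.rpow_le_rpow (abs_nonneg _) ?_ hα
  rw [abs_mul, abs_mul (2 * Real.pi) ξ, mul_left_comm]
  exact mul_le_mul_of_nonneg_left h (abs_nonneg _)

/-- The energy pairing of a function of finite energy with a Rodrigues function. -/
theorem energy_rodFun_eq {α : ℝ} (hα : 0 < α) (n : ℕ) (hf : Integrable f)
    (h0 : ∀ x ∉ Ioo (-1 : ℝ) 1, f x = 0) (hM : MemLp (fun ξ => symb α ξ * 𝓕 f ξ) 2)
    {r : ℂ[X]} (hr : ∀ φ, IsTestIn φ → ∫ x in (-1 : ℝ)..1, rodFun α n x * rieszTest (2 * α) φ x =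
        ∫ x in (-1 : ℝ)..1, r.eval (x : ℂ) * φ x) :
    energy α f (zeroExt (rodFun α n)) = rsign (2 * α) * ∫ x : ℝ, r.eval (x : ℂ) * f x := by
  set G := zeroExt (rodFun α n) with hG
  have iG : Integrable G := integrable_zeroExt (continuous_rodFun hα.le n)
  have hs : 0 ≤ 2 * α := by linarith
  have hpi := Real.pi_pos
  obtain ⟨R, hR, hRr⟩ := exists_test_eq_poly r
  have toR : ∀ {g : ℝ → ℂ}, (∀ x ∉ Ioo (-1 : ℝ) 1, g x = 0) → ∀ x : ℝ, r.eval (x : ℂ) * g x = R x * g x := by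
    intro g hg x
    by_cases hx : x ∈ Ioo (-1 : ℝ) 1
    · rw [hRr x (Ioo_subset_Icc_self hx)]
    · rw [hg x hx]; simp
  have key : ∀ i, ∫ ξ, 𝓕 (approx f i) ξ * (symb (2 * α) ξ * 𝓕 G (-ξ)) =
      rsign (2 * α) * ∫ x, R x * approx f i x := by
    intro i
    have ht := isTestIn_approx hf h0 i
    have h1 := hr _ ht
    rw [← integral_zeroExt_mul, ← ht.integral_eq, integral_mul_rieszTest iG ht.isTest hs] at h1
    simp only [toR (fun x hx => ht.eq_zero hx)] at h1
    rw [← h1, ← mul_assoc, rsign_mul_self, one_mul, ← integral_neg_eq_self]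
    congr 1; funext ξ
    rw [neg_neg, symb_neg]; ring
  have lim1 := (tendsto_integral_test_mul_approx hf h0 hR).const_mul (rsign (2 * α))
  simp only [← key] at lim1
  simp only [toR h0]
  refine tendsto_nhds_unique ?_ lim1
  have sub : ∀ i, ∫ ξ, 𝓕 (approx f i) ξ * (symb (2 * α) ξ * 𝓕 G (-ξ)) =
      ∫ ξ, (((lamSeq i)⁻¹ : ℝ) : ℂ) * (𝓕 bump (delSeq i * ((lamSeq i)⁻¹ * ξ)) * 𝓕 f ξ *
        (symb (2 * α) ((lamSeq i)⁻¹ * ξ) * 𝓕 G (-((lamSeq i)⁻¹ * ξ)))) := by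
    intro i
    have hl := lamSeq_pos i
    have h1 := Measure.integral_comp_mul_left
      (fun ξ => 𝓕 (approx f i) ξ * (symb (2 * α) ξ * 𝓕 G (-ξ))) (lamSeq i)⁻¹
    rw [inv_inv, abs_of_pos hl] at h1
    rw [integral_const_mul]
    have hc : (lamSeq i : ℂ) ≠ 0 := by exact_mod_cast hl.ne'
    simp only [fourier_approx hf, mul_inv_cancel_left₀ hl.ne'] at h1 ⊢
    rw [h1]
    simp [hc]
  simp only [sub]
  obtain ⟨C, hC, hdec⟩ := exists_norm_symb_mul_fourier_rodFun_le hα.le n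
  refine tendsto_integral_of_dominated_convergence
    (fun ξ => 2 * 2 ^ α * C * (‖symb α ξ * 𝓕 f ξ‖ * (1 / (1 + |2 * Real.pi * ξ|))))
    (fun i => ?_) (integrable_norm_mul_inv hM _) (fun i => Eventually.of_forall fun ξ => ?_)
    (Eventually.of_forall fun ξ => ?_)
  · have c1 := isTestIn_bump.isTest.continuous_fourier
    have c2 := continuous_fourier hf
    have c3 := continuous_fourier iG
    have c4 := continuous_symb hs
    refine Continuous.aestronglyMeasurable ?_
    fun_prop
  · have h1 := inv_lamSeq_le i
    have h2 := one_le_inv_lamSeq i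
    set c := (lamSeq i)⁻¹
    have hd := hdec (-(c * ξ))
    rw [symb_neg, mul_neg, abs_neg] at hd
    have h3 : C / (1 + |2 * Real.pi * (c * ξ)|) ≤ C * (1 / (1 + |2 * Real.pi * ξ|)) := by
      rw [div_eq_mul_one_div]
      refine mul_le_mul_of_nonneg_left (one_div_le_one_div_of_le (by positivity) ?_) hC
      rw [mul_left_comm, abs_mul c, abs_of_pos (by linarith : 0 < c)]
      have := abs_nonneg (2 * Real.pi * ξ)
      nlinarith
    have h4 : ‖symb α (c * ξ)‖ ≤ 2 ^ α * ‖symb α ξ‖ := by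
      refine norm_symb_le_of_abs_le hα.le ?_
      rw [abs_mul, abs_of_pos (by linarith : 0 < c)]
      exact mul_le_mul_of_nonneg_right h1 (abs_nonneg _)
    rw [show 2 * α = α + α by ring, symb_add hα.le hα.le]
    have e : ‖(c : ℂ) * (𝓕 bump (delSeq i * (c * ξ)) * 𝓕 f ξ *
        (symb α (c * ξ) * symb α (c * ξ) * 𝓕 G (-(c * ξ))))‖ =
        c * (‖𝓕 bump (delSeq i * (c * ξ))‖ * (‖symb α (c * ξ)‖ * (‖𝓕 f ξ‖ *
          ‖symb α (c * ξ) * 𝓕 G (-(c * ξ))‖))) := by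
      simp only [norm_mul, Complex.norm_real, Real.norm_of_nonneg (by linarith : 0 ≤ c)]
      ring
    rw [e]
    calc _ ≤ 2 * (1 * ((2 ^ α * ‖symb α ξ‖) * (‖𝓕 f ξ‖ * (C * (1 / (1 + |2 * Real.pi * ξ|)))))) := by
          gcongr
          · exact norm_fourier_bump_le _
          · exact hd.trans h3
      _ = _ := by rw [norm_mul]; ring
  · have h1 : Tendsto (fun i => (lamSeq i)⁻¹ * ξ) atTop (𝓝 ξ) := by
      simpa using tendsto_inv_lamSeq.mul_const ξ
    have h2 : Tendsto (fun i => (((lamSeq i)⁻¹ : ℝ) : ℂ)) atTop (𝓝 ((1 : ℝ) : ℂ)) :=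
      (Complex.continuous_ofReal.tendsto 1).comp tendsto_inv_lamSeq
    have h3 : Tendsto (fun i => 𝓕 bump (delSeq i * ((lamSeq i)⁻¹ * ξ))) atTop (𝓝 1) :=
      tendsto_fourier_bump (by simpa using tendsto_delSeq.mul h1)
    have h4 := ((continuous_symb hs).tendsto ξ).comp h1
    have h5 := ((continuous_fourier iG).tendsto (-ξ)).comp h1.neg
    have := h2.mul ((h3.mul_const (𝓕 f ξ)).mul (h4.mul h5))
    simpa using this

end

end RieszJacobi

end

noncomputable section

namespace RieszJacobi

open Filter Topology Polynomial

/-! ### Weighted square integrable functions -/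

lemma jacobiMeasure_eq (a : ℝ) :
    jacobiMeasure a = (volume.restrict (Ioo (-1) 1)).withDensity
      (fun x => ENNReal.ofReal (wt a x)) := by
  refine withDensity_congr_ae ?_
  filter_upwards [ae_restrict_mem measurableSet_Ioo] with x hx
  rw [wt, show 1 - x ^ 2 = (1 - x) * (1 + x) by ring,
    Real.mul_rpow (by linarith [hx.2]) (by linarith [hx.1])]

lemma measurable_wt (a : ℝ) : Measurable (wt a) := by
  unfold wt
  fun_prop

lemma integral_jacobiMeasure (a : ℝ) (k : ℝ → ℂ) :
    ∫ x, k x ∂(jacobiMeasure a) = ∫ x in (-1 : ℝ)..1, (wt a x : ℂ) * k x := by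
  rw [jacobiMeasure_eq, integral_withDensity_eq_integral_toReal_smul
    (measurable_wt a).ennreal_ofReal (by simp), intervalIntegral.integral_of_le (by norm_num),
    integral_Ioc_eq_integral_Ioo]
  refine setIntegral_congr_fun measurableSet_Ioo fun x hx => ?_
  simp only [ENNReal.toReal_ofReal (wt_pos hx).le]
  rfl

lemma integrable_jacobiMeasure_iff {a : ℝ} {k : ℝ → ℂ} :
    Integrable k (jacobiMeasure a) ↔
      Integrable (fun x => (wt a x : ℂ) * k x) (volume.restrict (Ioo (-1) 1)) := by
  rw [jacobiMeasure_eq, integrable_withDensity_iff_integrable_smul'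
    (measurable_wt a).ennreal_ofReal (by simp)]
  refine integrable_congr ?_
  filter_upwards [ae_restrict_mem measurableSet_Ioo] with x hx
  rw [ENNReal.toReal_ofReal (wt_pos hx).le]
  rfl

lemma restrict_absolutelyContinuous_jacobiMeasure (a : ℝ) :
    volume.restrict (Ioo (-1) 1) ≪ jacobiMeasure a := by
  rw [jacobiMeasure_eq]
  refine withDensity_absolutelyContinuous' (measurable_wt a).ennreal_ofReal.aemeasurable ?_
  filter_upwards [ae_restrict_mem measurableSet_Ioo] with x hx
  simpa using wt_pos hx

lemma jacobiMeasure_absolutelyContinuous (a : ℝ) :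
    jacobiMeasure a ≪ volume.restrict (Ioo (-1) 1) :=
  withDensity_absolutelyContinuous _ _

instance isFiniteMeasure_jacobiMeasure {a : ℝ} [Fact (0 ≤ a)] : IsFiniteMeasure (jacobiMeasure a) := by
  have h : Integrable (fun _ : ℝ => (1 : ℂ)) (jacobiMeasure a) := by
    rw [integrable_jacobiMeasure_iff]
    refine Integrable.mono_measure (ν := volume.restrict (Icc (-1) 1)) ?_
      (Measure.restrict_mono Ioo_subset_Icc_self le_rfl)
    exact ((continuous_wt_ofReal (Fact.out : 0 ≤ a)).mul continuous_const).integrableOn_Icc (μ := volume)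
  exact (integrable_const_iff.1 h).resolve_left one_ne_zero

lemma memLp_jacobiMeasure_of_continuous {a : ℝ} (ha : 0 ≤ a) {k : ℝ → ℂ} (hk : Continuous k) :
    MemLp k 2 (jacobiMeasure a) := by
  have : Fact (0 ≤ a) := ⟨ha⟩
  obtain ⟨C, hC⟩ := (isCompact_Icc (a := (-1 : ℝ)) (b := 1)).exists_bound_of_continuousOn hk.continuousOn
  refine MemLp.of_bound hk.aestronglyMeasurable C ?_
  refine (jacobiMeasure_absolutelyContinuous a).ae_le ?_
  filter_upwards [ae_restrict_mem measurableSet_Ioo] with x hx using hC x (Ioo_subset_Icc_self hx)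

lemma integrable_wt_mul_of_memLp {a : ℝ} (ha : 0 ≤ a) {g : ℝ → ℂ} (hg : MemLp g 2 (jacobiMeasure a)) :
    Integrable (fun x => (wt a x : ℂ) * g x) (volume.restrict (Ioo (-1) 1)) := by
  have : Fact (0 ≤ a) := ⟨ha⟩
  exact integrable_jacobiMeasure_iff.1 (hg.integrable (by norm_num))

lemma exists_norm_rodFun_le {β : ℝ} (k : ℕ) :
    ∃ C : ℝ, 0 ≤ C ∧ ∀ x ∈ Ioo (-1 : ℝ) 1, ‖zeroExt (rodFun β k) x‖ ≤ C * wt β x := by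
  obtain ⟨C, hC⟩ := (isCompact_Icc (a := (-1 : ℝ)) (b := 1)).exists_bound_of_continuousOn
    (rodrigues k β).continuous.continuousOn
  refine ⟨C, (norm_nonneg _).trans (hC 0 (by simp)), fun x hx => ?_⟩
  rw [zeroExt_of_mem _ hx, rodFun, norm_mul, mul_comm, Complex.norm_real, Complex.norm_real,
    Real.norm_of_nonneg (wt_pos hx).le]
  exact mul_le_mul_of_nonneg_right (hC x (Ioo_subset_Icc_self hx)) (wt_pos hx).le

/-- The pairing of the distributional derivative with a Rodrigues function, for the order of
differentiation at hand, is the energy pairing up to a sign. -/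
theorem norm_integral_mul_rodFun {α : ℝ} (hα : 0 < α) {ν m n k : ℕ} (hν : (ν : ℝ) ≤ α)
    (hβ : 0 ≤ α - 2 * ν + m) (hk : n + 2 * ν = k + m) {v g : ℝ → ℂ} (hf : Integrable (zeroExt v))
    (hM : MemLp (fun ξ => symb α ξ * 𝓕 (zeroExt v) ξ) 2)
    (hg : IsRieszDeriv Lam (2 * α - 2 * ν) m v g) (hg2 : MemLp g 2 (jacobiMeasure (α - 2 * ν + m))) :
    ‖∫ x in (-1 : ℝ)..1, rodFun (α - 2 * ν + m) k x * g x‖ =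
      ‖energy α (zeroExt v) (zeroExt (rodFun α n))‖ := by
  set β := α - 2 * ν + m with hβd
  set s := 2 * α - 2 * ν with hsd
  set f := zeroExt v with hfd
  set H := zeroExt (rodFun β k) with hH
  have hs : 0 ≤ s := by rw [hsd]; linarith
  have iH : Integrable H := integrable_zeroExt (continuous_rodFun hβ k)
  have hH0 : ∀ x ∉ Ioo (-1 : ℝ) 1, H x = 0 := fun x hx => zeroExt_of_notMem _ hx
  have hγ : β + k = α + n := by
    have : (n : ℝ) + 2 * ν = k + m := by exact_mod_cast hk
    rw [hβd]; linarith
  have ht := fun i => isTestIn_approx iH hH0 i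
  obtain ⟨C, hC, hCH⟩ := exists_norm_rodFun_le (β := β) k
  -- the limit on the physical side
  have lim1 : Tendsto (fun i => ∫ x in Ioo (-1 : ℝ) 1, g x * approx H i x) atTop
      (𝓝 (∫ x in Ioo (-1 : ℝ) 1, g x * H x)) := by
    refine tendsto_integral_of_dominated_convergence
      (fun x => 2 * C * 4 ^ β * ‖(wt β x : ℂ) * g x‖) (fun i => ?_)
      ((integrable_wt_mul_of_memLp hβ hg2).norm.const_mul _) (fun i => ?_) ?_
    · exact (hg2.aestronglyMeasurable.mono_ac (restrict_absolutelyContinuous_jacobiMeasure β)).mul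
        (ht i).isTest.continuous.aestronglyMeasurable
    · filter_upwards [ae_restrict_mem measurableSet_Ioo] with x hx
      have h1 := norm_approx_le hβ hC hH0 hCH i hx
      rw [norm_mul, norm_mul, Complex.norm_real, Real.norm_of_nonneg (wt_pos hx).le]
      calc ‖g x‖ * ‖approx H i x‖ ≤ ‖g x‖ * (2 * C * 4 ^ β * wt β x) := by gcongr
        _ = _ := by ring
    · filter_upwards [ae_restrict_mem measurableSet_Ioo] with x hx
      refine tendsto_const_nhds.mul ?_
      obtain ⟨C', hC'⟩ := (isCompact_Icc (a := (-1 : ℝ)) (b := 1)).exists_bound_of_continuousOn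
        (continuous_rodFun hβ k).continuousOn
      refine tendsto_approx iH.aestronglyMeasurable (C := C') (fun y => ?_) ?_
      · by_cases hy : y ∈ Ioo (-1 : ℝ) 1
        · rw [hH, zeroExt_of_mem _ hy]; exact hC' y (Ioo_subset_Icc_self hy)
        · rw [hH0 y hy, norm_zero]
          exact (norm_nonneg _).trans (hC' 0 (by simp))
      · refine (continuous_rodFun hβ k).continuousAt.congr ?_
        filter_upwards [isOpen_Ioo.mem_nhds hx] with y hy
        rw [hH, zeroExt_of_mem _ hy]
  have key : ∀ i, ∫ x in Ioo (-1 : ℝ) 1, g x * approx H i x = (-1) ^ m * (rsign s *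
      ∫ ξ, 𝓕 f ξ * (symb s ξ * ((2 * Real.pi * Complex.I * (-ξ : ℝ)) ^ m *
        (𝓕 bump (delSeq i * -ξ) * 𝓕 H (lamSeq i * -ξ))))) := by
    intro i
    have h1 := hg.2 ⟨approx H i, (ht i).contDiff, (ht i).isTest.hasCompactSupport, (ht i).tsupport_subset⟩
    refine h1.trans ?_
    change (-1) ^ m * ∫ x, f x * rieszTest s (iteratedDeriv m (approx H i)) x = _
    rw [integral_mul_rieszTest hf ((ht i).isTest.iteratedDeriv m) hs]
    simp only [(ht i).isTest.fourier_iteratedDeriv, fourier_approx iH]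
  -- the limit on the Fourier side
  have lim2 : Tendsto (fun i => ∫ ξ, 𝓕 f ξ * (symb s ξ * ((2 * Real.pi * Complex.I * (-ξ : ℝ)) ^ m *
        (𝓕 bump (delSeq i * -ξ) * 𝓕 H (lamSeq i * -ξ))))) atTop
      (𝓝 (∫ ξ, 𝓕 f ξ * (symb s ξ * ((2 * Real.pi * Complex.I * (-ξ : ℝ)) ^ m *
        (1 * 𝓕 H (-ξ)))))) := by
    obtain ⟨D, hD, hdec⟩ := exists_norm_symb_mul_fourier_rodFun_le hβ k
    refine tendsto_integral_of_dominated_convergence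
      (fun ξ => 2 ^ β * (2 * D) * (‖symb α ξ * 𝓕 f ξ‖ * (1 / (1 + |2 * Real.pi * ξ|))))
      (fun i => ?_) (integrable_norm_mul_inv hM _) (fun i => Eventually.of_forall fun ξ => ?_)
      (Eventually.of_forall fun ξ => ?_)
    · have c1 := isTestIn_bump.isTest.continuous_fourier
      have c2 := continuous_fourier hf
      have c3 := continuous_fourier iH
      have c4 := continuous_symb hs
      refine Continuous.aestronglyMeasurable ?_
      fun_prop
    · have h1 := half_le_lamSeq i
      set c := lamSeq i
      have hc0 : 0 < c := by linarith
      have hd := hdec (c * -ξ)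
      rw [mul_neg, symb_neg, mul_neg, abs_neg] at hd
      have h3 : D / (1 + |2 * Real.pi * (c * ξ)|) ≤ 2 * D * (1 / (1 + |2 * Real.pi * ξ|)) := by
        rw [mul_comm 2 D, mul_assoc D, div_eq_mul_one_div]
        refine mul_le_mul_of_nonneg_left ?_ hD
        rw [mul_one_div, div_le_div_iff₀ (by positivity) (by positivity), mul_left_comm (2 * Real.pi),
          abs_mul c, abs_of_pos hc0]
        have := abs_nonneg (2 * Real.pi * ξ)
        nlinarith
      have h4 : ‖symb β ξ‖ ≤ 2 ^ β * ‖symb β (c * ξ)‖ := by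
        refine norm_symb_le_of_abs_le hβ ?_
        rw [abs_mul, abs_of_pos hc0]
        have := abs_nonneg ξ
        nlinarith
      have h5 : ‖symb s ξ‖ * ‖(2 * Real.pi * Complex.I * (-ξ : ℝ)) ^ m‖ = ‖symb α ξ‖ * ‖symb β ξ‖ := by
        have e1 : ‖(2 * Real.pi * Complex.I * (-ξ : ℝ)) ^ m‖ = |2 * Real.pi * ξ| ^ (m : ℝ) := by
          rw [Real.rpow_natCast, norm_pow]
          congr 1
          simp [abs_mul]
        rw [e1, norm_symb, norm_symb, norm_symb, ← Real.rpow_add_of_nonneg (abs_nonneg _) hs m.cast_nonneg,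
          ← Real.rpow_add_of_nonneg (abs_nonneg _) hα.le hβ]
        congr 1
        rw [hsd, hβd]; ring
      calc ‖𝓕 f ξ * (symb s ξ * ((2 * Real.pi * Complex.I * (-ξ : ℝ)) ^ m *
            (𝓕 bump (delSeq i * -ξ) * 𝓕 H (c * -ξ))))‖
          = ‖𝓕 f ξ‖ * ((‖symb s ξ‖ * ‖(2 * Real.pi * Complex.I * (-ξ : ℝ)) ^ m‖) *
            (‖𝓕 bump (delSeq i * -ξ)‖ * ‖𝓕 H (-(c * ξ))‖)) := by
            simp only [norm_mul, mul_neg]; ring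
        _ ≤ ‖𝓕 f ξ‖ * ((‖symb α ξ‖ * (2 ^ β * ‖symb β (c * ξ)‖)) * (1 * ‖𝓕 H (-(c * ξ))‖)) := by
            rw [h5]
            gcongr
            exact norm_fourier_bump_le _
        _ = 2 ^ β * (‖𝓕 f ξ‖ * ‖symb α ξ‖) * ‖symb β (c * ξ) * 𝓕 H (-(c * ξ))‖ := by
            rw [norm_mul]; ring
        _ ≤ 2 ^ β * (‖𝓕 f ξ‖ * ‖symb α ξ‖) * (2 * D * (1 / (1 + |2 * Real.pi * ξ|))) := by
            gcongr
            exact hd.trans h3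
        _ = _ := by rw [norm_mul]; ring
    · refine tendsto_const_nhds.mul (tendsto_const_nhds.mul (tendsto_const_nhds.mul ?_))
      refine Tendsto.mul (tendsto_fourier_bump (by simpa using tendsto_delSeq.mul_const (-ξ))) ?_
      refine ((continuous_fourier iH).tendsto (-ξ)).comp ?_
      simpa using tendsto_lamSeq.mul_const (-ξ)
  have lim3 := (lim2.const_mul (rsign s)).const_mul ((-1) ^ m)
  simp only [← key] at lim3
  have h1 := tendsto_nhds_unique lim1 lim3
  have h2 : ∫ x in (-1 : ℝ)..1, rodFun β k x * g x = ∫ x in Ioo (-1 : ℝ) 1, g x * H x := by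
    rw [intervalIntegral.integral_of_le (by norm_num), integral_Ioc_eq_integral_Ioo]
    refine setIntegral_congr_fun measurableSet_Ioo fun x hx => ?_
    simp only [hH, zeroExt_of_mem _ hx, mul_comm]
  have h3 : ∫ ξ, 𝓕 f ξ * (symb s ξ * ((2 * Real.pi * Complex.I * (-ξ : ℝ)) ^ m * (1 * 𝓕 H (-ξ)))) =
      (-1) ^ ν * energy α f (zeroExt (rodFun α n)) := by
    unfold energy
    rw [← integral_const_mul]
    congr 1; funext ξ
    have e1 : ∀ ν : ℕ, symb (s + 2 * ν) ξ = (-1) ^ ν * (2 * Real.pi * Complex.I * ξ) ^ (2 * ν) * symb s ξ := by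
      intro ν
      induction ν with
      | zero => simp
      | succ j ih =>
        rw [show s + 2 * ((j + 1 : ℕ) : ℝ) = (s + 2 * j) + 2 by push_cast; ring,
          symb_add_two (by positivity), ih]
        ring
    have e2 : 2 * α = s + 2 * ν := by rw [hsd]; ring
    rw [e2, e1, hH, fourier_rodFun hβ, fourier_rodFun hα.le, hγ]
    have e3 : (2 * Real.pi * Complex.I * ((-ξ : ℝ) : ℂ)) ^ m * (2 * Real.pi * Complex.I * ((-ξ : ℝ) : ℂ)) ^ k =
        (2 * Real.pi * Complex.I * ((-ξ : ℝ) : ℂ)) ^ n * (2 * Real.pi * Complex.I * ξ) ^ (2 * ν) := by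
      rw [← pow_add, add_comm m k, ← hk, pow_add, pow_mul, pow_mul]
      congr 2
      push_cast; ring
    have e4 : ((-1 : ℂ) ^ ν) * (-1) ^ ν = 1 := by rw [← mul_pow]; simp
    linear_combination 𝓕 f ξ * symb s ξ * wtCos (α + n) (2 * Real.pi * -ξ) *
      (e3 - (2 * Real.pi * Complex.I * ((-ξ : ℝ) : ℂ)) ^ n * (2 * Real.pi * Complex.I * ξ) ^ (2 * ν) * e4)
  rw [h2, h1, h3]
  simp [norm_rsign]

end RieszJacobi

end

noncomputable section

namespace RieszJacobi

open Filter Topology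

/-! ### Riesz derivatives as square integrable functions -/

lemma locallyIntegrable_of_memLp {f : ℝ → ℂ} (hf : MemLp f 2) : LocallyIntegrable f :=
  hf.locallyIntegrable (by norm_num)

/-- The Fourier transform on `L²` is given by the integral for integrable functions. -/
lemma fourier_toLp_ae_eq {f : ℝ → ℂ} (hf : Integrable f) (hf2 : MemLp f 2) :
    ((𝓕 (hf2.toLp f) : Lp ℂ 2 (volume : Measure ℝ)) : ℝ → ℂ) =ᵐ[volume] 𝓕 f := by
  refine ae_eq_of_integral_contDiff_smul_eq (locallyIntegrable_of_memLp (Lp.memLp _))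
    (continuous_fourier hf).locallyIntegrable fun φ hφ hc => ?_
  have hφ' : ContDiff ℝ ∞ (fun x => (φ x : ℂ)) := Complex.ofRealCLM.contDiff.comp hφ
  have hc' : HasCompactSupport (fun x => (φ x : ℂ)) :=
    hc.comp_left (g := fun x : ℝ => (x : ℂ)) Complex.ofReal_zero
  have h1 := congrArg (fun T : 𝓢'(ℝ, ℂ) => T (hc'.toSchwartzMap hφ'))
    (Lp.fourier_toTemperedDistribution_eq (hf2.toLp f))
  simp only [TemperedDistribution.fourier_apply, Lp.toTemperedDistribution_apply] at h1
  have h2 : ∫ x, (φ x : ℂ) * (𝓕 (hf2.toLp f) : Lp ℂ 2 (volume : Measure ℝ)) x =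
      ∫ x, 𝓕 (fun x => (φ x : ℂ)) x * f x := by
    refine h1.symm.trans (integral_congr_ae ?_)
    filter_upwards [hf2.coeFn_toLp] with x hx
    rw [hx]; rfl
  have h3 : ∫ x, (φ x : ℂ) * 𝓕 f x = ∫ x, 𝓕 (fun x => (φ x : ℂ)) x * f x := by
    have iφ : Integrable (fun x => (φ x : ℂ)) := (IsTest.mk hφ' hc').integrable
    have := VectorFourier.integral_fourierIntegral_smul_eq_flip (μ := volume) (ν := volume)
      (L := innerₗ ℝ) Real.continuous_fourierChar (by fun_prop) iφ hf
    rw [flip_innerₗ] at this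
    exact this.symm
  simp only [Complex.real_smul]
  rw [h2, h3]

/-- Functions of finite energy. -/
structure FiniteEnergy (α : ℝ) (v : ℝ → ℂ) : Prop where
  integrable : Integrable (zeroExt v)
  memLp : MemLp (fun ξ => symb α ξ * 𝓕 (zeroExt v) ξ) 2

lemma integrable_zeroExt_of_memLp {v : ℝ → ℂ} (h : MemLp (zeroExt v) 2) : Integrable (zeroExt v) := by
  have h1 : MemLp (zeroExt v) 1 (volume.restrict (Ioo (-1) 1)) :=
    (h.restrict _).mono_exponent (by norm_num)
  have h2 := memLp_one_iff_integrable.1 h1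
  refine (integrableOn_iff_integrable_of_support_subset (s := Ioo (-1) 1) ?_).1 h2
  intro x hx
  by_contra hn
  exact hx (zeroExt_of_notMem _ hn)

lemma MemHStar.finiteEnergy {α : ℝ} (hα : 0 < α) {v : ℝ → ℂ} (h : MemHStar α v) :
    FiniteEnergy α v := by
  obtain ⟨h2, hS⟩ := h
  have hi := integrable_zeroExt_of_memLp h2
  refine ⟨hi, ?_⟩
  obtain ⟨f', hf'⟩ := TemperedDistribution.memSobolev_iff_exists_smulLeftCLM_fourier.1 hS
  set B : ℝ → ℂ := fun x => (((1 + ‖x‖ ^ 2) ^ (α / 2) : ℝ) : ℂ) with hB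
  have hBg : B.HasTemperateGrowth := by rw [hB]; fun_prop
  have hBc : Continuous B := hBg.1.continuous
  have key : (fun ξ => B ξ * 𝓕 (zeroExt v) ξ) =ᵐ[volume] f' := by
    refine ae_eq_of_integral_contDiff_smul_eq
      (hBc.mul (continuous_fourier hi)).locallyIntegrable
      (locallyIntegrable_of_memLp (Lp.memLp _)) fun φ hφ hc => ?_
    have hφ' : ContDiff ℝ ∞ (fun x => (φ x : ℂ)) := Complex.ofRealCLM.contDiff.comp hφ
    have hc' : HasCompactSupport (fun x => (φ x : ℂ)) :=
      hc.comp_left (g := fun x : ℝ => (x : ℂ)) Complex.ofReal_zero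
    have h1 := congrArg (fun T : 𝓢'(ℝ, ℂ) => T (hc'.toSchwartzMap hφ')) hf'
    rw [Lp.fourier_toTemperedDistribution_eq] at h1
    simp only [TemperedDistribution.smulLeftCLM_apply_apply, Lp.toTemperedDistribution_apply] at h1
    simp only [Complex.real_smul]
    refine Eq.trans ?_ h1
    refine integral_congr_ae ?_
    filter_upwards [fourier_toLp_ae_eq hi h2] with x hx
    rw [hx, SchwartzMap.smulLeftCLM_apply_apply hBg]
    simp only [smul_eq_mul]
    change (φ x : ℂ) * _ = B x * (φ x : ℂ) * _
    ring
  have hm : MemLp (fun ξ => B ξ * 𝓕 (zeroExt v) ξ) 2 := (memLp_congr_ae key).2 (Lp.memLp f')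
  refine (hm.const_mul (((2 * Real.pi) ^ α : ℝ) : ℂ)).mono
    ((continuous_symb hα.le).mul (continuous_fourier hi)).aestronglyMeasurable
    (Eventually.of_forall fun ξ => ?_)
  rw [norm_mul, norm_mul, norm_mul, ← mul_assoc]
  refine mul_le_mul_of_nonneg_right ?_ (norm_nonneg _)
  rw [norm_symb, Complex.norm_real, Complex.norm_real, Real.norm_of_nonneg (by positivity),
    Real.norm_of_nonneg (by positivity), abs_mul, abs_of_pos (by positivity : 0 < 2 * Real.pi),
    Real.mul_rpow (by positivity) (abs_nonneg _)]
  refine mul_le_mul_of_nonneg_left ?_ (by positivity)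
  have h3 : |ξ| ≤ (1 + ‖ξ‖ ^ 2) ^ ((1 : ℝ) / 2) := by
    rw [← Real.sqrt_eq_rpow]
    refine Real.le_sqrt_of_sq_le ?_
    rw [Real.norm_eq_abs]; linarith
  calc |ξ| ^ α ≤ ((1 + ‖ξ‖ ^ 2) ^ ((1 : ℝ) / 2)) ^ α := Real.rpow_le_rpow (abs_nonneg _) h3 hα.le
    _ = _ := by rw [← Real.rpow_mul (by positivity)]; congr 1; ring

open Classical in
/-- The Riesz derivative of a function of finite energy. -/
def rieszFun (α : ℝ) (v : ℝ → ℂ) : ℝ → ℂ :=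
  if h : MemLp (fun ξ => symb α ξ * 𝓕 (zeroExt v) ξ) 2 then
    fun x => rsign α * (𝓕⁻ (h.toLp _) : Lp ℂ 2 (volume : Measure ℝ)) x
  else 0

lemma FiniteEnergy.memLp_rieszFun {α : ℝ} {v : ℝ → ℂ} (h : FiniteEnergy α v) :
    MemLp (rieszFun α v) 2 := by
  rw [rieszFun, dif_pos h.memLp]
  exact (Lp.memLp _).const_mul _

lemma FiniteEnergy.eLpNorm_rieszFun {α : ℝ} {v : ℝ → ℂ} (h : FiniteEnergy α v) :
    eLpNorm (rieszFun α v) 2 = eLpNorm (fun ξ => symb α ξ * 𝓕 (zeroExt v) ξ) 2 := by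
  rw [rieszFun, dif_pos h.memLp]
  have e : (fun x => rsign α * (𝓕⁻ (h.memLp.toLp _) : Lp ℂ 2 (volume : Measure ℝ)) x) =
    rsign α • ((𝓕⁻ (h.memLp.toLp _) : Lp ℂ 2 (volume : Measure ℝ)) : ℝ → ℂ) := rfl
  rw [e, eLpNorm_const_smul, ← Lp.enorm_def]
  have h1 : ‖rsign α‖ₑ = 1 := by rw [← ofReal_norm, norm_rsign]; simp
  have h2 : ‖(𝓕⁻ (h.memLp.toLp _) : Lp ℂ 2 (volume : Measure ℝ))‖ = ‖h.memLp.toLp _‖ :=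
    (Lp.fourierTransformₗᵢ ℝ ℂ).symm.norm_map _
  rw [h1, one_mul, ← ofReal_norm, h2, ofReal_norm, Lp.enorm_toLp]

lemma FiniteEnergy.integral_rieszFun_mul {α : ℝ} {v φ : ℝ → ℂ} (h : FiniteEnergy α v) (hφ : IsTest φ) :
    ∫ x, rieszFun α v x * φ x =
      rsign α * ∫ ξ, 𝓕 (zeroExt v) ξ * (symb α ξ * 𝓕 φ (-ξ)) := by
  have h1 := congrArg (fun T : 𝓢'(ℝ, ℂ) => T (hφ.hasCompactSupport.toSchwartzMap hφ.contDiff))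
    (Lp.fourierInv_toTemperedDistribution_eq (h.memLp.toLp _))
  simp only [TemperedDistribution.fourierInv_apply, Lp.toTemperedDistribution_apply] at h1
  rw [rieszFun, dif_pos h.memLp]
  simp only [mul_assoc]
  rw [integral_const_mul]
  congr 1
  have h2 : ∫ x, (𝓕⁻ (h.memLp.toLp _) : Lp ℂ 2 (volume : Measure ℝ)) x * φ x =
      ∫ x, φ x * (𝓕⁻ (h.memLp.toLp _) : Lp ℂ 2 (volume : Measure ℝ)) x := by
    simp only [mul_comm]
  rw [h2]
  refine h1.symm.trans (integral_congr_ae ?_)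
  filter_upwards [h.memLp.coeFn_toLp] with ξ hξ
  rw [hξ, SchwartzMap.fourierInv_coe]
  change 𝓕⁻ φ ξ * _ = _
  rw [Real.fourierInv_eq_fourier_neg]
  ring

lemma setIntegral_mul_test (I : TopologicalSpace.Opens ℝ) (φ : 𝓓(I, ℂ)) (g : ℝ → ℂ) :
    ∫ x in (I : Set ℝ), g x * φ x = ∫ x, g x * φ x := by
  refine setIntegral_eq_integral_of_forall_compl_eq_zero fun x hx => ?_
  rw [image_eq_zero_of_notMem_tsupport fun h => hx (φ.tsupport_subset h), mul_zero]

lemma isTest_testFunction {I : TopologicalSpace.Opens ℝ} (φ : 𝓓(I, ℂ)) : IsTest φ :=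
  ⟨φ.contDiff, φ.hasCompactSupport⟩

lemma FiniteEnergy.isRieszDeriv {α : ℝ} (hα : 0 < α) {v : ℝ → ℂ} (h : FiniteEnergy α v)
    (I : TopologicalSpace.Opens ℝ) : IsRieszDeriv I α 0 v (rieszFun α v) := by
  refine ⟨(locallyIntegrable_of_memLp h.memLp_rieszFun).locallyIntegrableOn _, fun φ => ?_⟩
  rw [setIntegral_mul_test, h.integral_rieszFun_mul (isTest_testFunction φ), iteratedDeriv_zero,
    integral_mul_rieszTest h.integrable (isTest_testFunction φ) hα.le]
  simp

/-- Riesz derivatives are unique. -/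
lemma IsRieszDeriv.ae_eq {I : TopologicalSpace.Opens ℝ} {s : ℝ} {l : ℕ} {v g g' : ℝ → ℂ}
    (h : IsRieszDeriv I s l v g) (h' : IsRieszDeriv I s l v g') :
    g =ᵐ[volume.restrict I] g' := by
  have hI : MeasurableSet (I : Set ℝ) := I.isOpen.measurableSet
  have h1 : ∀ᵐ x, x ∈ (I : Set ℝ) → g x - g' x = 0 := by
    refine I.isOpen.ae_eq_zero_of_integral_contDiff_smul_eq_zero (h.1.sub h'.1) fun φ hφ hc hs => ?_
    have hφ' : ContDiff ℝ ∞ (fun x => (φ x : ℂ)) := Complex.ofRealCLM.contDiff.comp hφ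
    have hc' : HasCompactSupport (fun x => (φ x : ℂ)) :=
      hc.comp_left (g := fun x : ℝ => (x : ℂ)) Complex.ofReal_zero
    have hs' : tsupport (fun x => (φ x : ℂ)) ⊆ I := by
      refine (closure_mono fun x hx => ?_).trans hs
      simpa using hx
    let ψ : 𝓓(I, ℂ) := ⟨fun x => (φ x : ℂ), hφ', hc', hs'⟩
    have e := (h.2 ψ).trans (h'.2 ψ).symm
    rw [setIntegral_mul_test, setIntegral_mul_test] at e
    change ∫ x, g x * (φ x : ℂ) = ∫ x, g' x * (φ x : ℂ) at e
    have int : ∀ {k : ℝ → ℂ}, LocallyIntegrableOn k I volume → Integrable (fun x => k x * (φ x : ℂ)) := by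
      intro k hk
      have := (hk.integrableOn_compact_subset (t := tsupport φ) hs hc.isCompact)
      have h3 := IntegrableOn.continuousOn_mul (g := fun x => (φ x : ℂ)) (g' := k) hφ'.continuous.continuousOn this hc.isCompact
      have h4 := (integrableOn_iff_integrable_of_support_subset (s := tsupport φ) ?_).1 h3
      · refine h4.congr (Eventually.of_forall fun x => ?_)
        simp [mul_comm]
      · intro x hx
        by_contra hn
        refine hx ?_
        simp [image_eq_zero_of_notMem_tsupport hn]
    rw [← sub_eq_zero, ← integral_sub (int h.1) (int h'.1)] at e
    rw [← e]
    congr 1; funext x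
    change (φ x : ℝ) • (g x - g' x) = g x * (φ x : ℂ) - g' x * (φ x : ℂ)
    rw [Complex.real_smul]; ring
  rw [EventuallyEq, ae_restrict_iff' hI]
  filter_upwards [h1] with x hx hxI using sub_eq_zero.1 (hx hxI)

lemma zeroExt_add (v w : ℝ → ℂ) : zeroExt (v + w) = fun x => zeroExt v x + zeroExt w x := by
  ext x
  by_cases hx : x ∈ Ioo (-1 : ℝ) 1
  · simp [zeroExt_of_mem _ hx]
  · simp [zeroExt_of_notMem _ hx]

lemma zeroExt_smul (c : ℂ) (v : ℝ → ℂ) : zeroExt (c • v) = fun x => c * zeroExt v x := by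
  ext x
  by_cases hx : x ∈ Ioo (-1 : ℝ) 1
  · simp [zeroExt_of_mem _ hx]
  · simp [zeroExt_of_notMem _ hx]

lemma zeroExt_zeroExt (v : ℝ → ℂ) : zeroExt (zeroExt v) = zeroExt v := by
  simp [zeroExt]

namespace FiniteEnergy

variable {α : ℝ} {v w : ℝ → ℂ}

lemma add (hv : FiniteEnergy α v) (hw : FiniteEnergy α w) : FiniteEnergy α (v + w) := by
  refine ⟨?_, ?_⟩
  · rw [zeroExt_add]; exact hv.integrable.add hw.integrable
  · rw [zeroExt_add]
    refine (hv.memLp.add hw.memLp).ae_eq (Eventually.of_forall fun ξ => ?_)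
    simp only [Pi.add_apply]
    rw [fourier_fun_add hv.integrable hw.integrable, mul_add]

lemma smul (c : ℂ) (hv : FiniteEnergy α v) : FiniteEnergy α (c • v) := by
  refine ⟨?_, ?_⟩
  · rw [zeroExt_smul]; exact hv.integrable.const_mul c
  · rw [zeroExt_smul]
    refine (hv.memLp.const_mul c).ae_eq (Eventually.of_forall fun ξ => ?_)
    simp only [fourier_const_mul]; ring

lemma sub (hv : FiniteEnergy α v) (hw : FiniteEnergy α w) : FiniteEnergy α (v - w) := by
  have := hv.add (hw.smul (-1))
  rwa [neg_one_smul, ← sub_eq_add_neg] at this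

lemma zero (α : ℝ) : FiniteEnergy α 0 := by
  have e : zeroExt 0 = fun _ => 0 := by ext x; simp [zeroExt]
  refine ⟨by rw [e]; exact integrable_zero _ _ _, ?_⟩
  have h1 : 𝓕 (fun _ : ℝ => (0 : ℂ)) = fun _ => 0 := by
    ext ξ; rw [Real.fourier_real_eq]; simp
  rw [e, h1]
  simp

lemma sum {ι : Type*} (s : Finset ι) {f : ι → ℝ → ℂ} (h : ∀ i ∈ s, FiniteEnergy α (f i)) :
    FiniteEnergy α (∑ i ∈ s, f i) :=
  Finset.sum_induction f (FiniteEnergy α) (fun _ _ => add) (zero α) h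

end FiniteEnergy

lemma integrable_zeroExt_mul_rieszTest {s : ℝ} (hs : 0 ≤ s) {v φ : ℝ → ℂ} (hv : Integrable (zeroExt v))
    (hφ : IsTest φ) : Integrable (fun x => zeroExt v x * rieszTest s φ x) := by
  obtain ⟨C, hC⟩ := (isCompact_Icc (a := (-1 : ℝ)) (b := 1)).exists_bound_of_continuousOn
    (continuous_rieszTest hφ hs).continuousOn
  refine (hv.norm.mul_const C).mono'
    (hv.aestronglyMeasurable.mul (continuous_rieszTest hφ hs).aestronglyMeasurable)
    (Eventually.of_forall fun x => ?_)
  rw [norm_mul]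
  by_cases hx : x ∈ Ioo (-1 : ℝ) 1
  · exact mul_le_mul_of_nonneg_left (hC x (Ioo_subset_Icc_self hx)) (norm_nonneg _)
  · simp [zeroExt_of_notMem _ hx]

lemma FiniteEnergy.rieszFun_add {α : ℝ} (hα : 0 < α) {v w : ℝ → ℂ} (hv : FiniteEnergy α v)
    (hw : FiniteEnergy α w) :
    rieszFun α (v + w) =ᵐ[volume] fun x => rieszFun α v x + rieszFun α w x := by
  have h : IsRieszDeriv ⊤ α 0 (v + w) (fun x => rieszFun α v x + rieszFun α w x) := by
    refine ⟨(locallyIntegrable_of_memLp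
      (hv.memLp_rieszFun.add hw.memLp_rieszFun)).locallyIntegrableOn _, fun φ => ?_⟩
    have ht := isTest_testFunction φ
    have int : ∀ {z}, FiniteEnergy α z → Integrable (fun x => rieszFun α z x * φ x) := fun hz =>
      hz.memLp_rieszFun.integrable_mul
        (ht.continuous.memLp_of_hasCompactSupport ht.hasCompactSupport (p := 2))
    have e1 := (hv.isRieszDeriv hα ⊤).2 φ
    have e2 := (hw.isRieszDeriv hα ⊤).2 φ
    rw [setIntegral_mul_test] at e1 e2 ⊢
    simp only [iteratedDeriv_zero, zeroExt_add, add_mul] at e1 e2 ⊢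
    rw [integral_add (int hv) (int hw), e1, e2,
      integral_add (integrable_zeroExt_mul_rieszTest hα.le hv.integrable ht)
      (integrable_zeroExt_mul_rieszTest hα.le hw.integrable ht), mul_add]
  simpa using ((hv.add hw).isRieszDeriv hα ⊤).ae_eq h

lemma FiniteEnergy.rieszFun_smul {α : ℝ} (hα : 0 < α) (c : ℂ) {v : ℝ → ℂ} (hv : FiniteEnergy α v) :
    rieszFun α (c • v) =ᵐ[volume] fun x => c * rieszFun α v x := by
  have h : IsRieszDeriv ⊤ α 0 (c • v) (fun x => c * rieszFun α v x) := by
    refine ⟨(locallyIntegrable_of_memLp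
      (hv.memLp_rieszFun.const_mul c)).locallyIntegrableOn _, fun φ => ?_⟩
    have e1 := (hv.isRieszDeriv hα ⊤).2 φ
    simp only [iteratedDeriv_zero, zeroExt_smul, mul_assoc] at e1 ⊢
    rw [integral_const_mul, integral_const_mul, e1]
    ring
  simpa using ((hv.smul c).isRieszDeriv hα ⊤).ae_eq h

end RieszJacobi

end

noncomputable section

namespace RieszJacobi

open Filter Topology Polynomial

/-! ### Orthogonality of the Rodrigues functions -/

lemma finiteEnergy_rodFun {α : ℝ} (hα : 0 < α) (n : ℕ) : FiniteEnergy α (rodFun α n) :=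
  ⟨integrable_zeroExt (continuous_rodFun hα.le n), memLp_symb_mul_fourier_rodFun hα.le n⟩

lemma conj_fourier_rodFun {α : ℝ} (hα : 0 < α) (n : ℕ) (ξ : ℝ) :
    (starRingEnd ℂ) (𝓕 (zeroExt (rodFun α n)) ξ) = 𝓕 (zeroExt (rodFun α n)) (-ξ) := by
  rw [fourier_rodFun hα.le, fourier_rodFun hα.le, mul_neg, wtCos_neg_arg]
  simp [Complex.conj_ofReal, Complex.conj_ofNat]

lemma energy_comm (α : ℝ) (f g : ℝ → ℂ) : energy α f g = energy α g f := by
  unfold energy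
  rw [← integral_neg_eq_self]
  congr 1; funext ξ
  rw [neg_neg, symb_neg]; ring

/-- The class of the weighted Fourier transform of a function of finite energy. -/
def FiniteEnergy.toLp {α : ℝ} {v : ℝ → ℂ} (h : FiniteEnergy α v) : Lp ℂ 2 (volume : Measure ℝ) :=
  h.memLp.toLp _

lemma inner_rodFun_eq_energy {α : ℝ} (hα : 0 < α) (n : ℕ) {v : ℝ → ℂ} (h : FiniteEnergy α v) :
    inner ℂ (finiteEnergy_rodFun hα n).toLp h.toLp =
      energy α (zeroExt v) (zeroExt (rodFun α n)) := by
  rw [L2.inner_def]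
  unfold energy FiniteEnergy.toLp
  refine integral_congr_ae ?_
  filter_upwards [h.memLp.coeFn_toLp, (finiteEnergy_rodFun hα n).memLp.coeFn_toLp] with ξ h1 h2
  rw [h1, h2, RCLike.inner_apply, map_mul, conj_symb, conj_fourier_rodFun hα,
    show 2 * α = α + α by ring, symb_add hα.le hα.le]
  ring

lemma energy_rodFun_rodFun {α : ℝ} (hα : 0 < α) (n k : ℕ) :
    energy α (zeroExt (rodFun α k)) (zeroExt (rodFun α n)) =
      if n = k then rsign (2 * α) * ((-1) ^ n * wtConst (α + n) * wtInt (α + n)) else 0 := by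
  have key : ∀ {n k : ℕ}, n ≤ k → energy α (zeroExt (rodFun α k)) (zeroExt (rodFun α n)) =
      if n = k then rsign (2 * α) * ((-1) ^ n * wtConst (α + n) * wtInt (α + n)) else 0 := by
    intro n k hnk
    obtain ⟨r, hr, hc, hI⟩ := exists_poly_rieszTest n hα
    have hE := finiteEnergy_rodFun hα k
    rw [energy_rodFun_eq hα n hE.integrable (fun x hx => zeroExt_of_notMem _ hx) hE.memLp hI]
    simp only [mul_comm (eval _ r)]
    rw [integral_zeroExt_mul, integral_rodFun_mul_poly hα.le k (hr.trans hnk)]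
    split_ifs with h
    · subst h
      have h2 : ((n.factorial : ℕ) : ℂ) ≠ 0 := by exact_mod_cast n.factorial_ne_zero
      rw [hc]
      field_simp
    · rw [coeff_eq_zero_of_natDegree_lt (by omega)]
      ring
  rcases le_total n k with h | h
  · exact key h
  · rw [energy_comm, key h]
    by_cases e : k = n
    · subst e; simp
    · simp [e, Ne.symm e]

lemma toLp_rodFun_ne_zero {α : ℝ} (hα : 0 < α) (n : ℕ) : (finiteEnergy_rodFun hα n).toLp ≠ 0 := by
  intro h0
  have h1 : (fun ξ => symb α ξ * 𝓕 (zeroExt (rodFun α n)) ξ) =ᵐ[volume] 0 := by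
    have := (finiteEnergy_rodFun hα n).memLp.coeFn_toLp
    have h2 : (finiteEnergy_rodFun hα n).memLp.toLp _ = 0 := h0
    rw [h2] at this
    exact this.symm.trans (Lp.coeFn_zero _ _ _)
  have hc : Continuous fun ξ => symb α ξ * 𝓕 (zeroExt (rodFun α n)) ξ :=
    (continuous_symb hα.le).mul (continuous_fourier (finiteEnergy_rodFun hα n).integrable)
  have h2 := (hc.ae_eq_iff_eq volume continuous_zero).1 h1
  have h3 : 0 < wtCos (α + n) 0 := by
    simpa [wtCos, wtInt] using wtInt_pos (γ := α + n) (by positivity)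
  have h4 : ∀ᶠ ξ : ℝ in 𝓝[>] 0, 0 < wtCos (α + n) (2 * Real.pi * ξ) := by
    have : Continuous fun ξ : ℝ => wtCos (α + n) (2 * Real.pi * ξ) :=
      (continuous_wtCos (by positivity)).comp (by fun_prop)
    refine (this.tendsto 0).eventually (lt_mem_nhds (by simpa using h3)) |>.filter_mono nhdsWithin_le_nhds
  obtain ⟨ξ, hξ, hξ0⟩ := (h4.and self_mem_nhdsWithin).exists
  have hξ0' : ξ ≠ 0 := (mem_Ioi.1 hξ0).ne'
  have h5 := congrFun h2 ξ
  simp only [Pi.zero_apply, fourier_rodFun hα.le, mul_eq_zero, pow_eq_zero_iff', Complex.ofReal_eq_zero] at h5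
  rcases h5 with h5 | h5 | h5
  · have := norm_symb α ξ
    rw [h5, norm_zero] at this
    have h6 : 0 < |2 * Real.pi * ξ| := abs_pos.2 (by positivity)
    exact (Real.rpow_pos_of_pos h6 α).ne this
  · simp [hξ0', Real.pi_ne_zero] at h5
  · exact hξ.ne' h5

lemma norm_toLp_rodFun_sq {α : ℝ} (hα : 0 < α) (n : ℕ) :
    ‖(finiteEnergy_rodFun hα n).toLp‖ ^ 2 = ‖wtConst (α + n)‖ * wtInt (α + n) := by
  have h1 := inner_rodFun_eq_energy hα n (finiteEnergy_rodFun hα n)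
  rw [energy_rodFun_rodFun hα, if_pos rfl, inner_self_eq_norm_sq_to_K] at h1
  have h2 := congrArg norm h1
  simpa [norm_rsign, abs_of_pos (wtInt_pos (γ := α + n) (by positivity))] using h2

lemma wtConst_ne_zero {γ : ℝ} (hγ : 0 < γ) : wtConst γ ≠ 0 := by
  intro h
  have := norm_toLp_rodFun_sq hγ 0
  simp only [Nat.cast_zero, add_zero, h, norm_zero, zero_mul] at this
  exact toLp_rodFun_ne_zero hγ 0 (norm_eq_zero.1 (pow_eq_zero_iff (two_ne_zero)|>.1 this))

lemma norm_wtConst_add {α : ℝ} (hα : 0 < α) (n : ℕ) :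
    ‖wtConst (α + n)‖ = Real.Gamma (2 * (α + n) + 1) / Real.Gamma (2 * α + 1) * ‖wtConst α‖ := by
  induction n with
  | zero =>
    have : Real.Gamma (2 * α + 1) ≠ 0 := (Real.Gamma_pos_of_pos (by linarith)).ne'
    simp [this]
  | succ n ih =>
    have hn : (0 : ℝ) ≤ n := n.cast_nonneg
    have hG : Real.Gamma (2 * (α + n + 1) + 1) =
        (2 * (α + n) + 2) * ((2 * (α + n) + 1) * Real.Gamma (2 * (α + n) + 1)) := by
      rw [show 2 * (α + n + 1) + 1 = (2 * (α + n) + 1 + 1) + 1 by ring,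
        Real.Gamma_add_one (by positivity), Real.Gamma_add_one (by positivity)]
      ring
    rw [show α + (n + 1 : ℕ) = (α + n) + 1 by push_cast; ring, wtConst_add_one (by positivity),
      norm_mul, ih, hG, norm_neg]
    have e : ‖((2 * ((α + n : ℝ) : ℂ) + 2) * (2 * ((α + n : ℝ) : ℂ) + 1))‖ =
        (2 * (α + n) + 2) * (2 * (α + n) + 1) := by
      rw [show (2 * ((α + n : ℝ) : ℂ) + 2) * (2 * ((α + n : ℝ) : ℂ) + 1) =
        (((2 * (α + n) + 2) * (2 * (α + n) + 1) : ℝ) : ℂ) by push_cast; ring, Complex.norm_real,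
        Real.norm_of_nonneg (by positivity)]
    rw [e]; ring

/-- Bessel's inequality for orthogonal vectors. -/
lemma sum_inner_sq_div_le {E ι : Type*} [NormedAddCommGroup E] [InnerProductSpace ℂ E] {b : ι → E}
    (h0 : ∀ i, b i ≠ 0) (ho : ∀ i j, i ≠ j → inner ℂ (b i) (b j) = 0) (s : Finset ι) (x : E) :
    ∑ i ∈ s, ‖inner ℂ (b i) x‖ ^ 2 / ‖b i‖ ^ 2 ≤ ‖x‖ ^ 2 := by
  have hon : Orthonormal ℂ (fun i => ((‖b i‖⁻¹ : ℝ) : ℂ) • b i) := by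
    refine ⟨fun i => ?_, fun i j hij => ?_⟩
    · rw [norm_smul, Complex.norm_real, norm_inv, norm_norm, inv_mul_cancel₀ (norm_ne_zero_iff.2 (h0 i))]
    · simp [inner_smul_left, inner_smul_right, ho i j hij]
  refine le_trans (le_of_eq ?_) (hon.sum_inner_products_le x (s := s))
  refine Finset.sum_congr rfl fun i _ => ?_
  rw [inner_smul_left, norm_mul, mul_pow]
  simp [div_eq_inv_mul]

/-! ### Orthogonality of the Rodrigues polynomials -/

/-- The Rodrigues polynomial as an element of the weighted space. -/
def rodLp {β : ℝ} (hβ : 0 ≤ β) (k : ℕ) : Lp ℂ 2 (jacobiMeasure β) :=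
  (memLp_jacobiMeasure_of_continuous hβ (continuous_real_eval (rodrigues k β))).toLp _

lemma inner_rodLp {β : ℝ} (hβ : 0 ≤ β) (k : ℕ) {g : ℝ → ℂ} (hg : MemLp g 2 (jacobiMeasure β)) :
    inner ℂ (rodLp hβ k) (hg.toLp g) = ∫ x in (-1 : ℝ)..1, rodFun β k x * g x := by
  have h := memLp_jacobiMeasure_of_continuous hβ (continuous_real_eval (rodrigues k β))
  rw [L2.inner_def]
  have e : ∫ x, inner ℂ ((rodLp hβ k : ℝ → ℂ) x) ((hg.toLp g : ℝ → ℂ) x) ∂(jacobiMeasure β) =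
      ∫ x, (((rodrigues k β).eval x : ℝ) : ℂ) * g x ∂(jacobiMeasure β) := by
    refine integral_congr_ae ?_
    filter_upwards [hg.coeFn_toLp, h.coeFn_toLp] with x h1 h2
    have h2' : (rodLp hβ k : ℝ → ℂ) x = (((rodrigues k β).eval x : ℝ) : ℂ) := h2
    rw [h1, h2', RCLike.inner_apply, Complex.conj_ofReal, mul_comm]
  rw [e, integral_jacobiMeasure]
  congr 1; funext x
  rw [rodFun]; ring

lemma inner_rodLp_rodLp {β : ℝ} (hβ : 0 ≤ β) {j k : ℕ} (hjk : j ≤ k) :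
    inner ℂ (rodLp hβ k) (rodLp hβ j) =
      (-1) ^ k * k.factorial * ((rodrigues j β).coeff k : ℝ) * wtInt (β + k) := by
  have h := memLp_jacobiMeasure_of_continuous hβ (continuous_real_eval (rodrigues j β))
  have h1 := inner_rodLp hβ k h
  have h2 := integral_rodFun_mul_poly hβ k (q := (rodrigues j β).map (algebraMap ℝ ℂ))
    ((natDegree_map_le).trans ((natDegree_rodrigues_le j β).trans hjk))
  have e : ∀ x : ℝ, ((rodrigues j β).map (algebraMap ℝ ℂ)).eval (x : ℂ) = (((rodrigues j β).eval x : ℝ) : ℂ) := by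
    intro x
    exact eval_map_algebraMap _ _ |>.trans (aeval_algebraMap_apply_eq_algebraMap_eval x _)
  simp only [e] at h2
  rw [coeff_map] at h2
  exact h1.trans h2

lemma norm_rodLp_sq {β : ℝ} (hβ : 0 ≤ β) (k : ℕ) :
    ‖rodLp hβ k‖ ^ 2 = k.factorial * (Real.Gamma (2 * (β + k) + 1) / Real.Gamma (2 * (β + k) - k + 1)) *
      wtInt (β + k) := by
  have h := inner_rodLp_rodLp hβ (le_refl k)
  rw [inner_self_eq_norm_sq_to_K, coeff_rodrigues k hβ] at h
  have e : ((-1 : ℝ) ^ k) * (-1) ^ k = 1 := by rw [← mul_pow]; simp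
  have h' : ‖rodLp hβ k‖ ^ 2 = (-1) ^ k * k.factorial * ((-1) ^ k * (Real.Gamma (2 * (β + k) + 1) /
    Real.Gamma (2 * (β + k) - k + 1))) * wtInt (β + k) := by
    refine Complex.ofReal_injective ?_
    push_cast
    simpa using h
  rw [h']
  linear_combination (k.factorial * (Real.Gamma (2 * (β + k) + 1) /
    Real.Gamma (2 * (β + k) - k + 1)) * wtInt (β + k)) * e

lemma rodLp_ne_zero {β : ℝ} (hβ : 0 ≤ β) (k : ℕ) : rodLp hβ k ≠ 0 := by
  intro h
  have h1 := norm_rodLp_sq hβ k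
  rw [h, norm_zero] at h1
  have h2 : 0 < Real.Gamma (2 * (β + k) + 1) := Real.Gamma_pos_of_pos (by positivity)
  have h3 : 0 < Real.Gamma (2 * (β + k) - k + 1) := Real.Gamma_pos_of_pos (by
    have : (0 : ℝ) ≤ k := k.cast_nonneg
    linarith)
  have h4 := wtInt_pos (γ := β + k) (by positivity)
  have h5 : (0 : ℝ) < k.factorial := by exact_mod_cast k.factorial_pos
  have : 0 < (k.factorial : ℝ) * (Real.Gamma (2 * (β + k) + 1) / Real.Gamma (2 * (β + k) - k + 1)) *
      wtInt (β + k) := by positivity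
  rw [← h1] at this
  simp at this

lemma inner_rodLp_of_ne {β : ℝ} (hβ : 0 ≤ β) {j k : ℕ} (hjk : j ≠ k) :
    inner ℂ (rodLp hβ j) (rodLp hβ k) = 0 := by
  have key : ∀ {j k : ℕ}, j < k → inner ℂ (rodLp hβ k) (rodLp hβ j) = 0 := by
    intro j k h
    rw [inner_rodLp_rodLp hβ h.le, coeff_eq_zero_of_natDegree_lt
      ((natDegree_rodrigues_le j β).trans_lt h)]
    simp
  rcases hjk.lt_or_gt with h | h
  · rw [← inner_conj_symm, key h, map_zero]
  · exact key h

lemma factorial_mul_rpow_le_Gamma {a : ℝ} (ha : 0 ≤ a) :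
    ∃ K : ℝ, 0 < K ∧ ∀ k : ℕ, k.factorial * ((k : ℝ) + 1) ^ a ≤ K * Real.Gamma (k + 1 + a) := by
  have base : ∀ θ : ℝ, 0 ≤ θ → θ ≤ 1 → ∀ k : ℕ,
      k.factorial * ((k : ℝ) + 1) ^ θ ≤ 1 / Real.Gamma (1 + θ) * Real.Gamma (k + 1 + θ) := by
    intro θ h0 h1 k
    induction k with
    | zero =>
      have : Real.Gamma (1 + θ) ≠ 0 := (Real.Gamma_pos_of_pos (by linarith)).ne'
      simp [this]
    | succ k ih =>
      have hk : (0 : ℝ) < k + 1 := by positivity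
      have hb : ((k : ℝ) + 2) ^ θ ≤ ((k : ℝ) + 1) ^ θ * ((k + 1 + θ) / (k + 1)) := by
        have h2 : (1 + 1 / ((k : ℝ) + 1)) ^ θ ≤ 1 + θ * (1 / ((k : ℝ) + 1)) :=
          rpow_one_add_le_one_add_mul_self (by
            have : 0 < 1 / ((k : ℝ) + 1) := by positivity
            linarith) h0 h1
        have h3 : (k : ℝ) + 2 = (k + 1) * (1 + 1 / (k + 1)) := by field_simp; ring
        rw [h3, Real.mul_rpow hk.le (by positivity)]
        refine mul_le_mul_of_nonneg_left (h2.trans (le_of_eq ?_)) (by positivity)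
        field_simp
      rw [Nat.factorial_succ, show ((k + 1 : ℕ) : ℝ) + 1 + θ = (k + 1 + θ) + 1 by push_cast; ring,
        Real.Gamma_add_one (by positivity)]
      push_cast
      rw [show (k : ℝ) + 1 + 1 = k + 2 by ring]
      calc ((k : ℝ) + 1) * k.factorial * ((k : ℝ) + 2) ^ θ
          ≤ ((k : ℝ) + 1) * k.factorial * (((k : ℝ) + 1) ^ θ * ((k + 1 + θ) / (k + 1))) := by gcongr
        _ = (k + 1 + θ) * (k.factorial * ((k : ℝ) + 1) ^ θ) := by field_simp
        _ ≤ (k + 1 + θ) * (1 / Real.Gamma (1 + θ) * Real.Gamma (k + 1 + θ)) := by gcongr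
        _ = _ := by ring
  have step : ∀ j : ℕ, ∀ θ : ℝ, 0 ≤ θ → θ ≤ 1 → ∀ k : ℕ,
      k.factorial * ((k : ℝ) + 1) ^ (θ + j) ≤ 1 / Real.Gamma (1 + θ) * Real.Gamma (k + 1 + (θ + j)) := by
    intro j θ h0 h1 k
    induction j with
    | zero => simpa using base θ h0 h1 k
    | succ j ih =>
      have hk : (0 : ℝ) < k + 1 := by positivity
      have hΓ : 0 < Real.Gamma (1 + θ) := Real.Gamma_pos_of_pos (by linarith)
      have hΓ' : 0 < Real.Gamma (k + 1 + (θ + j)) := Real.Gamma_pos_of_pos (by positivity)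
      rw [show θ + (j + 1 : ℕ) = (θ + j) + 1 by push_cast; ring, Real.rpow_add_one hk.ne', ← add_assoc,
        Real.Gamma_add_one (by positivity)]
      calc k.factorial * (((k : ℝ) + 1) ^ (θ + j) * (k + 1))
          = (k + 1) * (k.factorial * ((k : ℝ) + 1) ^ (θ + j)) := by ring
        _ ≤ (k + 1) * (1 / Real.Gamma (1 + θ) * Real.Gamma (k + 1 + (θ + j))) := by gcongr
        _ ≤ (k + 1 + (θ + j)) * (1 / Real.Gamma (1 + θ) * Real.Gamma (k + 1 + (θ + j))) := by
          have : 0 ≤ θ + j := by positivity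
          exact mul_le_mul_of_nonneg_right (by linarith) (by positivity)
        _ = _ := by ring
  have hfl := Nat.floor_le ha
  have hfl2 := Nat.lt_floor_add_one a
  refine ⟨1 / Real.Gamma (1 + (a - ⌊a⌋₊)), ?_, fun k => ?_⟩
  · have : 0 < Real.Gamma (1 + (a - ⌊a⌋₊)) := Real.Gamma_pos_of_pos (by linarith)
    positivity
  · simpa using step ⌊a⌋₊ (a - ⌊a⌋₊) (by linarith) (by linarith) k

end RieszJacobi

end

noncomputable section

namespace RieszJacobi

open Filter Topology Polynomial

/-! ### The energy space -/

namespace FiniteEnergy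

variable {α : ℝ} {v w : ℝ → ℂ}

lemma coeFn_toLp (h : FiniteEnergy α v) :
    (h.toLp : ℝ → ℂ) =ᵐ[volume] fun ξ => symb α ξ * 𝓕 (zeroExt v) ξ :=
  h.memLp.coeFn_toLp

lemma toLp_add (hv : FiniteEnergy α v) (hw : FiniteEnergy α w) :
    (hv.add hw).toLp = hv.toLp + hw.toLp := by
  refine Lp.ext ?_
  filter_upwards [coeFn_toLp (hv.add hw), hv.coeFn_toLp, hw.coeFn_toLp, Lp.coeFn_add hv.toLp hw.toLp]
    with ξ h1 h2 h3 h4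
  rw [h1, h4, Pi.add_apply, h2, h3, zeroExt_add, fourier_fun_add hv.integrable hw.integrable, mul_add]

lemma toLp_smul (c : ℂ) (hv : FiniteEnergy α v) : (hv.smul c).toLp = c • hv.toLp := by
  refine Lp.ext ?_
  filter_upwards [coeFn_toLp (hv.smul c), hv.coeFn_toLp, Lp.coeFn_smul c hv.toLp] with ξ h1 h2 h3
  rw [h1, h3, Pi.smul_apply, h2, zeroExt_smul, fourier_const_mul, smul_eq_mul]
  ring

lemma toLp_congr (hv : FiniteEnergy α v) (hw : FiniteEnergy α w) (h : v = w) : hv.toLp = hw.toLp := by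
  subst h; rfl

lemma toLp_sub (hv : FiniteEnergy α v) (hw : FiniteEnergy α w) :
    (hv.sub hw).toLp = hv.toLp - hw.toLp := by
  rw [toLp_congr (hv.sub hw) (hv.add (hw.smul (-1))) (by rw [neg_one_smul, sub_eq_add_neg]),
    toLp_add hv (hw.smul (-1)), toLp_smul (-1) hw, neg_one_smul, sub_eq_add_neg]

lemma toLp_zero : (zero α).toLp = 0 := by
  rw [toLp_congr (zero α) ((zero α).smul 0) (by simp), toLp_smul 0 (zero α), zero_smul]

lemma toLp_sum {ι : Type*} (s : Finset ι) {f : ι → ℝ → ℂ} (h : ∀ i, FiniteEnergy α (f i)) :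
    (FiniteEnergy.sum s fun i _ => h i).toLp = ∑ i ∈ s, (h i).toLp := by
  classical
  induction s using Finset.induction_on with
  | empty => exact toLp_zero
  | insert i s hi ih =>
    rw [Finset.sum_insert (f := fun i => (h i).toLp) hi, ← ih,
      ← toLp_add (h i) (FiniteEnergy.sum s fun i _ => h i)]
    exact toLp_congr _ _ (Finset.sum_insert hi)

lemma enorm_toLp (h : FiniteEnergy α v) :
    ‖h.toLp‖ₑ = eLpNorm (fun ξ => symb α ξ * 𝓕 (zeroExt v) ξ) 2 :=
  Lp.enorm_toLp h.memLp

end FiniteEnergy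

lemma inner_toLp_rodFun {α : ℝ} (hα : 0 < α) {n k : ℕ} (h : n ≠ k) :
    inner ℂ (finiteEnergy_rodFun hα n).toLp (finiteEnergy_rodFun hα k).toLp = 0 := by
  rw [inner_rodFun_eq_energy hα n (finiteEnergy_rodFun hα k), energy_rodFun_rodFun hα, if_neg h]

/-! ### Partial sums of the expansion into Rodrigues functions -/

/-- The coefficients of the expansion of a function into Rodrigues functions. -/
def rodCoeff (α : ℝ) (v : ℝ → ℂ) (n : ℕ) : ℂ :=
  energy α (zeroExt v) (zeroExt (rodFun α n)) / energy α (zeroExt (rodFun α n)) (zeroExt (rodFun α n))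

/-- The partial sums of the expansion of a function into Rodrigues functions. -/
def rodSum (α : ℝ) (v : ℝ → ℂ) (M : ℕ) : ℝ → ℂ :=
  ∑ n ∈ Finset.range (M + 1), rodCoeff α v n • rodFun α n

/-- The polynomial factor of the partial sums. -/
def rodSumPoly (α : ℝ) (v : ℝ → ℂ) (M : ℕ) : ℂ[X] :=
  ∑ n ∈ Finset.range (M + 1), C (rodCoeff α v n) * (rodrigues n α).map (algebraMap ℝ ℂ)

lemma natDegree_rodSumPoly_le (α : ℝ) (v : ℝ → ℂ) (M : ℕ) : (rodSumPoly α v M).natDegree ≤ M := by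
  refine natDegree_sum_le_of_forall_le _ _ fun n hn => ?_
  refine (natDegree_C_mul_le _ _).trans (natDegree_map_le.trans ((natDegree_rodrigues_le n α).trans ?_))
  simpa [Nat.lt_succ_iff] using hn

lemma eval_map_ofReal (p : ℝ[X]) (x : ℝ) :
    (p.map (algebraMap ℝ ℂ)).eval (x : ℂ) = ((p.eval x : ℝ) : ℂ) :=
  eval_map_algebraMap _ _ |>.trans (aeval_algebraMap_apply_eq_algebraMap_eval x _)

lemma rodSum_apply (α : ℝ) (v : ℝ → ℂ) (M : ℕ) (x : ℝ) :
    rodSum α v M x = (wt α x : ℂ) * (rodSumPoly α v M).eval (x : ℂ) := by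
  rw [rodSum, rodSumPoly, eval_finsetSum, Finset.mul_sum, Finset.sum_apply]
  refine Finset.sum_congr rfl fun n _ => ?_
  rw [Pi.smul_apply, smul_eq_mul, eval_mul, eval_C, eval_map_ofReal, rodFun]
  ring

section

variable {α : ℝ} {v : ℝ → ℂ}

lemma finiteEnergy_rodSum (hα : 0 < α) (v : ℝ → ℂ) (M : ℕ) : FiniteEnergy α (rodSum α v M) :=
  FiniteEnergy.sum _ fun n _ => (finiteEnergy_rodFun hα n).smul _

lemma FiniteEnergy.rodCoeff_eq (hα : 0 < α) (h : FiniteEnergy α v) (n : ℕ) :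
    rodCoeff α v n = inner ℂ (finiteEnergy_rodFun hα n).toLp h.toLp /
      (‖(finiteEnergy_rodFun hα n).toLp‖ : ℂ) ^ 2 := by
  rw [rodCoeff, ← inner_rodFun_eq_energy hα n h,
    ← inner_rodFun_eq_energy hα n (finiteEnergy_rodFun hα n), inner_self_eq_norm_sq_to_K]
  rfl

lemma toLp_rodSum (hα : 0 < α) (v : ℝ → ℂ) (M : ℕ) :
    (finiteEnergy_rodSum hα v M).toLp =
      ∑ n ∈ Finset.range (M + 1), rodCoeff α v n • (finiteEnergy_rodFun hα n).toLp := by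
  have := FiniteEnergy.toLp_sum (Finset.range (M + 1))
    (fun n => (finiteEnergy_rodFun hα n).smul (rodCoeff α v n))
  exact this.trans (Finset.sum_congr rfl fun n _ => FiniteEnergy.toLp_smul _ (finiteEnergy_rodFun hα n))

lemma FiniteEnergy.inner_rodFun_sub_rodSum (hα : 0 < α) (h : FiniteEnergy α v) {M n : ℕ} (hn : n ≤ M) :
    inner ℂ (finiteEnergy_rodFun hα n).toLp (h.sub (finiteEnergy_rodSum hα v M)).toLp = 0 := by
  rw [FiniteEnergy.toLp_sub h (finiteEnergy_rodSum hα v M), toLp_rodSum hα, inner_sub_right, inner_sum,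
    Finset.sum_eq_single_of_mem n (by simpa [Nat.lt_succ_iff] using hn), inner_smul_right,
    h.rodCoeff_eq hα, inner_self_eq_norm_sq_to_K]
  · have : (‖(finiteEnergy_rodFun hα n).toLp‖ : ℂ) ≠ 0 := by
      exact_mod_cast norm_ne_zero_iff.2 (toLp_rodFun_ne_zero hα n)
    have e : ((‖(finiteEnergy_rodFun hα n).toLp‖ : ℝ) : ℂ) = RCLike.ofReal ‖(finiteEnergy_rodFun hα n).toLp‖ := rfl
    rw [← e]
    field_simp
    simp
  · intro k _ hk
    rw [inner_smul_right, inner_toLp_rodFun hα hk.symm, mul_zero]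

end

/-- Polynomials of exact degree `n`, for each `n`, span. -/
lemma mem_span_of_natDegree_le {K : Type*} [Field K] {p : ℕ → K[X]} (hd : ∀ n, (p n).natDegree ≤ n)
    (hc : ∀ n, (p n).coeff n ≠ 0) (M : ℕ) {q : K[X]} (hq : q.natDegree ≤ M) :
    q ∈ Submodule.span K (p '' {n | n ≤ M}) := by
  induction M generalizing q with
  | zero =>
    have h1 := eq_C_of_natDegree_le_zero hq
    have h2 := eq_C_of_natDegree_le_zero (hd 0)
    have : q = (q.coeff 0 / (p 0).coeff 0) • p 0 := by
      rw [h2, h1, smul_C]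
      simp [hc 0]
    rw [this]
    exact Submodule.smul_mem _ _ (Submodule.subset_span ⟨0, le_refl 0, rfl⟩)
  | succ M ih =>
    set c := q.coeff (M + 1) / (p (M + 1)).coeff (M + 1) with hcd
    have h1 : (q - c • p (M + 1)).natDegree ≤ M := by
      rw [natDegree_le_iff_coeff_eq_zero]
      intro k hk
      rw [coeff_sub, coeff_smul, smul_eq_mul]
      rcases (Nat.succ_le_of_lt hk).eq_or_lt with h | h
      · rw [← h, hcd, Nat.succ_eq_add_one, div_mul_cancel₀ _ (hc _), sub_self]
      · rw [coeff_eq_zero_of_natDegree_lt (hq.trans_lt h),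
          coeff_eq_zero_of_natDegree_lt ((hd _).trans_lt h)]
        simp
    have h2 := Submodule.span_mono (image_mono fun n (hn : n ≤ M) => hn.trans M.le_succ) (ih h1)
    have h3 : c • p (M + 1) ∈ Submodule.span K (p '' {n | n ≤ M + 1}) :=
      Submodule.smul_mem _ _ (Submodule.subset_span ⟨M + 1, le_refl (M + 1), rfl⟩)
    have h4 := Submodule.add_mem _ h2 h3
    rwa [sub_add_cancel] at h4

lemma integrable_eval_mul {f : ℝ → ℂ} (hf : Integrable f) (h0 : ∀ x ∉ Ioo (-1 : ℝ) 1, f x = 0)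
    (q : ℂ[X]) : Integrable (fun x : ℝ => q.eval (x : ℂ) * f x) := by
  obtain ⟨C, hC⟩ := (isCompact_Icc (a := (-1 : ℝ)) (b := 1)).exists_bound_of_continuousOn
    (continuous_eval_ofReal q).continuousOn
  refine (hf.norm.const_mul C).mono'
    ((continuous_eval_ofReal q).aestronglyMeasurable.mul hf.aestronglyMeasurable)
    (Eventually.of_forall fun x => ?_)
  rw [norm_mul]
  by_cases hx : x ∈ Ioo (-1 : ℝ) 1
  · exact mul_le_mul_of_nonneg_right (hC x (Ioo_subset_Icc_self hx)) (norm_nonneg _)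
  · simp [h0 x hx]

section

variable {α : ℝ} {v : ℝ → ℂ}

/-- The remainder of the expansion is orthogonal to polynomials. -/
lemma FiniteEnergy.integral_eval_mul_sub_rodSum (hα : 0 < α) (h : FiniteEnergy α v) {M : ℕ} {q : ℂ[X]}
    (hq : q.natDegree ≤ M) :
    ∫ x : ℝ, q.eval (x : ℂ) * zeroExt (v - rodSum α v M) x = 0 := by
  choose r hr hc hI using fun n => exists_poly_rieszTest n hα
  have hE := h.sub (finiteEnergy_rodSum hα v M)
  set f := zeroExt (v - rodSum α v M) with hf
  have h0 : ∀ x ∉ Ioo (-1 : ℝ) 1, f x = 0 := fun x hx => zeroExt_of_notMem _ hx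
  have hmem := mem_span_of_natDegree_le hr (fun n => by
    rw [hc]
    exact div_ne_zero (wtConst_ne_zero (by positivity)) (by exact_mod_cast n.factorial_ne_zero)) M hq
  refine Submodule.span_induction (p := fun q _ => ∫ x : ℝ, q.eval (x : ℂ) * f x = 0)
    ?_ (by simp) ?_ ?_ hmem
  · rintro _ ⟨n, hn, rfl⟩
    have h1 := energy_rodFun_eq hα n hE.integrable h0 hE.memLp (hI n)
    rw [← inner_rodFun_eq_energy hα n hE, h.inner_rodFun_sub_rodSum hα hn] at h1
    exact (mul_eq_zero.1 h1.symm).resolve_left (rsign_ne_zero _)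
  · intro p q _ _ hp hq
    simp only [eval_add, add_mul]
    rw [integral_add (integrable_eval_mul hE.integrable h0 p) (integrable_eval_mul hE.integrable h0 q),
      hp, hq, add_zero]
  · intro c p _ hp
    simp only [eval_smul, smul_eq_mul, mul_assoc]
    rw [integral_const_mul, hp, mul_zero]

lemma memLp_jacobiMeasure_iff {a : ℝ} {k : ℝ → ℂ} :
    MemLp k 2 (jacobiMeasure a) ↔ AEStronglyMeasurable k (volume.restrict (Ioo (-1) 1)) ∧
      Integrable (fun x => (wt a x : ℂ) * ((‖k x‖ ^ 2 : ℝ) : ℂ)) (volume.restrict (Ioo (-1) 1)) := by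
  constructor
  · intro h
    refine ⟨h.aestronglyMeasurable.mono_ac (restrict_absolutelyContinuous_jacobiMeasure a), ?_⟩
    rw [← integrable_jacobiMeasure_iff]
    exact ((memLp_two_iff_integrable_sq_norm h.aestronglyMeasurable).1 h).ofReal
  · rintro ⟨h1, h2⟩
    have h3 := h1.mono_ac (jacobiMeasure_absolutelyContinuous a)
    rw [memLp_two_iff_integrable_sq_norm h3]
    rw [← integrable_jacobiMeasure_iff] at h2
    exact h2.re

lemma memLp_wt_neg_mul (hv : MemLp v 2 (jacobiMeasure (-α))) :
    MemLp (fun x => (wt (-α) x : ℂ) * v x) 2 (jacobiMeasure α) := by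
  rw [memLp_jacobiMeasure_iff] at hv ⊢
  refine ⟨(Complex.measurable_ofReal.comp (measurable_wt _)).aestronglyMeasurable.mul hv.1,
    hv.2.congr ?_⟩
  filter_upwards [ae_restrict_mem measurableSet_Ioo] with x hx
  have h1 : wt α x * wt (-α) x = 1 := by rw [← wt_add hx, add_neg_cancel, wt_zero]
  rw [norm_mul, Complex.norm_real, Real.norm_of_nonneg (wt_pos hx).le]
  norm_cast
  linear_combination (-wt (-α) x * ‖v x‖ ^ 2) * h1

/-- The remainders of the expansion are bounded in `L¹`. -/
lemma FiniteEnergy.exists_integral_norm_sub_rodSum_le (hα : 0 < α) (h : FiniteEnergy α v)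
    (hv : MemLp v 2 (jacobiMeasure (-α))) :
    ∃ K : ℝ, 0 ≤ K ∧ ∀ M, ∫ x, ‖zeroExt (v - rodSum α v M) x‖ ≤ K := by
  have : Fact (0 ≤ α) := ⟨hα.le⟩
  set U := fun x => (wt (-α) x : ℂ) * v x with hU
  have mU : MemLp U 2 (jacobiMeasure α) := memLp_wt_neg_mul hv
  have m1 : MemLp (fun _ : ℝ => (1 : ℝ)) 2 (jacobiMeasure α) := memLp_const _
  refine ⟨‖m1.toLp _‖ * ‖mU.toLp‖, by positivity, fun M => ?_⟩
  set σ := fun x : ℝ => (rodSumPoly α v M).eval (x : ℂ) with hσ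
  have mσ : MemLp σ 2 (jacobiMeasure α) :=
    memLp_jacobiMeasure_of_continuous hα.le (continuous_eval_ofReal _)
  have hUσ : ∀ x ∈ Ioo (-1 : ℝ) 1, (wt α x : ℂ) * (U x - σ x) = (v - rodSum α v M) x := by
    intro x hx
    have h1 : (wt α x : ℂ) * (wt (-α) x : ℂ) = 1 := by
      rw [← Complex.ofReal_mul, ← wt_add hx, add_neg_cancel, wt_zero, Complex.ofReal_one]
    rw [Pi.sub_apply, rodSum_apply, hU, hσ]
    linear_combination v x * h1
  have horth : inner ℂ mσ.toLp (mU.sub mσ).toLp = 0 := by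
    rw [L2.inner_def]
    have e : ∫ x, inner ℂ ((mσ.toLp : ℝ → ℂ) x) (((mU.sub mσ).toLp : ℝ → ℂ) x) ∂(jacobiMeasure α) =
        ∫ x, ((rodSumPoly α v M).map (starRingEnd ℂ)).eval (x : ℂ) * (U x - σ x) ∂(jacobiMeasure α) := by
      refine integral_congr_ae ?_
      filter_upwards [mσ.coeFn_toLp, (mU.sub mσ).coeFn_toLp] with x h1 h2
      rw [h1, h2, RCLike.inner_apply, Pi.sub_apply, mul_comm]
      congr 1
      rw [hσ]
      simp only [eval_eq_sum_range, natDegree_map, coeff_map, map_sum, map_mul, map_pow,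
        Complex.conj_ofReal]
    rw [e, integral_jacobiMeasure, ← h.integral_eval_mul_sub_rodSum hα (M := M)
      (q := (rodSumPoly α v M).map (starRingEnd ℂ))
      (natDegree_map_le.trans (natDegree_rodSumPoly_le α v M))]
    simp only [mul_comm (eval _ _)]
    rw [integral_zeroExt_mul, intervalIntegral.integral_of_le (by norm_num),
      intervalIntegral.integral_of_le (by norm_num), integral_Ioc_eq_integral_Ioo,
      integral_Ioc_eq_integral_Ioo]
    refine setIntegral_congr_fun measurableSet_Ioo fun x hx => ?_
    simp only [← hUσ x hx]
    ring
  have hle : ‖(mU.sub mσ).toLp‖ ≤ ‖mU.toLp‖ := by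
    have e : mU.toLp = mσ.toLp + (mU.sub mσ).toLp := by
      rw [MemLp.toLp_sub mU mσ, add_sub_cancel]
    have h2 := norm_add_sq_eq_norm_sq_add_norm_sq_of_inner_eq_zero _ _ horth
    rw [← e] at h2
    nlinarith [norm_nonneg mσ.toLp, norm_nonneg mU.toLp, norm_nonneg (mU.sub mσ).toLp]
  have hn : MemLp (fun x => ‖U x - σ x‖) 2 (jacobiMeasure α) := (mU.sub mσ).norm
  have e1 : ∫ x, ‖zeroExt (v - rodSum α v M) x‖ = inner ℝ (m1.toLp _) (hn.toLp _) := by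
    rw [L2.inner_def]
    have e2 : ∫ x, inner ℝ ((m1.toLp _ : ℝ → ℝ) x) ((hn.toLp _ : ℝ → ℝ) x) ∂(jacobiMeasure α) =
        ∫ x, ‖U x - σ x‖ ∂(jacobiMeasure α) := by
      refine integral_congr_ae ?_
      filter_upwards [m1.coeFn_toLp, hn.coeFn_toLp] with x h1 h2
      rw [h1, h2]
      simp
    rw [e2, jacobiMeasure_eq, integral_withDensity_eq_integral_toReal_smul
      (measurable_wt α).ennreal_ofReal (by simp)]
    have e3 : (fun x => ‖zeroExt (v - rodSum α v M) x‖) =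
        (Ioo (-1 : ℝ) 1).indicator fun x => ‖(v - rodSum α v M) x‖ := by
      ext x
      by_cases hx : x ∈ Ioo (-1 : ℝ) 1
      · rw [zeroExt_of_mem _ hx, indicator_of_mem hx]
      · rw [zeroExt_of_notMem _ hx, indicator_of_notMem hx, norm_zero]
    rw [e3, integral_indicator measurableSet_Ioo]
    refine setIntegral_congr_fun measurableSet_Ioo fun x hx => ?_
    simp only [ENNReal.toReal_ofReal (wt_pos hx).le, ← hUσ x hx, norm_mul, Complex.norm_real,
      Real.norm_of_nonneg (wt_pos hx).le, smul_eq_mul]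
  have e4 : ‖hn.toLp _‖ = ‖(mU.sub mσ).toLp‖ := by
    rw [Lp.norm_toLp, Lp.norm_toLp]
    congr 1
    exact eLpNorm_norm (U - σ)
  rw [e1]
  calc inner ℝ (m1.toLp _) (hn.toLp _) ≤ ‖m1.toLp _‖ * ‖hn.toLp _‖ := real_inner_le_norm _ _
    _ ≤ _ := by rw [e4]; gcongr

/-- The Fourier transforms of the remainders tend to zero. -/
lemma FiniteEnergy.tendsto_fourier_sub_rodSum (hα : 0 < α) (h : FiniteEnergy α v)
    (hv : MemLp v 2 (jacobiMeasure (-α))) (ξ : ℝ) :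
    Tendsto (fun M => 𝓕 (zeroExt (v - rodSum α v M)) ξ) atTop (𝓝 0) := by
  obtain ⟨K, hK, hbd⟩ := h.exists_integral_norm_sub_rodSum_le hα hv
  set t := 2 * Real.pi * |ξ| with ht
  have ht0 : 0 ≤ t := by positivity
  have lim : Tendsto (fun M : ℕ => t ^ (M + 1) / (M + 1).factorial * 2 * K) atTop (𝓝 0) := by
    have := ((FloorSemiring.tendsto_pow_div_factorial_atTop t).comp (tendsto_add_atTop_nat 1)).mul_const 2
      |>.mul_const K
    simpa using this
  refine squeeze_zero_norm' ?_ lim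
  obtain ⟨M₀, hM₀⟩ := exists_nat_ge (2 * t)
  filter_upwards [eventually_ge_atTop M₀] with M hM
  have hE := h.sub (finiteEnergy_rodSum hα v M)
  set f := zeroExt (v - rodSum α v M) with hf
  have h0 : ∀ x ∉ Ioo (-1 : ℝ) 1, f x = 0 := fun x hx => zeroExt_of_notMem _ hx
  set z : ℂ := -2 * Real.pi * Complex.I * ξ with hz
  have hzn : ‖z‖ = t := by
    rw [hz, ht]
    simp [abs_of_pos Real.pi_pos]
  set T : ℂ[X] := ∑ j ∈ Finset.range (M + 1), C (z ^ j / j.factorial) * X ^ j with hT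
  have hTd : T.natDegree ≤ M := by
    refine natDegree_sum_le_of_forall_le _ _ fun j hj => (natDegree_C_mul_X_pow_le _ _).trans ?_
    simpa [Nat.lt_succ_iff] using hj
  have hTe : ∀ x : ℝ, T.eval (x : ℂ) = ∑ j ∈ Finset.range (M + 1), (z * x) ^ j / j.factorial := by
    intro x
    rw [hT, eval_finsetSum]
    refine Finset.sum_congr rfl fun j _ => ?_
    rw [eval_mul, eval_C, eval_pow, eval_X, mul_pow]
    ring
  have hint := h.integral_eval_mul_sub_rodSum hα hTd
  rw [← hf] at hint
  have iexp : Integrable (fun x : ℝ => Complex.exp (z * x) * f x) := by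
    refine hE.integrable.norm.mono' ((by fun_prop : Continuous fun x : ℝ =>
      Complex.exp (z * x)).aestronglyMeasurable.mul hE.integrable.aestronglyMeasurable)
      (Eventually.of_forall fun x => ?_)
    rw [norm_mul, Complex.norm_exp, show (z * (x : ℂ)).re = 0 by simp [hz], Real.exp_zero, one_mul]
  have e1 : 𝓕 f ξ = ∫ x : ℝ, (Complex.exp (z * x) - T.eval (x : ℂ)) * f x := by
    simp only [sub_mul]
    rw [integral_sub iexp (integrable_eval_mul hE.integrable h0 T), hint, sub_zero,
      Real.fourier_real_eq_integral_exp_smul]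
    congr 1; funext x
    rw [smul_eq_mul, hz]
    congr 2
    push_cast; ring
  rw [e1]
  refine (norm_integral_le_of_norm_le (hE.integrable.norm.const_mul (t ^ (M + 1) / (M + 1).factorial * 2))
    (Eventually.of_forall fun x => ?_)).trans ?_
  · rw [norm_mul]
    by_cases hx : x ∈ Ioo (-1 : ℝ) 1
    · refine mul_le_mul_of_nonneg_right ?_ (norm_nonneg _)
      have hx1 : |x| ≤ 1 := abs_le.2 ⟨hx.1.le, hx.2.le⟩
      have hn : ‖z * x‖ ≤ t := by
        rw [norm_mul, hzn, Complex.norm_real, Real.norm_eq_abs]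
        exact mul_le_of_le_one_right ht0 hx1
      rw [hTe]
      refine (Complex.exp_bound' ?_).trans (by gcongr)
      rw [div_le_iff₀ (by positivity)]
      have : (M₀ : ℝ) ≤ M := by exact_mod_cast hM
      push_cast
      linarith
    · rw [h0 x hx, zeroExt_of_notMem _ hx]; simp
  · rw [integral_const_mul]
    exact mul_le_mul_of_nonneg_left (hbd M) (by positivity)

end

end RieszJacobi

end

noncomputable section

namespace RieszJacobi

open Filter Topology

/-! ### The error of the partial sums -/

section

variable {α : ℝ} {v : ℝ → ℂ}

lemma norm_sum_smul_sq {E ι : Type*} [NormedAddCommGroup E] [InnerProductSpace ℂ E] {b : ι → E}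
    (ho : ∀ i j, i ≠ j → inner ℂ (b i) (b j) = 0) (c : ι → ℂ) (s : Finset ι) :
    ‖∑ i ∈ s, c i • b i‖ ^ 2 = ∑ i ∈ s, ‖c i‖ ^ 2 * ‖b i‖ ^ 2 := by
  classical
  induction s using Finset.induction_on with
  | empty => simp
  | insert i s hi ih =>
    have h : inner ℂ (c i • b i) (∑ j ∈ s, c j • b j) = 0 := by
      rw [inner_sum]
      refine Finset.sum_eq_zero fun j hj => ?_
      rw [inner_smul_left, inner_smul_right, ho i j (fun e => hi (e ▸ hj))]
      simp
    have h2 := norm_add_sq_eq_norm_sq_add_norm_sq_of_inner_eq_zero _ _ h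
    rw [Finset.sum_insert hi, Finset.sum_insert hi, ← ih, pow_two, h2, norm_smul]
    ring

lemma FiniteEnergy.norm_rodSum_sub_sq (hα : 0 < α) (h : FiniteEnergy α v) {N M : ℕ} (hNM : N ≤ M) :
    ‖((finiteEnergy_rodSum hα v M).sub (finiteEnergy_rodSum hα v N)).toLp‖ ^ 2 =
      ∑ n ∈ Finset.Ico (N + 1) (M + 1),
        ‖energy α (zeroExt v) (zeroExt (rodFun α n))‖ ^ 2 / ‖(finiteEnergy_rodFun hα n).toLp‖ ^ 2 := by
  rw [FiniteEnergy.toLp_sub (finiteEnergy_rodSum hα v M) (finiteEnergy_rodSum hα v N),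
    toLp_rodSum hα, toLp_rodSum hα, ← Finset.sum_Ico_eq_sub _ (by omega),
    norm_sum_smul_sq fun i j hij => inner_toLp_rodFun hα hij]
  refine Finset.sum_congr rfl fun n _ => ?_
  have h0 : ‖(finiteEnergy_rodFun hα n).toLp‖ ≠ 0 := norm_ne_zero_iff.2 (toLp_rodFun_ne_zero hα n)
  rw [h.rodCoeff_eq hα, inner_rodFun_eq_energy hα n h, norm_div, norm_pow, Complex.norm_real, norm_norm]
  field_simp

/-- Fatou's lemma for the remainders of the expansion. -/
lemma FiniteEnergy.eLpNorm_sub_rodSum_le (hα : 0 < α) (h : FiniteEnergy α v)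
    (hv : MemLp v 2 (jacobiMeasure (-α))) {N : ℕ} {B : ℝ}
    (hB : ∀ M, N ≤ M → ∑ n ∈ Finset.Ico (N + 1) (M + 1),
      ‖energy α (zeroExt v) (zeroExt (rodFun α n))‖ ^ 2 / ‖(finiteEnergy_rodFun hα n).toLp‖ ^ 2 ≤ B ^ 2)
    (hB0 : 0 ≤ B) :
    eLpNorm (fun ξ => symb α ξ * 𝓕 (zeroExt (v - rodSum α v N)) ξ) 2 ≤ ENNReal.ofReal B := by
  have hd := fun M => (finiteEnergy_rodSum hα v M).sub (finiteEnergy_rodSum hα v N)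
  have hr := fun M => h.sub (finiteEnergy_rodSum hα v M)
  have lim : ∀ ξ, Tendsto (fun M => symb α ξ * 𝓕 (zeroExt (rodSum α v M - rodSum α v N)) ξ) atTop
      (𝓝 (symb α ξ * 𝓕 (zeroExt (v - rodSum α v N)) ξ)) := by
    intro ξ
    refine Tendsto.const_mul _ ?_
    have e : ∀ M, 𝓕 (zeroExt (rodSum α v M - rodSum α v N)) ξ =
        𝓕 (zeroExt (v - rodSum α v N)) ξ - 𝓕 (zeroExt (v - rodSum α v M)) ξ := by
      intro M
      rw [eq_sub_iff_add_eq, ← fourier_fun_add (hd M).integrable (hr M).integrable, ← zeroExt_add,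
        add_comm, sub_add_sub_cancel]
    simp only [e]
    simpa using tendsto_const_nhds.sub (h.tendsto_fourier_sub_rodSum hα hv ξ)
  refine (Lp.eLpNorm_lim_le_liminf_eLpNorm (fun M => (hd M).memLp.aestronglyMeasurable) _
    (Eventually.of_forall lim)).trans ?_
  refine liminf_le_of_frequently_le' (Eventually.frequently ?_)
  filter_upwards [eventually_ge_atTop N] with M hM
  rw [← (hd M).enorm_toLp, ← ofReal_norm]
  refine ENNReal.ofReal_le_ofReal (abs_le_of_sq_le_sq' ?_ hB0).2
  rw [h.norm_rodSum_sub_sq hα hM]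
  exact hB M hM

/-- Comparison of the two normalisations of the Rodrigues functions. -/
lemma exists_norm_rodLp_sq_mul_rpow_le (hα : 0 < α) {β : ℝ} (hβ : 0 ≤ β) (m : ℕ) :
    ∃ C : ℝ, 0 < C ∧ ∀ N n k : ℕ, 1 ≤ N → N ≤ n → n ≤ k + m → β + k = α + n →
      ‖rodLp hβ k‖ ^ 2 ≤ (C * (N : ℝ) ^ (-β)) ^ 2 * ‖(finiteEnergy_rodFun hα n).toLp‖ ^ 2 := by
  obtain ⟨K, hK, hG⟩ := factorial_mul_rpow_le_Gamma (a := 2 * β) (by positivity)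
  have hc : 0 < ‖wtConst α‖ := norm_pos_iff.2 (wtConst_ne_zero hα)
  have hΓα : 0 < Real.Gamma (2 * α + 1) := Real.Gamma_pos_of_pos (by positivity)
  set A := K * (Real.Gamma (2 * α + 1) / ‖wtConst α‖) * ((m : ℝ) + 1) ^ (2 * β) with hA
  have hA0 : 0 < A := by positivity
  refine ⟨√A, Real.sqrt_pos.2 hA0, fun N n k hN hNn hnk hγ => ?_⟩
  have hN0 : (0 : ℝ) < N := by exact_mod_cast hN
  rw [norm_rodLp_sq, norm_toLp_rodFun_sq hα, norm_wtConst_add hα, hγ, mul_pow, Real.sq_sqrt hA0.le,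
    ← Real.rpow_natCast ((N : ℝ) ^ (-β)), ← Real.rpow_mul hN0.le]
  have hW : 0 < wtInt (α + n) := wtInt_pos (by positivity)
  have hΓn : 0 < Real.Gamma (2 * (α + n) + 1) := Real.Gamma_pos_of_pos (by positivity)
  have e : 2 * (α + n) - k + 1 = k + 1 + 2 * β := by linarith
  have hΓk : 0 < Real.Gamma (k + 1 + 2 * β) := Real.Gamma_pos_of_pos (by positivity)
  have hNk : (N : ℝ) ^ (2 * β) ≤ ((m : ℝ) + 1) ^ (2 * β) * ((k : ℝ) + 1) ^ (2 * β) := by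
    rw [← Real.mul_rpow (by positivity) (by positivity)]
    refine Real.rpow_le_rpow hN0.le ?_ (by positivity)
    have h1 : (N : ℝ) ≤ k + m := by exact_mod_cast hNn.trans hnk
    have h2 : (0 : ℝ) ≤ m := m.cast_nonneg
    have h3 : (0 : ℝ) ≤ k := k.cast_nonneg
    nlinarith
  have key : (k.factorial : ℝ) * (N : ℝ) ^ (2 * β) ≤
      ((m : ℝ) + 1) ^ (2 * β) * (K * Real.Gamma (k + 1 + 2 * β)) := by
    calc (k.factorial : ℝ) * (N : ℝ) ^ (2 * β)
        ≤ k.factorial * (((m : ℝ) + 1) ^ (2 * β) * ((k : ℝ) + 1) ^ (2 * β)) := by gcongr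
      _ = ((m : ℝ) + 1) ^ (2 * β) * (k.factorial * ((k : ℝ) + 1) ^ (2 * β)) := by ring
      _ ≤ _ := mul_le_mul_of_nonneg_left (hG k) (by positivity)
  have hNp : 0 < (N : ℝ) ^ (2 * β) := by positivity
  have e2 : (N : ℝ) ^ (-β * ((2 : ℕ) : ℝ)) = ((N : ℝ) ^ (2 * β))⁻¹ := by
    rw [← Real.rpow_neg hN0.le]; congr 1; push_cast; ring
  rw [e, e2, hA]
  have e3 : K * (Real.Gamma (2 * α + 1) / ‖wtConst α‖) * ((m : ℝ) + 1) ^ (2 * β) * ((N : ℝ) ^ (2 * β))⁻¹ *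
      (Real.Gamma (2 * (α + n) + 1) / Real.Gamma (2 * α + 1) * ‖wtConst α‖ * wtInt (α + n)) =
      (((m : ℝ) + 1) ^ (2 * β) * (K * Real.Gamma (k + 1 + 2 * β))) * (((N : ℝ) ^ (2 * β))⁻¹ *
        (Real.Gamma (2 * (α + n) + 1) / Real.Gamma (k + 1 + 2 * β)) * wtInt (α + n)) := by
    field_simp
  have e4 : k.factorial * (Real.Gamma (2 * (α + n) + 1) / Real.Gamma (k + 1 + 2 * β)) * wtInt (α + n) =
      (k.factorial * (N : ℝ) ^ (2 * β)) * (((N : ℝ) ^ (2 * β))⁻¹ *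
        (Real.Gamma (2 * (α + n) + 1) / Real.Gamma (k + 1 + 2 * β)) * wtInt (α + n)) := by
    field_simp
  rw [e3, e4]
  gcongr

end

/-- The error estimate for the partial sums of the expansion into Rodrigues functions. -/
theorem exists_eLpNorm_sub_rodSum_le {α : ℝ} (hα : 0 < α) {ν m : ℕ} (hν : (ν : ℝ) ≤ α)
    (hβ : 0 ≤ α - 2 * ν + m) :
    ∃ C : ℝ, 0 < C ∧ ∀ N : ℕ, 1 ≤ N → m ≤ N + 1 + 2 * ν → ∀ v : ℝ → ℂ, FiniteEnergy α v →
      MemLp v 2 (jacobiMeasure (-α)) → ∀ g : ℝ → ℂ, IsRieszDeriv Lam (2 * α - 2 * ν) m v g →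
        eLpNorm (fun ξ => symb α ξ * 𝓕 (zeroExt (v - rodSum α v N)) ξ) 2 ≤
          ENNReal.ofReal (C * (N : ℝ) ^ (2 * (ν : ℝ) - α - m)) *
            eLpNorm g 2 (jacobiMeasure (α - 2 * ν + m)) := by
  obtain ⟨C, hC, hCb⟩ := exists_norm_rodLp_sq_mul_rpow_le hα hβ m
  refine ⟨C, hC, fun N hN hmN v h hv g hg => ?_⟩
  have hN0 : (0 : ℝ) < N := by exact_mod_cast hN
  have hpos : 0 < C * (N : ℝ) ^ (2 * (ν : ℝ) - α - m) := by positivity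
  by_cases hg2 : MemLp g 2 (jacobiMeasure (α - 2 * ν + m))
  swap
  · have hm : AEStronglyMeasurable g (jacobiMeasure (α - 2 * ν + m)) := by
      have : AEStronglyMeasurable g (volume.restrict (Ioo (-1) 1)) := hg.1.aestronglyMeasurable
      exact this.mono_ac (jacobiMeasure_absolutelyContinuous _)
    have : eLpNorm g 2 (jacobiMeasure (α - 2 * ν + m)) = ⊤ := by
      by_contra hne
      exact hg2 ⟨hm, lt_top_iff_ne_top.2 hne⟩
    rw [this, ENNReal.mul_top (ENNReal.ofReal_pos.2 hpos).ne']
    exact le_top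
  have e : eLpNorm g 2 (jacobiMeasure (α - 2 * ν + m)) = ENNReal.ofReal ‖hg2.toLp g‖ := by
    rw [ofReal_norm, Lp.enorm_toLp]
  rw [e, ← ENNReal.ofReal_mul hpos.le]
  refine h.eLpNorm_sub_rodSum_le hα hv (fun M hM => ?_) (by positivity)
  set D := C * (N : ℝ) ^ (2 * (ν : ℝ) - α - m) with hD
  have hterm : ∀ n ∈ Finset.Ico (N + 1) (M + 1), ‖energy α (zeroExt v) (zeroExt (rodFun α n))‖ ^ 2 /
      ‖(finiteEnergy_rodFun hα n).toLp‖ ^ 2 ≤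
      D ^ 2 * (‖inner ℂ (rodLp hβ (n + 2 * ν - m)) (hg2.toLp g)‖ ^ 2 / ‖rodLp hβ (n + 2 * ν - m)‖ ^ 2) := by
    intro n hn
    have hn' := (Finset.mem_Ico.1 hn).1
    obtain ⟨k, hk⟩ : ∃ k, n + 2 * ν = k + m := ⟨n + 2 * ν - m, by omega⟩
    rw [show n + 2 * ν - m = k by omega]
    have hkr : (n : ℝ) + 2 * ν = k + m := by exact_mod_cast hk
    have h1 := norm_integral_mul_rodFun hα hν hβ hk h.integrable h.memLp hg hg2
    rw [inner_rodLp hβ k hg2, h1]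
    have h2 := hCb N n k hN (by omega) (by omega) (by linarith)
    rw [show -(α - 2 * ν + m) = 2 * (ν : ℝ) - α - m by ring, ← hD] at h2
    have p1 : 0 < ‖rodLp hβ k‖ := norm_pos_iff.2 (rodLp_ne_zero hβ k)
    have p2 : 0 < ‖(finiteEnergy_rodFun hα n).toLp‖ := norm_pos_iff.2 (toLp_rodFun_ne_zero hα n)
    rw [← mul_div_assoc, div_le_div_iff₀ (by positivity) (by positivity)]
    calc _ ≤ ‖energy α (zeroExt v) (zeroExt (rodFun α n))‖ ^ 2 *
          (D ^ 2 * ‖(finiteEnergy_rodFun hα n).toLp‖ ^ 2) := by gcongr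
      _ = _ := by ring
  refine (Finset.sum_le_sum hterm).trans ?_
  rw [← Finset.mul_sum, mul_pow D]
  refine mul_le_mul_of_nonneg_left ?_ (sq_nonneg D)
  have hinj : InjOn (fun n => n + 2 * ν - m) (Finset.Ico (N + 1) (M + 1)) := by
    intro a ha b hb hab
    have := (Finset.mem_Ico.1 ha).1
    have := (Finset.mem_Ico.1 hb).1
    simp only at hab
    omega
  rw [← Finset.sum_image (f := fun k => ‖inner ℂ (rodLp hβ k) (hg2.toLp g)‖ ^ 2 / ‖rodLp hβ k‖ ^ 2) hinj]
  exact sum_inner_sq_div_le (rodLp_ne_zero hβ) (fun i j => inner_rodLp_of_ne hβ) _ _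

end RieszJacobi

end

noncomputable section

namespace RieszJacobi

open Filter Topology Polynomial

/-! ### The space spanned by the generalized Jacobi functions -/

/-- The Jacobi polynomials with equal parameters, as polynomials. -/
def jacobiPoly (n : ℕ) (α : ℝ) : ℝ[X] :=
  ∑ s ∈ Finset.range (n + 1),
    C (Real.Gamma (n + α + 1) / ((n - s).factorial * Real.Gamma (α + s + 1)) *
      (Real.Gamma (n + α + 1) / (s.factorial * Real.Gamma (n + α - s + 1)))) *
      ((C (1 / 2) * X - C (1 / 2)) ^ s * (C (1 / 2) * X + C (1 / 2)) ^ (n - s))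

lemma eval_jacobiPoly (n : ℕ) (α x : ℝ) : (jacobiPoly n α).eval x = jacobiP n α α x := by
  rw [jacobiPoly, jacobiP, eval_finsetSum]
  refine Finset.sum_congr rfl fun s _ => ?_
  simp only [eval_mul, eval_pow, eval_add, eval_sub, eval_C, eval_X]
  rw [show (x - 1) / 2 = 1 / 2 * x - 1 / 2 by ring, show (x + 1) / 2 = 1 / 2 * x + 1 / 2 by ring]
  ring

lemma natDegree_half_mul_X_sub_le : (C (1 / 2 : ℝ) * X - C (1 / 2)).natDegree ≤ 1 := by
  rw [sub_eq_add_neg, ← C_neg]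
  exact natDegree_linear_le

lemma natDegree_half_mul_X_add_le : (C (1 / 2 : ℝ) * X + C (1 / 2)).natDegree ≤ 1 :=
  natDegree_linear_le

lemma natDegree_jacobiPoly_le (n : ℕ) (α : ℝ) : (jacobiPoly n α).natDegree ≤ n := by
  refine natDegree_sum_le_of_forall_le _ _ fun s hs => (natDegree_C_mul_le _ _).trans ?_
  have hs' : s ≤ n := by simpa [Nat.lt_succ_iff] using hs
  refine (natDegree_mul_le_of_le (natDegree_pow_le_of_le s natDegree_half_mul_X_sub_le)
    (natDegree_pow_le_of_le (n - s) natDegree_half_mul_X_add_le)).trans ?_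
  omega

lemma coeff_jacobiPoly_ne_zero (n : ℕ) {α : ℝ} (hα : 0 < α) : (jacobiPoly n α).coeff n ≠ 0 := by
  rw [jacobiPoly, finsetSum_coeff]
  refine (Finset.sum_pos (fun s hs => ?_) ⟨0, by simp⟩).ne'
  have hs' : s ≤ n := by simpa [Nat.lt_succ_iff] using hs
  have hs'' : (s : ℝ) ≤ n := by exact_mod_cast hs'
  have h1 : ((C (1 / 2 : ℝ) * X - C (1 / 2)) ^ s).coeff s = (1 / 2) ^ s := by
    have := coeff_pow_of_natDegree_le (m := s) natDegree_half_mul_X_sub_le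
    rw [mul_one] at this
    rw [this]
    simp
  have h2 : ((C (1 / 2 : ℝ) * X + C (1 / 2)) ^ (n - s)).coeff (n - s) = (1 / 2) ^ (n - s) := by
    have := coeff_pow_of_natDegree_le (m := n - s) natDegree_half_mul_X_add_le
    rw [mul_one] at this
    rw [this]
    simp
  have h3 := coeff_mul_add_eq_of_natDegree_le (df := s) (dg := n - s)
    ((natDegree_pow_le_of_le s natDegree_half_mul_X_sub_le).trans (mul_one s).le)
    ((natDegree_pow_le_of_le (n - s) natDegree_half_mul_X_add_le).trans (mul_one _).le)
  rw [Nat.add_sub_cancel' hs', h1, h2] at h3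
  rw [coeff_C_mul, h3]
  have g1 : 0 < Real.Gamma (n + α + 1) := Real.Gamma_pos_of_pos (by positivity)
  have g2 : 0 < Real.Gamma (α + s + 1) := Real.Gamma_pos_of_pos (by positivity)
  have g3 : 0 < Real.Gamma (n + α - s + 1) := Real.Gamma_pos_of_pos (by linarith)
  positivity

/-- Multiplication of a polynomial by the weight, extended by zero. -/
def wtPoly (α : ℝ) : ℂ[X] →ₗ[ℂ] (ℝ → ℂ) where
  toFun q := zeroExt fun x => (wt α x : ℂ) * q.eval (x : ℂ)
  map_add' p q := by
    rw [show (zeroExt fun x => (wt α x : ℂ) * p.eval (x : ℂ)) + zeroExt (fun x => (wt α x : ℂ) * q.eval (x : ℂ)) =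
      zeroExt ((fun x => (wt α x : ℂ) * p.eval (x : ℂ)) + fun x => (wt α x : ℂ) * q.eval (x : ℂ)) from
      (zeroExt_add _ _).symm]
    refine congrArg zeroExt (funext fun x => ?_)
    simp [mul_add]
  map_smul' c p := by
    rw [RingHom.id_apply, show c • zeroExt (fun x => (wt α x : ℂ) * p.eval (x : ℂ)) =
      zeroExt (c • fun x => (wt α x : ℂ) * p.eval (x : ℂ)) from (zeroExt_smul _ _).symm]
    refine congrArg zeroExt (funext fun x => ?_)
    simp
    ring

lemma wtPoly_rodrigues (α : ℝ) (n : ℕ) :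
    wtPoly α ((rodrigues n α).map (algebraMap ℝ ℂ)) = zeroExt (rodFun α n) := by
  refine congrArg zeroExt (funext fun x => ?_)
  rw [eval_map_ofReal, rodFun]

lemma wtPoly_jacobiPoly (α : ℝ) (n : ℕ) :
    wtPoly α ((jacobiPoly n α).map (algebraMap ℝ ℂ)) = jacobiFun α n := by
  refine congrArg zeroExt (funext fun x => ?_)
  rw [eval_map_ofReal, eval_jacobiPoly, wt, Complex.ofReal_mul]

lemma wtPoly_mem_span {α : ℝ} {p : ℕ → ℝ[X]} (hd : ∀ n, (p n).natDegree ≤ n)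
    (hc : ∀ n, (p n).coeff n ≠ 0) (N : ℕ) {q : ℂ[X]} (hq : q.natDegree ≤ N) :
    wtPoly α q ∈ Submodule.span ℂ
      ((fun n => wtPoly α ((p n).map (algebraMap ℝ ℂ))) '' {n | n ≤ N}) := by
  have h := mem_span_of_natDegree_le (p := fun n => (p n).map (algebraMap ℝ ℂ))
    (fun n => natDegree_map_le.trans (hd n)) (fun n => by
      rw [coeff_map]
      simpa using hc n) N hq
  have h2 := Submodule.mem_map_of_mem (f := wtPoly α) h
  rwa [Submodule.map_span, image_image] at h2

lemma mem_jacobiSpace_iff {α : ℝ} (hα : 0 < α) {N : ℕ} {w : ℝ → ℂ} :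
    w ∈ jacobiSpace α N ↔ ∃ q : ℂ[X], q.natDegree ≤ N ∧ wtPoly α q = w := by
  constructor
  · intro h
    refine Submodule.span_induction (p := fun w _ => ∃ q : ℂ[X], q.natDegree ≤ N ∧ wtPoly α q = w)
      ?_ ⟨0, by simp, map_zero _⟩ ?_ ?_ h
    · rintro _ ⟨n, hn, rfl⟩
      exact ⟨_, natDegree_map_le.trans ((natDegree_jacobiPoly_le n α).trans hn), wtPoly_jacobiPoly α n⟩
    · rintro _ _ _ _ ⟨p, hp, rfl⟩ ⟨q, hq, rfl⟩
      exact ⟨p + q, natDegree_add_le_of_degree_le hp hq, map_add _ _ _⟩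
    · rintro c _ _ ⟨p, hp, rfl⟩
      exact ⟨c • p, (natDegree_smul_le _ _).trans hp, map_smul _ _ _⟩
  · rintro ⟨q, hq, rfl⟩
    have h := wtPoly_mem_span (α := α) (fun n => natDegree_jacobiPoly_le n α)
      (fun n => coeff_jacobiPoly_ne_zero n hα) N hq
    simp only [wtPoly_jacobiPoly] at h
    exact h

lemma coeff_rodrigues_ne_zero (n : ℕ) {β : ℝ} (hβ : 0 ≤ β) : (rodrigues n β).coeff n ≠ 0 := by
  rw [coeff_rodrigues n hβ]
  have h2 : 0 < Real.Gamma (2 * (β + n) + 1) := Real.Gamma_pos_of_pos (by positivity)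
  have h3 : 0 < Real.Gamma (2 * (β + n) - n + 1) := Real.Gamma_pos_of_pos (by
    have : (0 : ℝ) ≤ n := n.cast_nonneg
    linarith)
  refine mul_ne_zero (pow_ne_zero _ (by norm_num)) (by positivity)

lemma zeroExt_rodSum (α : ℝ) (v : ℝ → ℂ) (N : ℕ) :
    zeroExt (rodSum α v N) = wtPoly α (rodSumPoly α v N) :=
  congrArg zeroExt (funext fun x => rodSum_apply α v N x)

lemma zeroExt_rodSum_mem {α : ℝ} (hα : 0 < α) (v : ℝ → ℂ) (N : ℕ) :
    zeroExt (rodSum α v N) ∈ jacobiSpace α N :=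
  (mem_jacobiSpace_iff hα).2 ⟨_, natDegree_rodSumPoly_le α v N, (zeroExt_rodSum α v N).symm⟩

section

variable {α : ℝ} {N : ℕ} {w : ℝ → ℂ}

lemma zeroExt_of_mem_jacobiSpace (hα : 0 < α) (hw : w ∈ jacobiSpace α N) : zeroExt w = w := by
  obtain ⟨q, -, rfl⟩ := (mem_jacobiSpace_iff hα).1 hw
  exact zeroExt_zeroExt _

lemma mem_span_rodFun (hα : 0 < α) (hw : w ∈ jacobiSpace α N) :
    w ∈ Submodule.span ℂ ((fun n => zeroExt (rodFun α n)) '' {n | n ≤ N}) := by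
  obtain ⟨q, hq, rfl⟩ := (mem_jacobiSpace_iff hα).1 hw
  have h := wtPoly_mem_span (α := α) (fun n => natDegree_rodrigues_le n α)
    (fun n => coeff_rodrigues_ne_zero n hα.le) N hq
  simpa only [wtPoly_rodrigues] using h

lemma FiniteEnergy.zeroExt_congr {v w : ℝ → ℂ} (hv : FiniteEnergy α v) (h : zeroExt v = zeroExt w) :
    FiniteEnergy α w := by
  obtain ⟨h1, h2⟩ := hv
  rw [h] at h1 h2
  exact ⟨h1, h2⟩

lemma FiniteEnergy.extendByZero {v : ℝ → ℂ} (hv : FiniteEnergy α v) :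
    FiniteEnergy α (zeroExt v) :=
  hv.zeroExt_congr (zeroExt_zeroExt v).symm

lemma finiteEnergy_of_mem_jacobiSpace (hα : 0 < α) (hw : w ∈ jacobiSpace α N) : FiniteEnergy α w := by
  refine Submodule.span_induction (p := fun w _ => FiniteEnergy α w) ?_ (FiniteEnergy.zero α)
    (fun _ _ _ _ h1 h2 => h1.add h2) (fun c _ _ h => h.smul c) (mem_span_rodFun hα hw)
  rintro _ ⟨n, -, rfl⟩
  exact (finiteEnergy_rodFun hα n).extendByZero

lemma exists_norm_symb_mul_fourier_le (hα : 0 < α) (hw : w ∈ jacobiSpace α N) :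
    ∃ C : ℝ, 0 ≤ C ∧ ∀ ξ, ‖symb α ξ * 𝓕 (zeroExt w) ξ‖ ≤ C / (1 + |2 * Real.pi * ξ|) := by
  have h : FiniteEnergy α w ∧ ∃ C : ℝ, 0 ≤ C ∧ ∀ ξ,
      ‖symb α ξ * 𝓕 (zeroExt w) ξ‖ ≤ C / (1 + |2 * Real.pi * ξ|) := by
    refine Submodule.span_induction (p := fun w _ => FiniteEnergy α w ∧ ∃ C : ℝ, 0 ≤ C ∧ ∀ ξ,
      ‖symb α ξ * 𝓕 (zeroExt w) ξ‖ ≤ C / (1 + |2 * Real.pi * ξ|)) ?_ ?_ ?_ ?_ (mem_span_rodFun hα hw)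
    · rintro _ ⟨n, -, rfl⟩
      refine ⟨(finiteEnergy_rodFun hα n).extendByZero, ?_⟩
      simp only [zeroExt_zeroExt]
      exact exists_norm_symb_mul_fourier_rodFun_le hα.le n
    · refine ⟨FiniteEnergy.zero α, 0, le_rfl, fun ξ => ?_⟩
      have : zeroExt 0 = fun x => 0 * (0 : ℝ → ℂ) x := by ext x; simp [zeroExt]
      rw [this, fourier_const_mul]
      simp
    · rintro v w _ _ ⟨hv, C, hC, h⟩ ⟨hw, D, hD, h'⟩
      refine ⟨hv.add hw, C + D, add_nonneg hC hD, fun ξ => ?_⟩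
      rw [zeroExt_add, fourier_fun_add hv.integrable hw.integrable, mul_add, add_div]
      exact (norm_add_le _ _).trans (add_le_add (h ξ) (h' ξ))
    · rintro c v _ ⟨hv, C, hC, h⟩
      refine ⟨hv.smul c, ‖c‖ * C, by positivity, fun ξ => ?_⟩
      rw [zeroExt_smul, fourier_const_mul, mul_left_comm, norm_mul, mul_div_assoc]
      exact mul_le_mul_of_nonneg_left (h ξ) (norm_nonneg _)
  exact h.2

lemma exists_norm_fourier_le (hα : 0 < α) (hw : w ∈ jacobiSpace α N) :
    ∃ C : ℝ, 0 ≤ C ∧ ∀ ξ, ‖𝓕 (zeroExt w) ξ‖ ≤ C / (1 + |2 * Real.pi * ξ|) := by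
  obtain ⟨C, hC, h⟩ := exists_norm_symb_mul_fourier_le hα hw
  refine ⟨max C (2 * ∫ x, ‖zeroExt w x‖), le_max_of_le_left hC, fun ξ => ?_⟩
  rcases le_total 1 |2 * Real.pi * ξ| with h1 | h1
  · refine le_trans ?_ ((h ξ).trans (by gcongr; exact le_max_left _ _))
    rw [norm_mul, norm_symb]
    exact le_mul_of_one_le_left (norm_nonneg _) (Real.one_le_rpow h1 hα.le)
  · refine (norm_fourier_le _ _).trans ?_
    rw [le_div_iff₀ (by positivity)]
    refine le_trans ?_ (le_max_right _ _)
    rw [mul_comm]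
    have : 0 ≤ ∫ x, ‖zeroExt w x‖ := integral_nonneg fun _ => norm_nonneg _
    exact mul_le_mul_of_nonneg_right (by linarith) this

lemma fourier_conj_neg (f : ℝ → ℂ) (ξ : ℝ) :
    𝓕 (fun x => (starRingEnd ℂ) (f x)) (-ξ) = (starRingEnd ℂ) (𝓕 f ξ) := by
  rw [Real.fourier_real_eq_integral_exp_smul, Real.fourier_real_eq_integral_exp_smul, ← integral_conj]
  congr 1; funext x
  rw [smul_eq_mul, smul_eq_mul, map_mul, ← Complex.exp_conj]
  congr 2
  simp [Complex.conj_ofNat]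

/-- An element of the space is determined by its Riesz derivative on `(-1, 1)`. -/
theorem eq_zero_of_rieszFun_ae_eq_zero (hα : 0 < α) (hw : w ∈ jacobiSpace α N)
    (h0 : rieszFun α w =ᵐ[volume.restrict (Ioo (-1) 1)] 0) : w = 0 := by
  have hE := finiteEnergy_of_mem_jacobiSpace hα hw
  have hze := zeroExt_of_mem_jacobiSpace hα hw
  set f := zeroExt w with hf
  obtain ⟨C, hC, hdC⟩ := exists_norm_symb_mul_fourier_le hα hw
  obtain ⟨D, hD, hdD⟩ := exists_norm_fourier_le hα hw
  rw [← hf] at hdC hdD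
  set k : ℝ → ℂ := fun x => (starRingEnd ℂ) (f x) with hk
  have ik : Integrable k := by
    refine hE.integrable.norm.mono'
      (Complex.continuous_conj.comp_aestronglyMeasurable hE.integrable.aestronglyMeasurable)
      (Eventually.of_forall fun x => ?_)
    rw [hk, RCLike.norm_conj]
  have k0 : ∀ x ∉ Ioo (-1 : ℝ) 1, k x = 0 := by
    intro x hx
    rw [hk]
    simp only [hf, zeroExt_of_notMem _ hx, map_zero]
  have zero : ∀ i, ∫ ξ, 𝓕 f ξ * (symb α ξ * 𝓕 (approx k i) (-ξ)) = 0 := by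
    intro i
    have ht := isTestIn_approx ik k0 i
    have h1 := hE.integral_rieszFun_mul ht.isTest
    have h2 : ∫ x, rieszFun α w x * approx k i x = 0 := by
      rw [← setIntegral_eq_integral_of_forall_compl_eq_zero (s := Ioo (-1 : ℝ) 1)
        (fun x hx => by rw [ht.eq_zero hx, mul_zero])]
      refine integral_eq_zero_of_ae ?_
      filter_upwards [h0] with x hx
      rw [hx]; simp
    rw [h2] at h1
    exact (mul_eq_zero.1 h1.symm).resolve_left (rsign_ne_zero _)
  have lim : Tendsto (fun i => ∫ ξ, 𝓕 f ξ * (symb α ξ * 𝓕 (approx k i) (-ξ))) atTop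
      (𝓝 (∫ ξ, 𝓕 f ξ * (symb α ξ * 𝓕 k (-ξ)))) := by
    refine tendsto_integral_of_dominated_convergence
      (fun ξ => 2 * D * (‖symb α ξ * 𝓕 f ξ‖ * (1 / (1 + |2 * Real.pi * ξ|))))
      (fun i => ?_) (integrable_norm_mul_inv hE.memLp _) (fun i => Eventually.of_forall fun ξ => ?_)
      (Eventually.of_forall fun ξ => ?_)
    · have c1 := (isTestIn_approx ik k0 i).isTest.continuous_fourier
      have c2 := continuous_fourier hE.integrable
      have c4 := continuous_symb hα.le
      refine Continuous.aestronglyMeasurable ?_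
      fun_prop
    · have h1 := half_le_lamSeq i
      set c := lamSeq i
      have hc0 : 0 < c := by linarith
      have h2 : ‖𝓕 (approx k i) (-ξ)‖ ≤ 2 * D * (1 / (1 + |2 * Real.pi * ξ|)) := by
        rw [fourier_approx ik, norm_mul, mul_neg, mul_neg, hk, fourier_conj_neg, RCLike.norm_conj]
        refine (mul_le_of_le_one_left (norm_nonneg _) (norm_fourier_bump_le _)).trans
          ((hdD (c * ξ)).trans ?_)
        rw [mul_comm 2 D, mul_assoc D, div_eq_mul_one_div]
        refine mul_le_mul_of_nonneg_left ?_ hD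
        rw [mul_one_div, div_le_div_iff₀ (by positivity) (by positivity), mul_left_comm (2 * Real.pi),
          abs_mul c, abs_of_pos hc0]
        have := abs_nonneg (2 * Real.pi * ξ)
        nlinarith
      calc ‖𝓕 f ξ * (symb α ξ * 𝓕 (approx k i) (-ξ))‖
          = ‖symb α ξ * 𝓕 f ξ‖ * ‖𝓕 (approx k i) (-ξ)‖ := by
            simp only [norm_mul]; ring
        _ ≤ ‖symb α ξ * 𝓕 f ξ‖ * (2 * D * (1 / (1 + |2 * Real.pi * ξ|))) := by gcongr
        _ = _ := by ring
    · exact tendsto_const_nhds.mul (tendsto_const_nhds.mul (tendsto_fourier_approx ik (-ξ)))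
  simp only [zero] at lim
  have h1 := tendsto_nhds_unique lim tendsto_const_nhds
  have e : ∀ ξ, 𝓕 f ξ * (symb α ξ * 𝓕 k (-ξ)) = ((‖symb α ξ‖ * ‖𝓕 f ξ‖ ^ 2 : ℝ) : ℂ) := by
    intro ξ
    have hs : symb α ξ = (‖symb α ξ‖ : ℂ) := by
      rw [norm_symb, symb]
    rw [hk, fourier_conj_neg]
    conv_lhs => rw [hs]
    rw [mul_left_comm, Complex.mul_conj, Complex.normSq_eq_norm_sq]
    push_cast; ring
  simp only [e] at h1
  rw [integral_complex_ofReal] at h1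
  have h2 : ∫ ξ, ‖symb α ξ‖ * ‖𝓕 f ξ‖ ^ 2 = 0 := by exact_mod_cast h1
  have hcf := continuous_fourier hE.integrable
  have hcs := continuous_symb hα.le
  have hint : Integrable fun ξ => ‖symb α ξ‖ * ‖𝓕 f ξ‖ ^ 2 := by
    refine (integrable_norm_mul_inv hE.memLp D).mono' (by
      refine Continuous.aestronglyMeasurable ?_
      fun_prop) (Eventually.of_forall fun ξ => ?_)
    rw [Real.norm_of_nonneg (by positivity)]
    calc ‖symb α ξ‖ * ‖𝓕 f ξ‖ ^ 2 = ‖symb α ξ * 𝓕 f ξ‖ * ‖𝓕 f ξ‖ := by rw [norm_mul]; ring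
      _ ≤ ‖symb α ξ * 𝓕 f ξ‖ * (D / (1 + |2 * Real.pi * ξ|)) := by gcongr; exact hdD ξ
      _ = _ := by ring
  have h3 := (integral_eq_zero_iff_of_nonneg (fun ξ => by positivity) hint).1 h2
  have hz : 𝓕 f =ᵐ[volume] 0 := by
    filter_upwards [h3, Measure.ae_ne volume (0 : ℝ)] with ξ h hξ
    have h4 : ‖symb α ξ‖ ≠ 0 := by
      rw [norm_symb]
      exact (Real.rpow_pos_of_pos (abs_pos.2 (by simp [hξ, Real.pi_ne_zero])) α).ne'
    have h5 := (mul_eq_zero.1 h).resolve_left h4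
    simpa using h5
  have hz' : 𝓕 f = 0 := (hcf.ae_eq_iff_eq volume continuous_zero).1 hz
  rw [← hze]
  funext x
  by_cases hx : x ∈ Ioo (-1 : ℝ) 1
  · obtain ⟨q, -, hq⟩ := (mem_jacobiSpace_iff hα).1 hw
    have hcont : ContinuousAt f x := by
      have hc : Continuous fun x : ℝ => (wt α x : ℂ) * q.eval (x : ℂ) :=
        (continuous_wt_ofReal hα.le).mul (continuous_eval_ofReal q)
      refine hc.continuousAt.congr ?_
      filter_upwards [isOpen_Ioo.mem_nhds hx] with y hy
      rw [hze, ← hq]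
      exact (zeroExt_of_mem (fun x => (wt α x : ℂ) * q.eval (x : ℂ)) hy).symm
    have h5 := hE.integrable.fourierInv_fourier_eq (by rw [hz']; exact integrable_zero _ _ _) hcont
    rw [hz'] at h5
    rw [hf, ← h5, Real.fourierInv_eq_fourier_neg, Real.fourier_real_eq]
    simp
  · exact zeroExt_of_notMem _ hx

end

end RieszJacobi

end

noncomputable section

namespace RieszJacobi

/-! ### The orthogonal projection -/

section

variable {α : ℝ} {I : TopologicalSpace.Opens ℝ}

lemma FiniteEnergy.memLp_restrict {v : ℝ → ℂ} (h : FiniteEnergy α v) (I : TopologicalSpace.Opens ℝ) :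
    MemLp (rieszFun α v) 2 (volume.restrict I) :=
  h.memLp_rieszFun.restrict _

/-- The class of the Riesz derivative in `L²(I)`. -/
def FiniteEnergy.rieszLp {v : ℝ → ℂ} (h : FiniteEnergy α v) (I : TopologicalSpace.Opens ℝ) :
    Lp ℂ 2 (volume.restrict (I : Set ℝ)) :=
  (h.memLp_restrict I).toLp _

lemma FiniteEnergy.rieszLp_add (hα : 0 < α) {v w : ℝ → ℂ} (hv : FiniteEnergy α v)
    (hw : FiniteEnergy α w) : (hv.add hw).rieszLp I = hv.rieszLp I + hw.rieszLp I := by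
  unfold rieszLp
  rw [← MemLp.toLp_add (hv.memLp_restrict I) (hw.memLp_restrict I), MemLp.toLp_eq_toLp_iff]
  exact ae_restrict_of_ae (hv.rieszFun_add hα hw)

lemma FiniteEnergy.rieszLp_smul (hα : 0 < α) (c : ℂ) {v : ℝ → ℂ} (hv : FiniteEnergy α v) :
    (hv.smul c).rieszLp I = c • hv.rieszLp I := by
  unfold rieszLp
  rw [← MemLp.toLp_const_smul c (hv.memLp_restrict I), MemLp.toLp_eq_toLp_iff]
  exact ae_restrict_of_ae (hv.rieszFun_smul hα c)

lemma FiniteEnergy.rieszLp_congr {v w : ℝ → ℂ} (hv : FiniteEnergy α v) (hw : FiniteEnergy α w)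
    (h : zeroExt v = zeroExt w) : hv.rieszLp I = hw.rieszLp I := by
  have : rieszFun α v = rieszFun α w := by
    unfold rieszFun
    rw [h]
  unfold rieszLp
  rw [MemLp.toLp_eq_toLp_iff, this]

lemma FiniteEnergy.rieszLp_sub (hα : 0 < α) {v w : ℝ → ℂ} (hv : FiniteEnergy α v)
    (hw : FiniteEnergy α w) : (hv.sub hw).rieszLp I = hv.rieszLp I - hw.rieszLp I := by
  rw [rieszLp_congr (hv.sub hw) (hv.add (hw.smul (-1))) (by rw [neg_one_smul, sub_eq_add_neg]),
    rieszLp_add hα hv (hw.smul (-1)), rieszLp_smul hα (-1) hw, neg_one_smul, sub_eq_add_neg]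

lemma FiniteEnergy.rieszOrthogonal_iff (hα : 0 < α) {v z : ℝ → ℂ} (hv : FiniteEnergy α v)
    (hz : FiniteEnergy α z) :
    RieszOrthogonal I α v z ↔ inner ℂ (hz.rieszLp I) (hv.rieszLp I) = 0 := by
  have e : inner ℂ (hz.rieszLp I) (hv.rieszLp I) =
      ∫ x in (I : Set ℝ), rieszFun α v x * (starRingEnd ℂ) (rieszFun α z x) := by
    rw [L2.inner_def]
    refine integral_congr_ae ?_
    filter_upwards [(hv.memLp_restrict I).coeFn_toLp, (hz.memLp_restrict I).coeFn_toLp] with x h1 h2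
    rw [rieszLp, rieszLp, h1, h2, RCLike.inner_apply]
  rw [e]
  constructor
  · rintro ⟨g, h, hg, hh, -, -, h0⟩
    rw [← h0]
    refine integral_congr_ae ?_
    filter_upwards [(hv.isRieszDeriv hα I).ae_eq hg, (hz.isRieszDeriv hα I).ae_eq hh] with x h1 h2
    rw [h1, h2]
  · intro h0
    exact ⟨_, _, hv.isRieszDeriv hα I, hz.isRieszDeriv hα I, hv.memLp_restrict I,
      hz.memLp_restrict I, h0⟩

/-- The Riesz derivative as a linear map on the space of generalized Jacobi functions. -/
def jacobiRiesz (hα : 0 < α) (I : TopologicalSpace.Opens ℝ) (N : ℕ) :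
    jacobiSpace α N →ₗ[ℂ] Lp ℂ 2 (volume.restrict (I : Set ℝ)) where
  toFun w := (finiteEnergy_of_mem_jacobiSpace hα w.2).rieszLp I
  map_add' v w := FiniteEnergy.rieszLp_add hα (finiteEnergy_of_mem_jacobiSpace hα v.2)
    (finiteEnergy_of_mem_jacobiSpace hα w.2)
  map_smul' c w := FiniteEnergy.rieszLp_smul hα c (finiteEnergy_of_mem_jacobiSpace hα w.2)

instance finiteDimensional_jacobiSpace (α : ℝ) (N : ℕ) : FiniteDimensional ℂ (jacobiSpace α N) :=
  FiniteDimensional.span_of_finite ℂ ((finite_le_nat N).image _)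

lemma jacobiRiesz_injective (hα : 0 < α) (hI : Lam ≤ I) (N : ℕ) :
    Function.Injective (jacobiRiesz hα I N) := by
  rw [injective_iff_map_eq_zero]
  intro w hw
  have h1 : rieszFun α w =ᵐ[volume.restrict I] 0 :=
    ((finiteEnergy_of_mem_jacobiSpace hα w.2).memLp_restrict I).coeFn_toLp.symm.trans
      ((Lp.eq_zero_iff_ae_eq_zero).1 hw)
  exact Subtype.ext (eq_zero_of_rieszFun_ae_eq_zero hα w.2
    (ae_restrict_of_ae_restrict_of_subset hI h1))

lemma isRieszProj_iff (hα : 0 < α) {N : ℕ} {u w : ℝ → ℂ} (hu : FiniteEnergy α u)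
    (hw : w ∈ jacobiSpace α N) :
    IsRieszProj I α N u w ↔ jacobiRiesz hα I N ⟨w, hw⟩ =
      (LinearMap.range (jacobiRiesz hα I N)).starProjection (hu.rieszLp I) := by
  have hwE := finiteEnergy_of_mem_jacobiSpace hα hw
  have key : ∀ v (hv : v ∈ jacobiSpace α N), RieszOrthogonal I α (w - u) v ↔
      inner ℂ (jacobiRiesz hα I N ⟨v, hv⟩) (jacobiRiesz hα I N ⟨w, hw⟩ - hu.rieszLp I) = 0 := by
    intro v hv
    rw [(hwE.sub hu).rieszOrthogonal_iff hα (finiteEnergy_of_mem_jacobiSpace hα hv),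
      FiniteEnergy.rieszLp_sub hα hwE hu]
    rfl
  constructor
  · rintro ⟨-, h⟩
    refine (Submodule.eq_starProjection_of_mem_of_inner_eq_zero (LinearMap.mem_range_self _ _) ?_).symm
    rintro _ ⟨v, rfl⟩
    rw [← inner_conj_symm, ← neg_sub, inner_neg_right, (key v v.2).1 (h v v.2)]
    simp
  · intro h
    refine ⟨hw, fun v hv => (key v hv).2 ?_⟩
    have := Submodule.starProjection_inner_eq_zero (K := LinearMap.range (jacobiRiesz hα I N))
      (hu.rieszLp I) _ (LinearMap.mem_range_self _ ⟨v, hv⟩)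
    rw [← h] at this
    rw [← inner_conj_symm, ← neg_sub, inner_neg_left, this]
    simp

end

end RieszJacobi

end

theorem mainTheorem8 (I : TopologicalSpace.Opens ℝ) (hI : I = RieszJacobi.Lam ∨ I = ⊤)
    (α : ℝ) (hα : 0 < α) (ν m : ℕ) (hν : ν ≤ ⌊α⌋₊) (hm : 2 * ν ≤ m + ⌊α⌋₊) :
    ∃ C : ℝ, 0 < C ∧
      ∀ N : ℕ, 1 ≤ N → m ≤ N + 1 + 2 * ν →
        ∀ u : ℝ → ℂ, RieszJacobi.MemHStar α u → RieszJacobi.MemB α ν m u →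
          ∃ w : ℝ → ℂ, (∀ w', RieszJacobi.IsRieszProj I α N u w' ↔ w' = w) ∧
            ∃ e : ℝ → ℂ, RieszJacobi.IsRieszDeriv I α 0 (w - u) e ∧
              ∀ g : ℝ → ℂ, RieszJacobi.IsRieszDeriv RieszJacobi.Lam (2 * α - 2 * ν) m u g →
                eLpNorm e 2 (volume.restrict I) ≤
                  ENNReal.ofReal (C * (N : ℝ) ^ (2 * (ν : ℝ) - α - m)) *
                    eLpNorm g 2 (RieszJacobi.jacobiMeasure (α - 2 * ν + m)) := by
  have hfl := Nat.floor_le hα.le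
  have hν' : (ν : ℝ) ≤ α := (Nat.cast_le.2 hν).trans hfl
  have hβ : 0 ≤ α - 2 * ν + m := by
    have : (2 * ν : ℝ) ≤ m + ⌊α⌋₊ := by exact_mod_cast hm
    linarith
  have hLI : RieszJacobi.Lam ≤ I := by
    rcases hI with rfl | rfl
    · exact le_rfl
    · exact le_top
  obtain ⟨C, hC, hest⟩ := RieszJacobi.exists_eLpNorm_sub_rodSum_le hα hν' hβ
  refine ⟨C, hC, fun N hN hmN u hu hB => ?_⟩
  have hE := hu.finiteEnergy hα
  set K := LinearMap.range (RieszJacobi.jacobiRiesz hα I N) with hK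
  obtain ⟨⟨w, hw⟩, hwe⟩ : K.starProjection (hE.rieszLp I) ∈ K :=
    Submodule.starProjection_apply_mem _ _
  have hwE := RieszJacobi.finiteEnergy_of_mem_jacobiSpace hα hw
  refine ⟨w, fun w' => ⟨fun h' => ?_, ?_⟩, _, (hwE.sub hE).isRieszDeriv hα I, fun g hg => ?_⟩
  · have h1 := (RieszJacobi.isRieszProj_iff hα hE h'.1).1 h'
    exact congrArg Subtype.val (RieszJacobi.jacobiRiesz_injective hα hLI N (h1.trans hwe.symm))
  · rintro rfl
    exact (RieszJacobi.isRieszProj_iff hα hE hw).2 hwe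
  · refine le_trans ?_ (hest N hN hmN u hE hB.1 g hg)
    have hs := RieszJacobi.finiteEnergy_rodSum hα u N
    have hsm := RieszJacobi.zeroExt_rodSum_mem hα u N
    have e1 : eLpNorm (RieszJacobi.rieszFun α (w - u)) 2 (volume.restrict I) =
        ‖hE.rieszLp I - K.starProjection (hE.rieszLp I)‖ₑ := by
      rw [← hwe, ← enorm_neg, neg_sub]
      have := RieszJacobi.FiniteEnergy.rieszLp_sub (I := I) hα hwE hE
      refine Eq.trans ?_ (congrArg enorm this)
      exact (Lp.enorm_toLp ((hwE.sub hE).memLp_restrict I)).symm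
    have e2 : ‖hE.rieszLp I - hs.rieszLp I‖ₑ =
        eLpNorm (RieszJacobi.rieszFun α (u - RieszJacobi.rodSum α u N)) 2 (volume.restrict I) := by
      rw [← RieszJacobi.FiniteEnergy.rieszLp_sub (I := I) hα hE hs]
      exact Lp.enorm_toLp ((hE.sub hs).memLp_restrict I)
    have hsK : hs.rieszLp I ∈ K := by
      refine ⟨⟨_, hsm⟩, ?_⟩
      exact RieszJacobi.FiniteEnergy.rieszLp_congr hs.extendByZero hs (RieszJacobi.zeroExt_zeroExt _)
    have hle : ‖hE.rieszLp I - K.starProjection (hE.rieszLp I)‖ ≤ ‖hE.rieszLp I - hs.rieszLp I‖ := by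
      have ho : inner ℂ (hE.rieszLp I - K.starProjection (hE.rieszLp I))
          (K.starProjection (hE.rieszLp I) - hs.rieszLp I) = 0 :=
        Submodule.starProjection_inner_eq_zero _ _
          (K.sub_mem (Submodule.starProjection_apply_mem _ _) hsK)
      have h2 := norm_add_sq_eq_norm_sq_add_norm_sq_of_inner_eq_zero _ _ ho
      rw [sub_add_sub_cancel] at h2
      nlinarith [norm_nonneg (hE.rieszLp I - K.starProjection (hE.rieszLp I)),
        norm_nonneg (hE.rieszLp I - hs.rieszLp I),
        norm_nonneg (K.starProjection (hE.rieszLp I) - hs.rieszLp I)]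
    rw [e1, ← (hE.sub hs).eLpNorm_rieszFun]
    refine le_trans ?_ (eLpNorm_mono_measure _ (Measure.restrict_le_self (s := (I : Set ℝ))))
    rw [← e2, ← ofReal_norm, ← ofReal_norm]
    exact ENNReal.ofReal_le_ofReal hle
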